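/- Let $d \ge 3$ and $n$ be natural numbers, let $0 < \sigma \le 1$, and let $y_1,\dots,y_n \in [-1,1]^d$ be chosen by an adversary. Let $x_i = y_i + g_i$, where $g_1,\dots,g_n$ are independent Gaussian vectors in $\mathbb{R}^d$ with mean $0$ and covariance matrix $\sigma^2 I_d$, and consider the Travelling Salesperson Problem on $x_1,\dots,x_n$ with Euclidean distances. One iteration of the 2-opt heuristic replaces the current tour by a strictly shorter tour that arises from it by exchanging a set of two edges $\{e_1,e_2\}$ of the tour for a set of two edges $\{f_1,f_2\}$ that is not contained in the tour. Let $T(x_1,\dots,x_n)$ be the largest number of consecutive iterations that 2-opt can perform, over all initial tours and all choices of the improving exchanges. For $c \ge 2$ put $D = c\,(1+\sigma\sqrt{n\log n})$ (with $n \log n$ read as $0$ for $n = 0$). Then $$\mathbb{E}\,[T(x_1,\dots,x_n)] \;\le\; K\,\frac{\sqrt{d}\,D^2 n^4}{\sigma^2},$$ where $K$ is an absolute constant: it depends on none of $c, d, n, \sigma, y_1,\dots,y_n$. -/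

import Mathlib

open MeasureTheory ProbabilityTheory
open scoped ENNReal NNReal

namespace TwoOpt

/-- The ambient space `ℝ^d` with the Euclidean norm. -/
abbrev Space (d : ℕ) : Type := EuclideanSpace ℝ (Fin d)

/-- A tour through `n` points, given by the order `π 0, π 1, …, π (n-1)` in which it visits them.
Orders that differ by a rotation or a reversal describe the same tour; they have the same edges and
the same length, and everything below depends on a tour only through these two. -/
abbrev Tour (n : ℕ) : Type := Equiv.Perm (Fin n)

/-- The (undirected) edges of a tour; `finRotate n i` is `i + 1` modulo `n`. -/
def Tour.edges {n : ℕ} (π : Tour n) : Finset (Sym2 (Fin n)) :=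
  Finset.univ.image fun i => s(π i, π (finRotate n i))

/-- The Euclidean length of a tour on the instance `x`. -/
noncomputable def Tour.length {n d : ℕ} (x : Fin n → Space d) (π : Tour n) : ℝ :=
  ∑ i, ‖x (π i) - x (π (finRotate n i))‖

/-- `π'` arises from `π` by a 2-change: a set of two edges of `π` is exchanged for a set of two
edges that is not contained in `π`, and the outcome is again a tour. -/
def IsTwoChange {n : ℕ} (π π' : Tour n) : Prop :=
  ∃ e₁ e₂ f₁ f₂ : Sym2 (Fin n), e₁ ≠ e₂ ∧ f₁ ≠ f₂ ∧
    {e₁, e₂} ⊆ π.edges ∧ ¬ ({f₁, f₂} ⊆ π.edges) ∧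
    π'.edges = (π.edges \ {e₁, e₂}) ∪ {f₁, f₂}

/-- One iteration of 2-opt on the instance `x`: a 2-change that strictly shortens the tour. -/
def IsIteration {n d : ℕ} (x : Fin n → Space d) (π π' : Tour n) : Prop :=
  IsTwoChange π π' ∧ π'.length x < π.length x

/-- 2-opt can perform `t` consecutive iterations on the instance `x`, from some initial tour and
with some choice of the improving 2-changes. -/
def HasRun {n d : ℕ} (x : Fin n → Space d) (t : ℕ) : Prop :=
  ∃ T : ℕ → Tour n, ∀ k < t, IsIteration x (T k) (T (k + 1))

/-- The number of iterations of 2-opt on the instance `x`, for the worst initial tour and the worst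
choice of improving 2-changes. -/
noncomputable def iterations {n d : ℕ} (x : Fin n → Space d) : ℝ≥0∞ :=
  ⨆ (t : ℕ) (_ : HasRun x t), (t : ℝ≥0∞)

/-- The law of `n` independent `d`-dimensional Gaussian vectors with mean `0` and covariance
`σ² I`. -/
noncomputable def gaussianNoise (n d : ℕ) (σ : ℝ) : Measure (Fin n → Fin d → ℝ) :=
  Measure.pi fun _ => Measure.pi fun _ => gaussianReal 0 (σ ^ 2).toNNReal

/-- The instance `y`, perturbed by the noise `g`. -/
noncomputable def perturb {n d : ℕ} (y : Fin n → Space d) (g : Fin n → Fin d → ℝ) :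
    Fin n → Space d :=
  fun i => y i + WithLp.toLp 2 (g i)

/-- The expected number of iterations of 2-opt on the instance `y` perturbed by independent
Gaussians of standard deviation `σ`. -/
noncomputable def expectedIterations {n d : ℕ} (y : Fin n → Space d) (σ : ℝ) : ℝ≥0∞ :=
  ∫⁻ g, iterations (perturb y g) ∂(gaussianNoise n d σ)

/-- The quantity `D = c (1 + σ √(n log n))`. -/
noncomputable def boxSize (c σ : ℝ) (n : ℕ) : ℝ :=
  c * (1 + σ * Real.sqrt (n * Real.log n))

end TwoOpt

namespace TwoOpt

/-! Combinatorial side. Two exchanges of a run are linked if the second removes an edge that the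
first has added. An exchange without a link leaves an added edge that survives to the end, so there
are at most n of them. If every linked pair contains a gain of at least ε, the run has length at
most 2n + 12 S/ε, where S = ∑ ‖x i‖ is of order n√d (`card_mul_le_of_links`, `HasRun.mul_le`). A
linked pair involves six vertices, or five after one coincidence. With two coincidences it either
undoes the first exchange, which is impossible, or runs through the third pairing of the same four
vertices, which cannot happen twice in succession.

Probabilistic side. With all points but one fixed, a gain is, up to a constant and a sign, the
difference of the distances of a Gaussian point to two fixed points b and c. In cylindrical
coordinates around the line bc the volume factor cancels the zeros of the derivative of this
difference, which bounds its density; three dimensions are needed for this factor. For a Gaussian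
point with mean m the bound is singular where c approaches the line mb. That line has codimension at
least two, so the moments of order below 2 over a Gaussian point c are finite; order 5/3 is the one
used (`exists_window_bound`). With η of order ε/σ², a linked pair on six vertices has two gains in
[0, ε] with probability at most η², and one on five vertices with probability at most 2η^(5/3)
(`exists_pairMass_le`).

There are at most n^6 and 2n^5 such pairs, and n^6 η² and n^5 η^(5/3) become small at the same
threshold η = n^(-3); this is the reason for the exponent 5/3. At the scale ε = 8^(-k)/M with M of
order n³/σ², the expected number of small pairs is at most 5 · 32^(-k). If k is the first scale
without small pairs, the run has length at most 2n + 12 S 8^k M, and the inequality s w³ ≤ s⁴ + w⁴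
separates S from the random k: what remains is a fourth moment of S and the sum of 16^k · 32^(-k)
(`iterations_le`). The outcome is of order √d n⁴/σ², and the factor D² ≥ 1 is only given away. -/

/-! ### Isotropic Gaussian measures -/

/-- The centered Gaussian measure on `ℝ^d` with covariance matrix `τ² I`. -/
noncomputable def isoGaussian (d : ℕ) (τ : ℝ) : Measure (Space d) :=
  (Measure.pi fun _ : Fin d => gaussianReal 0 (τ ^ 2).toNNReal).map (WithLp.toLp 2)

instance isProbabilityMeasure_isoGaussian (d : ℕ) (τ : ℝ) :
    IsProbabilityMeasure (isoGaussian d τ) :=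
  Measure.isProbabilityMeasure_map (by fun_prop)

lemma charFun_isoGaussian (d : ℕ) (τ : ℝ) (t : Space d) :
    charFun (isoGaussian d τ) t = Complex.exp (-(τ ^ 2 * ‖t‖ ^ 2 / 2 : ℝ)) := by
  rw [isoGaussian, charFun_pi]
  simp_rw [charFun_gaussianReal, ← Complex.exp_sum]
  congr 1
  rw [EuclideanSpace.real_norm_sq_eq, Finset.mul_sum, Finset.sum_div, Complex.ofReal_sum,
    ← Finset.sum_neg_distrib]
  refine Finset.sum_congr rfl fun i _ => ?_
  rw [Real.coe_toNNReal _ (sq_nonneg τ)]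
  push_cast
  ring

lemma isoGaussian_map_linearIsometryEquiv (d : ℕ) (τ : ℝ) (f : Space d ≃ₗᵢ[ℝ] Space d) :
    (isoGaussian d τ).map f = isoGaussian d τ := by
  have hf : Measurable f := f.continuous.measurable
  have : IsProbabilityMeasure ((isoGaussian d τ).map f) :=
    Measure.isProbabilityMeasure_map hf.aemeasurable
  apply Measure.ext_of_charFun
  ext t
  have h : charFun ((isoGaussian d τ).map f) t = charFun (isoGaussian d τ) (f.symm t) := by
    rw [charFun_apply, charFun_apply, integral_map hf.aemeasurable (by fun_prop)]
    refine integral_congr_ae (Filter.Eventually.of_forall fun x => ?_)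
    have : inner ℝ (f x) t = inner ℝ x (f.symm t) := by
      rw [← f.inner_map_map x (f.symm t), f.apply_symm_apply]
    simp only [this]
  rw [h, charFun_isoGaussian, charFun_isoGaussian, f.symm.norm_map]

/-- Splitting the noise into two independent halves lets one half provide a bounded density, while
the other averages out the singularities of that bound as a function of the mean. -/
lemma lintegral_isoGaussian_add (d : ℕ) {σ τ : ℝ} (h : σ ^ 2 = τ ^ 2 + τ ^ 2)
    {F : Space d → ℝ≥0∞} (hF : Measurable F) :
    ∫⁻ x, F x ∂isoGaussian d σ = ∫⁻ u, ∫⁻ v, F (u + v) ∂isoGaussian d τ ∂isoGaussian d τ := by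
  have : isoGaussian d σ = isoGaussian d τ ∗ isoGaussian d τ := by
    apply Measure.ext_of_charFun
    ext t
    rw [charFun_conv, charFun_isoGaussian, charFun_isoGaussian, ← Complex.exp_add, h]
    congr 1
    push_cast
    ring
  rw [this, Measure.lintegral_conv hF]

lemma lintegral_isoGaussian (d : ℕ) (τ : ℝ) {F : Space d → ℝ≥0∞} (hF : Measurable F) :
    ∫⁻ x, F x ∂isoGaussian d τ =
      ∫⁻ w, F (WithLp.toLp 2 w) ∂(Measure.pi fun _ : Fin d => gaussianReal 0 (τ ^ 2).toNNReal) := by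
  rw [isoGaussian, lintegral_map hF (by fun_prop)]

/-- The coordinates of a Gaussian vector in an orthonormal basis are independent Gaussians. -/
lemma lintegral_isoGaussian_repr {d : ℕ} (τ : ℝ) (b : OrthonormalBasis (Fin d) ℝ (Space d))
    (m : Space d) {F : (Fin d → ℝ) → ℝ≥0∞} (hF : Measurable F) :
    ∫⁻ x, F (fun i => b.repr (m + x) i) ∂isoGaussian d τ =
      ∫⁻ w, F w ∂(Measure.pi fun i => gaussianReal (b.repr m i) (τ ^ 2).toNNReal) := by
  have hm : Measurable fun x : Space d => F fun i => b.repr m i + x i := by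
    apply hF.comp
    fun_prop
  have hrepr : Measurable b.repr := b.repr.continuous.measurable
  have h1 : ∫⁻ x, F (fun i => b.repr (m + x) i) ∂isoGaussian d τ =
      ∫⁻ x, F (fun i => b.repr m i + x i) ∂isoGaussian d τ := by
    conv_rhs => rw [← isoGaussian_map_linearIsometryEquiv d τ b.repr]
    rw [lintegral_map hm hrepr]
    simp only [map_add, PiLp.add_apply]
  rw [h1, lintegral_isoGaussian d τ hm]
  have h2 : (Measure.pi fun i => gaussianReal (b.repr m i) (τ ^ 2).toNNReal) =
      (Measure.pi fun _ : Fin d => gaussianReal 0 (τ ^ 2).toNNReal).map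
        (fun w i => b.repr m i + w i) := by
    have := Measure.pi_map_pi (μ := fun _ : Fin d => gaussianReal 0 (τ ^ 2).toNNReal)
      (f := fun i x => b.repr m i + x) (fun i => by fun_prop)
    rw [this]
    congr 1
    ext1 i
    rw [gaussianReal_map_const_add, zero_add]
  rw [h2, lintegral_map hF (by fun_prop)]

/-- Resampling one coordinate preserves a product measure. In this form Fubini integrates out one
coordinate or one point without changing the index type. -/
lemma lintegral_pi_update {ι : Type*} [Fintype ι] [DecidableEq ι] {X : ι → Type*}
    [∀ i, MeasurableSpace (X i)] (μ : ∀ i, Measure (X i)) [∀ i, IsProbabilityMeasure (μ i)]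
    (i : ι) {f : (∀ i, X i) → ℝ≥0∞} (hf : Measurable f) :
    ∫⁻ x, f x ∂Measure.pi μ = ∫⁻ x, ∫⁻ z, f (Function.update x i z) ∂μ i ∂Measure.pi μ := by
  refine lintegral_eq_of_lmarginal_eq {i} hf ?_ ?_
  · have := hf.lmarginal (s := {i}) μ
    rwa [lmarginal_singleton] at this
  · ext x
    simp [lmarginal_singleton]

/-! ### Moments -/

/-- This follows from |x|^m ≤ m! e^|x| ≤ m! (e^x + e^(-x)), since both exponential moments are at
most e^(1/2) ≤ 2. -/
lemma lintegral_pow_abs_gaussianReal_le {τ : ℝ} (h0 : 0 ≤ τ) (h1 : τ ≤ 1) (m : ℕ) :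
    ∫⁻ x, ENNReal.ofReal (|x| ^ m) ∂gaussianReal 0 (τ ^ 2).toNNReal ≤
      ENNReal.ofReal (4 * m.factorial) := by
  have hexp : ∀ s : ℝ, s ^ 2 = 1 → ∫⁻ x, ENNReal.ofReal (Real.exp (s * x))
      ∂gaussianReal 0 (τ ^ 2).toNNReal ≤ ENNReal.ofReal 2 := by
    intro s hs
    rw [← ofReal_integral_eq_lintegral_ofReal (integrable_exp_mul_gaussianReal s)
      (Filter.Eventually.of_forall fun x => (Real.exp_pos _).le)]
    apply ENNReal.ofReal_le_ofReal
    have := congrFun (mgf_id_gaussianReal (μ := 0) (v := (τ ^ 2).toNNReal)) s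
    simp only [mgf, id] at this
    rw [this, hs, Real.coe_toNNReal _ (sq_nonneg τ)]
    have : Real.exp (0 * s + τ ^ 2 * 1 / 2) ≤ Real.exp (1 / 2) := by
      apply Real.exp_le_exp.2
      nlinarith
    refine this.trans ?_
    have h := Real.exp_one_lt_d9
    have h2 : Real.exp (1 / 2) ^ 2 = Real.exp 1 := by
      rw [← Real.exp_nat_mul]; norm_num
    nlinarith [Real.exp_pos (1 / 2)]
  calc ∫⁻ x, ENNReal.ofReal (|x| ^ m) ∂gaussianReal 0 (τ ^ 2).toNNReal
      ≤ ∫⁻ x, ENNReal.ofReal m.factorial * (ENNReal.ofReal (Real.exp (1 * x)) +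
          ENNReal.ofReal (Real.exp (-1 * x))) ∂gaussianReal 0 (τ ^ 2).toNNReal := by
        refine lintegral_mono fun x => ?_
        rw [← ENNReal.ofReal_add (Real.exp_pos _).le (Real.exp_pos _).le,
          ← ENNReal.ofReal_mul (by positivity)]
        apply ENNReal.ofReal_le_ofReal
        have hf : (0 : ℝ) < m.factorial := by positivity
        have := Real.pow_div_factorial_le_exp |x| (abs_nonneg x) m
        rw [div_le_iff₀ hf] at this
        refine this.trans ?_
        rw [mul_comm]
        apply mul_le_mul_of_nonneg_left _ hf.le
        rcases abs_cases x with h | h <;> rw [h.1]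
        · simpa using (Real.exp_pos (-x)).le
        · simpa using (Real.exp_pos x).le
    _ = ENNReal.ofReal m.factorial * (∫⁻ x, ENNReal.ofReal (Real.exp (1 * x))
          ∂gaussianReal 0 (τ ^ 2).toNNReal + ∫⁻ x, ENNReal.ofReal (Real.exp (-1 * x))
          ∂gaussianReal 0 (τ ^ 2).toNNReal) := by
        rw [lintegral_const_mul _ (by fun_prop), lintegral_add_left (by fun_prop)]
    _ ≤ ENNReal.ofReal m.factorial * (ENNReal.ofReal 2 + ENNReal.ofReal 2) := by
        gcongr
        · exact hexp 1 (by norm_num)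
        · exact hexp (-1) (by norm_num)
    _ = ENNReal.ofReal (4 * m.factorial) := by
        rw [← ENNReal.ofReal_add (by norm_num) (by norm_num), ← ENNReal.ofReal_mul (by positivity)]
        congr 1
        ring

lemma lintegral_sq_gaussianReal (m τ : ℝ) :
    ∫⁻ x, ENNReal.ofReal (x ^ 2) ∂gaussianReal m (τ ^ 2).toNNReal =
      ENNReal.ofReal (m ^ 2 + τ ^ 2) := by
  have h2 : MemLp id 2 (gaussianReal m (τ ^ 2).toNNReal) := memLp_id_gaussianReal 2
  rw [← ofReal_integral_eq_lintegral_ofReal (f := fun x : ℝ => x ^ 2) h2.integrable_sq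
    (Filter.Eventually.of_forall fun x => sq_nonneg x)]
  congr 1
  have hv := variance_eq_sub h2
  rw [variance_id_gaussianReal, Real.coe_toNNReal _ (sq_nonneg τ)] at hv
  simp only [id, integral_id_gaussianReal, Pi.pow_apply] at hv
  linarith

lemma lintegral_pi_eval {d : ℕ} (μ : Fin d → Measure ℝ) [∀ i, IsProbabilityMeasure (μ i)]
    (i : Fin d) {f : ℝ → ℝ≥0∞} (hf : Measurable f) :
    ∫⁻ w, f (w i) ∂Measure.pi μ = ∫⁻ x, f x ∂μ i := by
  rw [lintegral_pi_update μ i (f := fun w => f (w i)) (by fun_prop)]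
  simp

/-- By the power mean inequality, (‖x‖²/d)^j is at most the average of the x_i^(2j); the bound is
therefore free of d. -/
lemma lintegral_norm_pow_isoGaussian_le {d : ℕ} (hd : 0 < d) {τ : ℝ} (h0 : 0 ≤ τ) (h1 : τ ≤ 1)
    (j : ℕ) :
    ∫⁻ x, ENNReal.ofReal ((‖x‖ / √d) ^ (2 * j)) ∂isoGaussian d τ ≤
      ENNReal.ofReal (4 * (2 * j).factorial) := by
  have hd' : (0 : ℝ) < d := by exact_mod_cast hd
  rw [lintegral_isoGaussian d τ (by fun_prop)]
  calc _ ≤ ∫⁻ w, ∑ i : Fin d, ENNReal.ofReal (1 / d) * ENNReal.ofReal (|w i| ^ (2 * j))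
        ∂(Measure.pi fun _ : Fin d => gaussianReal 0 (τ ^ 2).toNNReal) := by
        refine lintegral_mono fun w => ?_
        simp_rw [← ENNReal.ofReal_mul (show (0 : ℝ) ≤ 1 / d by positivity)]
        rw [← ENNReal.ofReal_sum_of_nonneg (fun i _ => by positivity)]
        apply ENNReal.ofReal_le_ofReal
        have key := Real.pow_arith_mean_le_arith_mean_pow Finset.univ (fun _ : Fin d => 1 / (d : ℝ))
          (fun i => w i ^ 2) (fun i _ => by positivity)
          (by simp [hd'.ne']) (fun i _ => sq_nonneg _) j
        rw [pow_mul, div_pow, Real.sq_sqrt hd'.le, EuclideanSpace.real_norm_sq_eq]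
        simp_rw [← Finset.mul_sum] at key ⊢
        rw [div_eq_inv_mul, ← one_div]
        refine key.trans (le_of_eq ?_)
        congr 1
        refine Finset.sum_congr rfl fun i _ => ?_
        rw [pow_mul, sq_abs]
    _ = ∑ i : Fin d, ENNReal.ofReal (1 / d) *
          ∫⁻ x, ENNReal.ofReal (|x| ^ (2 * j)) ∂gaussianReal 0 (τ ^ 2).toNNReal := by
        rw [lintegral_finsetSum _ (fun i _ => by fun_prop)]
        refine Finset.sum_congr rfl fun i _ => ?_
        rw [lintegral_const_mul _ (by fun_prop)]
        rw [lintegral_pi_eval _ i (f := fun x => ENNReal.ofReal (|x| ^ (2 * j))) (by fun_prop)]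
    _ ≤ ∑ i : Fin d, ENNReal.ofReal (1 / d) * ENNReal.ofReal (4 * (2 * j).factorial) := by
        gcongr
        exact lintegral_pow_abs_gaussianReal_le h0 h1 _
    _ = ENNReal.ofReal (4 * (2 * j).factorial) := by
        rw [Finset.sum_const, Finset.card_univ, Fintype.card_fin, nsmul_eq_mul, ← mul_assoc,
          ← ENNReal.ofReal_natCast, ← ENNReal.ofReal_mul (by positivity),
          mul_one_div_cancel hd'.ne', ENNReal.ofReal_one, one_mul]

/-! ### The difference of two distances in cylindrical coordinates -/

lemma mul_exp_neg_sq_div_le (x : ℝ) : x * Real.exp (-(x ^ 2 / 16)) ≤ 2 := by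
  rw [Real.exp_neg, ← div_eq_mul_inv, div_le_iff₀ (Real.exp_pos _)]
  nlinarith [Real.add_one_le_exp (x ^ 2 / 16), sq_nonneg (x / 4 - 1)]

lemma lintegral_ofReal_exp_neg_mul_sq {b : ℝ} (hb : 0 < b) (m : ℝ) :
    ∫⁻ x : ℝ, ENNReal.ofReal (Real.exp (-b * (x - m) ^ 2)) = ENNReal.ofReal √(Real.pi / b) := by
  rw [lintegral_sub_right_eq_self (fun x => ENNReal.ofReal (Real.exp (-b * x ^ 2))) m,
    ← ofReal_integral_eq_lintegral_ofReal (integrable_exp_neg_mul_sq hb)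
      (Filter.Eventually.of_forall fun x => (Real.exp_pos _).le), integral_gaussian]

/-- A planar Gaussian centred at distance m from the origin is seen from there under an angle of
order τ/m. If ρ ≥ m/2, the inequality cos ψ ≤ 1 - 2ψ²/π² bounds the angular factor by a Gaussian of
width of order τ/√(ρm). If ρ < m/2, then |ρ - m| > m/2, and half of the radial exponent already pays
for a factor 4τ/m. -/
lemma lintegral_angular_le {τ m ρ : ℝ} (hτ : 0 < τ) (hm : 0 < m) (hρ : 0 < ρ) :
    ∫⁻ ψ in Set.Ioo (-Real.pi) Real.pi,
        ENNReal.ofReal (Real.exp (-((ρ * Real.cos ψ - m) ^ 2 + (ρ * Real.sin ψ) ^ 2) / (2 * τ ^ 2)))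
      ≤ ENNReal.ofReal (8 * Real.pi * τ / m * Real.exp (-((ρ - m) ^ 2 / (4 * τ ^ 2)))) := by
  have hpi := Real.pi_pos
  have hpi3 := Real.pi_gt_three
  have hpi4 := Real.pi_le_four
  have hsplit : ∀ ψ, -((ρ * Real.cos ψ - m) ^ 2 + (ρ * Real.sin ψ) ^ 2) / (2 * τ ^ 2) =
      -((ρ - m) ^ 2 / (2 * τ ^ 2)) - ρ * m / τ ^ 2 * (1 - Real.cos ψ) := by
    intro ψ
    have : (ρ * Real.sin ψ) ^ 2 = ρ ^ 2 - (ρ * Real.cos ψ) ^ 2 := by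
      rw [mul_pow, mul_pow, Real.sin_sq]; ring
    rw [this]
    field_simp
    ring
  have hexpm : Real.exp (-((ρ - m) ^ 2 / (2 * τ ^ 2))) ≤
      Real.exp (-((ρ - m) ^ 2 / (4 * τ ^ 2))) := by
    apply Real.exp_le_exp.2
    apply neg_le_neg
    apply div_le_div_of_nonneg_left (sq_nonneg _) (by positivity)
    nlinarith [sq_nonneg τ]
  by_cases hcase : m / 2 ≤ ρ
  · set b := 2 / Real.pi ^ 2 * (ρ * m / τ ^ 2) with hb
    have hb0 : 0 < b := by positivity
    calc _ ≤ ∫⁻ ψ in Set.Ioo (-Real.pi) Real.pi,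
          ENNReal.ofReal (Real.exp (-((ρ - m) ^ 2 / (4 * τ ^ 2)))) *
            ENNReal.ofReal (Real.exp (-b * (ψ - 0) ^ 2)) := by
          refine setLIntegral_mono (by fun_prop) fun ψ hψ => ?_
          rw [← ENNReal.ofReal_mul (Real.exp_pos _).le]
          apply ENNReal.ofReal_le_ofReal
          rw [hsplit, sub_eq_add_neg, Real.exp_add]
          apply mul_le_mul hexpm _ (Real.exp_pos _).le (Real.exp_pos _).le
          apply Real.exp_le_exp.2
          have hc := Real.cos_le_one_sub_mul_cos_sq (x := ψ) (abs_le.2 ⟨hψ.1.le, hψ.2.le⟩)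
          have h0 : 0 ≤ ρ * m / τ ^ 2 := by positivity
          rw [hb]
          nlinarith
      _ ≤ ENNReal.ofReal (Real.exp (-((ρ - m) ^ 2 / (4 * τ ^ 2)))) *
            ENNReal.ofReal √(Real.pi / b) := by
          rw [lintegral_const_mul _ (by fun_prop)]
          gcongr
          refine (setLIntegral_le_lintegral _ _).trans ?_
          rw [lintegral_ofReal_exp_neg_mul_sq hb0]
      _ ≤ _ := by
          rw [← ENNReal.ofReal_mul (Real.exp_pos _).le]
          apply ENNReal.ofReal_le_ofReal
          rw [mul_comm]
          apply mul_le_mul_of_nonneg_right _ (Real.exp_pos _).le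
          rw [Real.sqrt_le_left (by positivity), hb]
          have : Real.pi / (2 / Real.pi ^ 2 * (ρ * m / τ ^ 2)) =
            Real.pi ^ 3 * τ ^ 2 / (2 * ρ * m) := by
            field_simp
          rw [this, div_pow, div_le_div_iff₀ (by positivity) (by positivity)]
          have h1 : Real.pi ^ 3 * τ ^ 2 * m ^ 2 ≤ Real.pi ^ 3 * τ ^ 2 * (2 * ρ * m) := by
            apply mul_le_mul_of_nonneg_left _ (by positivity)
            nlinarith
          refine h1.trans ?_
          apply mul_le_mul_of_nonneg_right _ (by positivity)
          have : Real.pi ^ 2 * τ ^ 2 * Real.pi ≤ Real.pi ^ 2 * τ ^ 2 * 64 := by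
            apply mul_le_mul_of_nonneg_left _ (by positivity)
            linarith
          nlinarith
  · push Not at hcase
    calc _ ≤ ∫⁻ ψ in Set.Ioo (-Real.pi) Real.pi,
          ENNReal.ofReal (4 * τ / m * Real.exp (-((ρ - m) ^ 2 / (4 * τ ^ 2)))) := by
          refine setLIntegral_mono (by fun_prop) fun ψ hψ => ?_
          apply ENNReal.ofReal_le_ofReal
          rw [hsplit]
          have h0 : 0 ≤ ρ * m / τ ^ 2 * (1 - Real.cos ψ) :=
            mul_nonneg (by positivity) (by linarith [Real.cos_le_one ψ])
          calc _ ≤ Real.exp (-((ρ - m) ^ 2 / (2 * τ ^ 2))) := Real.exp_le_exp.2 (by linarith)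
            _ = Real.exp (-((ρ - m) ^ 2 / (4 * τ ^ 2))) *
                Real.exp (-((ρ - m) ^ 2 / (4 * τ ^ 2))) := by
                rw [← Real.exp_add]; congr 1; field_simp; ring
            _ ≤ Real.exp (-((m / τ) ^ 2 / 16)) * Real.exp (-((ρ - m) ^ 2 / (4 * τ ^ 2))) := by
                apply mul_le_mul_of_nonneg_right _ (Real.exp_pos _).le
                apply Real.exp_le_exp.2
                apply neg_le_neg
                rw [div_pow, div_div, div_le_div_iff₀ (by positivity) (by positivity)]
                have : m ^ 2 ≤ 4 * (ρ - m) ^ 2 := by nlinarith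
                nlinarith [sq_nonneg τ]
            _ ≤ 4 * τ / m * Real.exp (-((ρ - m) ^ 2 / (4 * τ ^ 2))) := by
                apply mul_le_mul_of_nonneg_right _ (Real.exp_pos _).le
                have h := mul_exp_neg_sq_div_le (m / τ)
                rw [← le_div_iff₀' (by positivity)] at h
                refine h.trans ?_
                rw [div_div_eq_mul_div]
                apply div_le_div_of_nonneg_right _ hm.le
                linarith
      _ = _ := by
          rw [setLIntegral_const, Real.volume_Ioo, ← ENNReal.ofReal_mul (by positivity)]
          congr 1
          ring

/-- On a circle around one focus, the difference of the distances to the foci is a monotone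
function of the angle, and its derivative is known. -/
lemma lintegral_circle_le {r t B : ℝ} (hr : 0 < r) (ht : 0 < t) (J : ℝ → ℝ≥0∞) :
    ∫⁻ φ in Set.Ioo 0 Real.pi,
      ENNReal.ofReal (r * t * Real.sin φ /
        √((r * Real.cos φ - t) ^ 2 + (r * Real.sin φ) ^ 2 + B ^ 2)) *
      J (√(r ^ 2 + B ^ 2) - √((r * Real.cos φ - t) ^ 2 + (r * Real.sin φ) ^ 2 + B ^ 2)) ≤
      ∫⁻ u, J u := by
  set v : ℝ → ℝ := fun φ => (r * Real.cos φ - t) ^ 2 + (r * Real.sin φ) ^ 2 + B ^ 2 with hv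
  have hv' : ∀ φ, v φ = r ^ 2 + t ^ 2 + B ^ 2 - 2 * r * t * Real.cos φ := by
    intro φ
    have := Real.sin_sq_add_cos_sq φ
    simp only [hv]
    linear_combination r ^ 2 * this
  have hpos : ∀ φ ∈ Set.Ioo 0 Real.pi, 0 < v φ := by
    intro φ hφ
    have := Real.sin_pos_of_pos_of_lt_pi hφ.1 hφ.2
    simp only [hv]
    positivity
  have hderiv : ∀ φ ∈ Set.Ioo 0 Real.pi, HasDerivWithinAt (fun φ => √(r ^ 2 + B ^ 2) - √(v φ))
      (-(r * t * Real.sin φ / √(v φ))) (Set.Ioo 0 Real.pi) φ := by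
    intro φ hφ
    have h1 : HasDerivAt v (2 * r * t * Real.sin φ) φ := by
      have : v = fun φ => r ^ 2 + t ^ 2 + B ^ 2 - 2 * r * t * Real.cos φ := funext hv'
      rw [this]
      exact (((Real.hasDerivAt_cos φ).const_mul (2 * r * t)).const_sub
        (r ^ 2 + t ^ 2 + B ^ 2)).congr_deriv (by ring)
    have h2 := (h1.sqrt (hpos φ hφ).ne').const_sub (√(r ^ 2 + B ^ 2))
    have : 0 < √(v φ) := Real.sqrt_pos.2 (hpos φ hφ)
    exact h2.hasDerivWithinAt.congr_deriv (by field_simp)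
  have hinj : Set.InjOn (fun φ => √(r ^ 2 + B ^ 2) - √(v φ)) (Set.Ioo 0 Real.pi) := by
    intro φ hφ φ' hφ' h
    have h1 : √(v φ) = √(v φ') := by simpa using h
    rw [Real.sqrt_inj (hpos φ hφ).le (hpos φ' hφ').le, hv', hv'] at h1
    have h2 : Real.cos φ = Real.cos φ' := by
      have : 2 * r * t * (Real.cos φ - Real.cos φ') = 0 := by linarith
      rcases mul_eq_zero.1 this with h | h
      · exact absurd h (by positivity)
      · linarith
    exact Real.injOn_cos ⟨hφ.1.le, hφ.2.le⟩ ⟨hφ'.1.le, hφ'.2.le⟩ h2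
  have key := lintegral_image_eq_lintegral_abs_deriv_mul measurableSet_Ioo hderiv hinj J
  calc _ = ∫⁻ φ in Set.Ioo 0 Real.pi, ENNReal.ofReal |-(r * t * Real.sin φ / √(v φ))| *
        J (√(r ^ 2 + B ^ 2) - √(v φ)) := by
        refine setLIntegral_congr_fun measurableSet_Ioo fun φ hφ => ?_
        have := Real.sin_pos_of_pos_of_lt_pi hφ.1 hφ.2
        simp only [abs_neg]
        rw [abs_of_nonneg (by positivity)]
    _ ≤ _ := by
        rw [← key]
        exact setLIntegral_le_lintegral _ _

/-- Write r = M + (r - M); half of the exponent absorbs r - M at the cost of a multiple of τ. -/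
lemma lintegral_radial_le {τ M : ℝ} (hτ : 0 < τ) (hM : 0 ≤ M) :
    ∫⁻ r in Set.Ioi 0, ENNReal.ofReal (r * Real.exp (-((r - M) ^ 2 / (8 * τ ^ 2)))) ≤
      ENNReal.ofReal (32 * τ * (M + τ)) := by
  have hb : 0 < 1 / (16 * τ ^ 2) := by positivity
  calc _ ≤ ∫⁻ r in Set.Ioi 0, ENNReal.ofReal (M + 4 * τ) *
        ENNReal.ofReal (Real.exp (-(1 / (16 * τ ^ 2)) * (r - M) ^ 2)) := by
        refine setLIntegral_mono (by fun_prop) fun r hr => ?_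
        rw [← ENNReal.ofReal_mul (by positivity)]
        apply ENNReal.ofReal_le_ofReal
        have e1 : -((r - M) ^ 2 / (8 * τ ^ 2)) =
          -(1 / (16 * τ ^ 2)) * (r - M) ^ 2 + -(((r - M) / τ) ^ 2 / 16) := by
          field_simp; ring
        rw [e1, Real.exp_add]
        have h1 := mul_exp_neg_sq_div_le ((r - M) / τ)
        have h2 : Real.exp (-(((r - M) / τ) ^ 2 / 16)) ≤ 1 :=
          Real.exp_le_one_iff.2 (by nlinarith [sq_nonneg ((r - M) / τ)])
        have h3 : (r - M) * Real.exp (-(((r - M) / τ) ^ 2 / 16)) ≤ 2 * τ := by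
          have := mul_le_mul_of_nonneg_left h1 hτ.le
          have e : τ * ((r - M) / τ * Real.exp (-(((r - M) / τ) ^ 2 / 16))) =
            (r - M) * Real.exp (-(((r - M) / τ) ^ 2 / 16)) := by field_simp
          linarith
        have h4 : r * Real.exp (-(((r - M) / τ) ^ 2 / 16)) ≤ M + 4 * τ := by nlinarith
        calc r * (Real.exp (-(1 / (16 * τ ^ 2)) * (r - M) ^ 2) *
              Real.exp (-(((r - M) / τ) ^ 2 / 16)))
            = r * Real.exp (-(((r - M) / τ) ^ 2 / 16)) *
              Real.exp (-(1 / (16 * τ ^ 2)) * (r - M) ^ 2) := by ring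
          _ ≤ _ := mul_le_mul_of_nonneg_right h4 (Real.exp_pos _).le
    _ ≤ ENNReal.ofReal (M + 4 * τ) * ENNReal.ofReal √(Real.pi / (1 / (16 * τ ^ 2))) := by
        rw [lintegral_const_mul _ (by fun_prop)]
        gcongr
        refine (setLIntegral_le_lintegral _ _).trans ?_
        rw [lintegral_ofReal_exp_neg_mul_sq hb]
    _ ≤ _ := by
        rw [← ENNReal.ofReal_mul (by positivity)]
        apply ENNReal.ofReal_le_ofReal
        have : √(Real.pi / (1 / (16 * τ ^ 2))) ≤ 8 * τ := by
          rw [Real.sqrt_le_left (by positivity)]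
          rw [div_div_eq_mul_div, div_one]
          nlinarith [Real.pi_le_four, sq_nonneg τ]
        have := mul_le_mul_of_nonneg_left this (show 0 ≤ M + 4 * τ by positivity)
        nlinarith [mul_nonneg hM hτ.le]

/-- The left factor is the distance to the second focus, which appears in the reciprocal of the
derivative along a circle. It exceeds its value at the mean by at most D + B, where D is the
displacement from the mean, and half of the exponent absorbs D. The other half is weakened to a
radial weight, because the distances to the origin differ by at most D. -/
lemma planar_weight_le {τ t B z ρ a m : ℝ} (hτ : 0 < τ) (hB : 0 ≤ B) :
    √((z - t) ^ 2 + ρ ^ 2 + B ^ 2) *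
      Real.exp (-(((z - a) ^ 2 + (ρ - m) ^ 2) / (4 * τ ^ 2))) ≤
    (√((a - t) ^ 2 + m ^ 2) + B + 4 * τ) *
      Real.exp (-((√(z ^ 2 + ρ ^ 2) - √(a ^ 2 + m ^ 2)) ^ 2 / (8 * τ ^ 2))) := by
  have hnorm : ∀ x y : ℝ, √(x ^ 2 + y ^ 2) = ‖(⟨x, y⟩ : ℂ)‖ := by
    intro x y
    rw [Complex.norm_def, Complex.normSq_mk]
    congr 1
    ring
  set D := √((z - a) ^ 2 + (ρ - m) ^ 2) with hD
  have hDsq : D ^ 2 = (z - a) ^ 2 + (ρ - m) ^ 2 := Real.sq_sqrt (by positivity)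
  have hD0 : 0 ≤ D := Real.sqrt_nonneg _
  have h1 : √((z - t) ^ 2 + ρ ^ 2 + B ^ 2) ≤ √((a - t) ^ 2 + m ^ 2) + D + B := by
    have e1 : √((z - t) ^ 2 + ρ ^ 2) ≤ √((a - t) ^ 2 + m ^ 2) + D := by
      rw [hD, hnorm, hnorm, hnorm]
      refine le_trans (le_of_eq ?_) (norm_add_le _ _)
      congr 1
      apply Complex.ext <;> simp
    have e2 : √((z - t) ^ 2 + ρ ^ 2 + B ^ 2) ≤ √((z - t) ^ 2 + ρ ^ 2) + B := by
      rw [Real.sqrt_le_left (by positivity)]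
      have := Real.sq_sqrt (show 0 ≤ (z - t) ^ 2 + ρ ^ 2 by positivity)
      nlinarith [mul_nonneg (Real.sqrt_nonneg ((z - t) ^ 2 + ρ ^ 2)) hB]
    linarith
  have h2 : (√(z ^ 2 + ρ ^ 2) - √(a ^ 2 + m ^ 2)) ^ 2 ≤ D ^ 2 := by
    rw [sq_le_sq, abs_of_nonneg hD0, hD, hnorm, hnorm, hnorm]
    refine (abs_norm_sub_norm_le _ _).trans (le_of_eq ?_)
    congr 1
  have h3 : Real.exp (-(D ^ 2 / (8 * τ ^ 2))) ≤
      Real.exp (-((√(z ^ 2 + ρ ^ 2) - √(a ^ 2 + m ^ 2)) ^ 2 / (8 * τ ^ 2))) := by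
    apply Real.exp_le_exp.2
    apply neg_le_neg
    gcongr
  rw [← hDsq]
  have h4 : D * Real.exp (-(D ^ 2 / (8 * τ ^ 2))) ≤ 4 * τ := by
    have := mul_exp_neg_sq_div_le (D / τ)
    have e : Real.exp (-(D ^ 2 / (8 * τ ^ 2))) ≤ Real.exp (-((D / τ) ^ 2 / 16)) := by
      apply Real.exp_le_exp.2
      apply neg_le_neg
      rw [div_pow, div_div]
      apply div_le_div_of_nonneg_left (sq_nonneg _) (by positivity)
      nlinarith [sq_nonneg τ]
    have e2 := mul_le_mul_of_nonneg_left this hτ.le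
    have e3 : τ * (D / τ * Real.exp (-((D / τ) ^ 2 / 16))) =
      D * Real.exp (-((D / τ) ^ 2 / 16)) := by field_simp
    have e4 := mul_le_mul_of_nonneg_left e hD0
    linarith
  have h5 : Real.exp (-(D ^ 2 / (8 * τ ^ 2))) ≤ 1 :=
    Real.exp_le_one_iff.2 (neg_nonpos.2 (by positivity))
  have h6 : Real.exp (-(D ^ 2 / (4 * τ ^ 2))) =
      Real.exp (-(D ^ 2 / (8 * τ ^ 2))) * Real.exp (-(D ^ 2 / (8 * τ ^ 2))) := by
    rw [← Real.exp_add]; congr 1; field_simp; ring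
  have hb0 := Real.sqrt_nonneg ((a - t) ^ 2 + m ^ 2)
  rw [h6, ← mul_assoc]
  apply mul_le_mul _ h3 (Real.exp_pos _).le (by positivity)
  calc _ ≤ (√((a - t) ^ 2 + m ^ 2) + D + B) * Real.exp (-(D ^ 2 / (8 * τ ^ 2))) :=
        mul_le_mul_of_nonneg_right h1 (Real.exp_pos _).le
    _ = (√((a - t) ^ 2 + m ^ 2) + B) * Real.exp (-(D ^ 2 / (8 * τ ^ 2))) +
        D * Real.exp (-(D ^ 2 / (8 * τ ^ 2))) := by ring
    _ ≤ (√((a - t) ^ 2 + m ^ 2) + B) * 1 + 4 * τ := by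
        gcongr
    _ = _ := by ring

/-- In polar coordinates around the first focus the area element and the factor ρ combine to r · r
sin φ. The derivative of the difference of distances along the circle is r t sin φ / S, with S the
distance to the second focus. The two factors sin φ cancel, so the change of variables of
`lintegral_circle_le` leaves the bounded weight S r / t. -/
lemma lintegral_half_plane_le {τ t B a m : ℝ} (hτ : 0 < τ) (ht : 0 < t) (hB : 0 ≤ B)
    {J : ℝ → ℝ≥0∞} (hJ : Measurable J) :
    ∫⁻ z, ∫⁻ ρ in Set.Ioi 0, ENNReal.ofReal
        (ρ * Real.exp (-(((z - a) ^ 2 + (ρ - m) ^ 2) / (4 * τ ^ 2)))) *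
        J (√(z ^ 2 + ρ ^ 2 + B ^ 2) - √((z - t) ^ 2 + ρ ^ 2 + B ^ 2)) ≤
      ENNReal.ofReal (32 * τ * (√(a ^ 2 + m ^ 2) + τ) *
        (√((a - t) ^ 2 + m ^ 2) + B + 4 * τ) / t) * ∫⁻ u, J u := by
  set M := √(a ^ 2 + m ^ 2) with hM
  set L := √((a - t) ^ 2 + m ^ 2) + B + 4 * τ with hL
  have hM0 : 0 ≤ M := Real.sqrt_nonneg _
  have hL0 : 0 < L := by positivity
  set F : ℝ × ℝ → ℝ≥0∞ := fun p => (Set.Ioi (0 : ℝ)).indicator (fun ρ => ENNReal.ofReal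
        (ρ * Real.exp (-(((p.1 - a) ^ 2 + (ρ - m) ^ 2) / (4 * τ ^ 2)))) *
        J (√(p.1 ^ 2 + ρ ^ 2 + B ^ 2) - √((p.1 - t) ^ 2 + ρ ^ 2 + B ^ 2))) p.2 with hF
  have hFm : Measurable F := by
    have : F = (Prod.snd ⁻¹' Set.Ioi (0 : ℝ)).indicator (fun p : ℝ × ℝ => ENNReal.ofReal
        (p.2 * Real.exp (-(((p.1 - a) ^ 2 + (p.2 - m) ^ 2) / (4 * τ ^ 2)))) *
        J (√(p.1 ^ 2 + p.2 ^ 2 + B ^ 2) - √((p.1 - t) ^ 2 + p.2 ^ 2 + B ^ 2))) := by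
      ext p
      simp [hF, Set.indicator]
    rw [this]
    exact Measurable.indicator (by fun_prop) (measurable_snd measurableSet_Ioi)
  have h1 : ∫⁻ z, ∫⁻ ρ in Set.Ioi 0, ENNReal.ofReal
        (ρ * Real.exp (-(((z - a) ^ 2 + (ρ - m) ^ 2) / (4 * τ ^ 2)))) *
        J (√(z ^ 2 + ρ ^ 2 + B ^ 2) - √((z - t) ^ 2 + ρ ^ 2 + B ^ 2)) = ∫⁻ p, F p := by
    rw [Measure.volume_eq_prod, lintegral_prod _ hFm.aemeasurable]
    simp only [hF, lintegral_indicator measurableSet_Ioi]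
  rw [h1, ← lintegral_comp_polarCoord_symm, polarCoord_target]
  set R : ℝ → ℝ≥0∞ := fun r => ENNReal.ofReal (r * Real.exp (-((r - M) ^ 2 / (8 * τ ^ 2)))) with hR
  set H : ℝ → ℝ → ℝ≥0∞ := fun r φ => (Set.Ioo 0 Real.pi).indicator (fun φ =>
      ENNReal.ofReal (r * t * Real.sin φ /
        √((r * Real.cos φ - t) ^ 2 + (r * Real.sin φ) ^ 2 + B ^ 2)) *
      J (√(r ^ 2 + B ^ 2) - √((r * Real.cos φ - t) ^ 2 + (r * Real.sin φ) ^ 2 + B ^ 2))) φ with hH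
  have hHm : Measurable fun p : ℝ × ℝ => H p.1 p.2 := by
    have : (fun p : ℝ × ℝ => H p.1 p.2) = (Prod.snd ⁻¹' Set.Ioo (0 : ℝ) Real.pi).indicator
      (fun p : ℝ × ℝ => ENNReal.ofReal (p.1 * t * Real.sin p.2 /
        √((p.1 * Real.cos p.2 - t) ^ 2 + (p.1 * Real.sin p.2) ^ 2 + B ^ 2)) *
      J (√(p.1 ^ 2 + B ^ 2) -
        √((p.1 * Real.cos p.2 - t) ^ 2 + (p.1 * Real.sin p.2) ^ 2 + B ^ 2))) := by
      ext p
      simp [hH, Set.indicator]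
    rw [this]
    exact Measurable.indicator (by fun_prop) (measurable_snd measurableSet_Ioo)
  have hpt : ∀ p ∈ Set.Ioi (0 : ℝ) ×ˢ Set.Ioo (-Real.pi) Real.pi,
      ENNReal.ofReal p.1 • F (polarCoord.symm p) ≤
        ENNReal.ofReal (L / t) * (R p.1 * H p.1 p.2) := by
    rintro ⟨r, φ⟩ ⟨hr, hφ⟩
    simp only [Set.mem_Ioi, Set.mem_Ioo] at hr hφ
    simp only [polarCoord_symm_apply, hF, smul_eq_mul]
    by_cases hs : r * Real.sin φ ∈ Set.Ioi (0 : ℝ)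
    swap
    · rw [Set.indicator_of_notMem hs, mul_zero]
      exact zero_le
    have hs' : 0 < Real.sin φ := pos_of_mul_pos_right hs hr.le
    have hφ0 : φ ∈ Set.Ioo 0 Real.pi := by
      refine ⟨?_, hφ.2⟩
      by_contra hneg
      push Not at hneg
      exact absurd hs' (not_lt.2 (Real.sin_nonpos_of_nonpos_of_neg_pi_le hneg hφ.1.le))
    rw [Set.indicator_of_mem hs]
    simp only [hH, hR]
    rw [Set.indicator_of_mem hφ0]
    have e1 : (r * Real.cos φ) ^ 2 + (r * Real.sin φ) ^ 2 = r ^ 2 := by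
      rw [mul_pow, mul_pow, ← mul_add, Real.cos_sq_add_sin_sq, mul_one]
    rw [e1]
    simp only [← mul_assoc]
    gcongr ?_ * _
    have hw := planar_weight_le (τ := τ) (t := t) (B := B) (z := r * Real.cos φ)
      (ρ := r * Real.sin φ) (a := a) (m := m) hτ hB
    rw [e1, Real.sqrt_sq hr.le, ← hL, ← hM] at hw
    set S := √((r * Real.cos φ - t) ^ 2 + (r * Real.sin φ) ^ 2 + B ^ 2) with hS
    have hS0 : 0 < S := by
      apply Real.sqrt_pos.2
      have : 0 < r * Real.sin φ := hs
      positivity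
    rw [← ENNReal.ofReal_mul hr.le, ← ENNReal.ofReal_mul (by positivity),
      ← ENNReal.ofReal_mul (by positivity)]
    apply ENNReal.ofReal_le_ofReal
    -- The factor r · r sin φ / S is, up to r / t, the derivative in `lintegral_circle_le`; the S
    -- divided out here is paid for by `planar_weight_le`.
    have := mul_le_mul_of_nonneg_left hw (show 0 ≤ r * (r * Real.sin φ) / S by positivity)
    calc _ = r * (r * Real.sin φ) / S * (S * Real.exp (-(((r * Real.cos φ - a) ^ 2 +
          (r * Real.sin φ - m) ^ 2) / (4 * τ ^ 2)))) := by field_simp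
      _ ≤ _ := this
      _ = _ := by field_simp
  calc _ ≤ ∫⁻ p in Set.Ioi (0 : ℝ) ×ˢ Set.Ioo (-Real.pi) Real.pi,
        ENNReal.ofReal (L / t) * (R p.1 * H p.1 p.2) :=
        setLIntegral_mono (by fun_prop) hpt
    _ ≤ ENNReal.ofReal (L / t) * ∫⁻ r in Set.Ioi (0 : ℝ), R r * ∫⁻ u, J u := by
        rw [lintegral_const_mul _ (by fun_prop)]
        gcongr
        rw [Measure.volume_eq_prod, ← Measure.prod_restrict, lintegral_prod _ (by fun_prop)]
        refine setLIntegral_mono (by fun_prop) fun r hr => ?_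
        dsimp only
        rw [lintegral_const_mul _ (by fun_prop)]
        gcongr _ * ?_
        refine (setLIntegral_le_lintegral _ _).trans ?_
        simp only [hH]
        rw [lintegral_indicator measurableSet_Ioo]
        exact lintegral_circle_le hr ht J
    _ ≤ ENNReal.ofReal (L / t) * (ENNReal.ofReal (32 * τ * (M + τ)) * ∫⁻ u, J u) := by
        rw [lintegral_mul_const _ (by fun_prop)]
        gcongr
        exact lintegral_radial_le hτ hM0
    _ = _ := by
        rw [← mul_assoc, ← ENNReal.ofReal_mul (by positivity)]
        congr 2
        field_simp

/-- The density of the difference of the distances of a Gaussian point to two fixed points, with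
all but three coordinates fixed. -/
lemma lintegral_three_gaussians_le {τ t B a m : ℝ} (hτ : 0 < τ) (ht : 0 < t) (hB : 0 ≤ B)
    (hm : 0 < m) {J : ℝ → ℝ≥0∞} (hJ : Measurable J) :
    ∫⁻ z, ∫⁻ w₁, ∫⁻ w₂, J (√(z ^ 2 + w₁ ^ 2 + w₂ ^ 2 + B ^ 2) -
        √((z - t) ^ 2 + w₁ ^ 2 + w₂ ^ 2 + B ^ 2)) ∂gaussianReal 0 (τ ^ 2).toNNReal
        ∂gaussianReal m (τ ^ 2).toNNReal ∂gaussianReal a (τ ^ 2).toNNReal ≤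
      ENNReal.ofReal (128 * (√(a ^ 2 + m ^ 2) + τ) *
        (√((a - t) ^ 2 + m ^ 2) + B + 4 * τ) / (τ * t * m)) * ∫⁻ u, J u := by
  have hpi := Real.pi_pos
  have hv : (τ ^ 2).toNNReal ≠ 0 := by
    rw [Ne, Real.toNNReal_eq_zero, not_le]; positivity
  have hpdf : ∀ c x, gaussianPDF c (τ ^ 2).toNNReal x = ENNReal.ofReal
      ((√(2 * Real.pi * τ ^ 2))⁻¹ * Real.exp (-(x - c) ^ 2 / (2 * τ ^ 2))) := by
    intro c x
    rw [gaussianPDF, gaussianPDFReal, Real.coe_toNNReal _ (sq_nonneg τ)]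
  -- The integrand depends on the last two coordinates only through ρ² = w₁² + w₂². Polar
  -- coordinates in this plane supply the factor ρ, and the integral over the angle supplies τ/m.
  have hinner : ∀ z, ∫⁻ w₁, ∫⁻ w₂, J (√(z ^ 2 + w₁ ^ 2 + w₂ ^ 2 + B ^ 2) -
        √((z - t) ^ 2 + w₁ ^ 2 + w₂ ^ 2 + B ^ 2)) ∂gaussianReal 0 (τ ^ 2).toNNReal
        ∂gaussianReal m (τ ^ 2).toNNReal ≤
      ENNReal.ofReal (4 / (τ * m)) * ∫⁻ ρ in Set.Ioi 0,
        ENNReal.ofReal (ρ * Real.exp (-((ρ - m) ^ 2 / (4 * τ ^ 2)))) *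
        J (√(z ^ 2 + ρ ^ 2 + B ^ 2) - √((z - t) ^ 2 + ρ ^ 2 + B ^ 2)) := by
    intro z
    set g : ℝ → ℝ≥0∞ := fun s => J (√(z ^ 2 + s + B ^ 2) - √((z - t) ^ 2 + s + B ^ 2)) with hg
    have hgm : Measurable g := by fun_prop
    have e0 : ∀ w₁ w₂ : ℝ, J (√(z ^ 2 + w₁ ^ 2 + w₂ ^ 2 + B ^ 2) -
        √((z - t) ^ 2 + w₁ ^ 2 + w₂ ^ 2 + B ^ 2)) = g (w₁ ^ 2 + w₂ ^ 2) := by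
      intro w₁ w₂
      simp only [hg, add_assoc]
    simp_rw [e0]
    set E : ℝ × ℝ → ℝ≥0∞ := fun p => ENNReal.ofReal
      (Real.exp (-((p.1 - m) ^ 2 + p.2 ^ 2) / (2 * τ ^ 2))) with hE
    have e1 : ∫⁻ w₁, ∫⁻ w₂, g (w₁ ^ 2 + w₂ ^ 2) ∂gaussianReal 0 (τ ^ 2).toNNReal
        ∂gaussianReal m (τ ^ 2).toNNReal =
        ENNReal.ofReal (1 / (2 * Real.pi * τ ^ 2)) * ∫⁻ p : ℝ × ℝ, E p * g (p.1 ^ 2 + p.2 ^ 2) := by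
      rw [← lintegral_const_mul _ (by fun_prop), Measure.volume_eq_prod,
        lintegral_prod _ (by fun_prop), gaussianReal_of_var_ne_zero _ hv,
        gaussianReal_of_var_ne_zero _ hv,
        lintegral_withDensity_eq_lintegral_mul _ (measurable_gaussianPDF _ _)
          (Measurable.lintegral_prod_right (by fun_prop))]
      refine lintegral_congr fun w₁ => ?_
      rw [Pi.mul_apply, lintegral_withDensity_eq_lintegral_mul _ (measurable_gaussianPDF _ _)
          (by fun_prop), ← lintegral_const_mul]
      swap
      · have := measurable_gaussianPDF 0 (τ ^ 2).toNNReal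
        fun_prop
      refine lintegral_congr fun w₂ => ?_
      rw [Pi.mul_apply, hpdf, hpdf, ← mul_assoc, ← mul_assoc, ← ENNReal.ofReal_mul (by positivity),
        ← ENNReal.ofReal_mul (by positivity)]
      congr 2
      have : (√(2 * Real.pi * τ ^ 2))⁻¹ * (√(2 * Real.pi * τ ^ 2))⁻¹ = 1 / (2 * Real.pi * τ ^ 2) := by
        rw [← mul_inv, Real.mul_self_sqrt (by positivity), one_div]
      rw [mul_mul_mul_comm, this, ← Real.exp_add]
      congr 2
      ring
    rw [e1, ← lintegral_comp_polarCoord_symm, polarCoord_target, Measure.volume_eq_prod,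
      ← Measure.prod_restrict, lintegral_prod]
    swap
    · simp only [polarCoord_symm_apply, smul_eq_mul]
      fun_prop
    calc _ ≤ ENNReal.ofReal (1 / (2 * Real.pi * τ ^ 2)) * ∫⁻ ρ in Set.Ioi 0,
          ENNReal.ofReal (8 * Real.pi * τ / m) *
          (ENNReal.ofReal (ρ * Real.exp (-((ρ - m) ^ 2 / (4 * τ ^ 2)))) * g (ρ ^ 2)) := by
          gcongr _ * ?_
          refine setLIntegral_mono (by fun_prop) fun ρ hρ => ?_
          have hρ' : (0 : ℝ) < ρ := hρ
          have e2 : ∀ ψ, (ρ * Real.cos ψ) ^ 2 + (ρ * Real.sin ψ) ^ 2 = ρ ^ 2 := by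
            intro ψ
            rw [mul_pow, mul_pow, ← mul_add, Real.cos_sq_add_sin_sq, mul_one]
          simp only [polarCoord_symm_apply, e2, smul_eq_mul, hE]
          rw [lintegral_const_mul _ (by fun_prop), lintegral_mul_const _ (by fun_prop)]
          calc _ ≤ ENNReal.ofReal ρ * (ENNReal.ofReal (8 * Real.pi * τ / m *
                Real.exp (-((ρ - m) ^ 2 / (4 * τ ^ 2)))) * g (ρ ^ 2)) := by
                gcongr
                exact lintegral_angular_le hτ hm hρ'
            _ = _ := by
                rw [← mul_assoc, ← mul_assoc, ← ENNReal.ofReal_mul hρ'.le,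
                  ← ENNReal.ofReal_mul (by positivity)]
                congr 2
                ring
      _ = _ := by
          rw [lintegral_const_mul _ (by fun_prop), ← mul_assoc,
            ← ENNReal.ofReal_mul (by positivity)]
          congr 2
          field_simp
          norm_num
  have hG : Measurable fun p : ℝ × ℝ =>
        ENNReal.ofReal (p.2 * Real.exp (-((p.2 - m) ^ 2 / (4 * τ ^ 2)))) *
        J (√(p.1 ^ 2 + p.2 ^ 2 + B ^ 2) - √((p.1 - t) ^ 2 + p.2 ^ 2 + B ^ 2)) := by fun_prop
  have hG' : Measurable fun z : ℝ => ∫⁻ ρ in Set.Ioi 0,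
        ENNReal.ofReal (ρ * Real.exp (-((ρ - m) ^ 2 / (4 * τ ^ 2)))) *
        J (√(z ^ 2 + ρ ^ 2 + B ^ 2) - √((z - t) ^ 2 + ρ ^ 2 + B ^ 2)) :=
    hG.lintegral_prod_right'
  calc _ ≤ ∫⁻ z, (ENNReal.ofReal (4 / (τ * m)) * ∫⁻ ρ in Set.Ioi 0,
        ENNReal.ofReal (ρ * Real.exp (-((ρ - m) ^ 2 / (4 * τ ^ 2)))) *
        J (√(z ^ 2 + ρ ^ 2 + B ^ 2) - √((z - t) ^ 2 + ρ ^ 2 + B ^ 2)))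
          ∂gaussianReal a (τ ^ 2).toNNReal := lintegral_mono hinner
    _ = ENNReal.ofReal (4 / (τ * m)) * ∫⁻ z, gaussianPDF a (τ ^ 2).toNNReal z *
        ∫⁻ ρ in Set.Ioi 0, ENNReal.ofReal (ρ * Real.exp (-((ρ - m) ^ 2 / (4 * τ ^ 2)))) *
        J (√(z ^ 2 + ρ ^ 2 + B ^ 2) - √((z - t) ^ 2 + ρ ^ 2 + B ^ 2)) := by
        rw [lintegral_const_mul _ hG', gaussianReal_of_var_ne_zero _ hv,
          lintegral_withDensity_eq_lintegral_mul _ (measurable_gaussianPDF _ _) hG']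
        rfl
    _ ≤ ENNReal.ofReal (4 / (τ * m)) * ∫⁻ z, ENNReal.ofReal (1 / τ) *
        ∫⁻ ρ in Set.Ioi 0, ENNReal.ofReal
        (ρ * Real.exp (-(((z - a) ^ 2 + (ρ - m) ^ 2) / (4 * τ ^ 2)))) *
        J (√(z ^ 2 + ρ ^ 2 + B ^ 2) - √((z - t) ^ 2 + ρ ^ 2 + B ^ 2)) := by
        gcongr _ * ?_
        refine lintegral_mono fun z => ?_
        rw [← lintegral_const_mul _ (by fun_prop), ← lintegral_const_mul _ (by fun_prop)]
        refine setLIntegral_mono (by fun_prop) fun ρ hρ => ?_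
        have hρ' : (0 : ℝ) < ρ := hρ
        rw [← mul_assoc, ← mul_assoc, hpdf, ← ENNReal.ofReal_mul (by positivity),
          ← ENNReal.ofReal_mul (by positivity)]
        gcongr ?_ * _
        apply ENNReal.ofReal_le_ofReal
        have k1 : (√(2 * Real.pi * τ ^ 2))⁻¹ ≤ 1 / τ := by
          rw [one_div]
          apply inv_anti₀ hτ
          apply Real.le_sqrt_of_sq_le
          nlinarith [Real.pi_gt_three, sq_nonneg τ]
        have k2 : Real.exp (-(z - a) ^ 2 / (2 * τ ^ 2)) ≤
            Real.exp (-((z - a) ^ 2 / (4 * τ ^ 2))) := by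
          apply Real.exp_le_exp.2
          rw [neg_div]
          apply neg_le_neg
          apply div_le_div_of_nonneg_left (sq_nonneg _) (by positivity)
          nlinarith [sq_nonneg τ]
        have k3 : Real.exp (-(((z - a) ^ 2 + (ρ - m) ^ 2) / (4 * τ ^ 2))) =
            Real.exp (-((z - a) ^ 2 / (4 * τ ^ 2))) * Real.exp (-((ρ - m) ^ 2 / (4 * τ ^ 2))) := by
          rw [← Real.exp_add]
          congr 1
          ring
        rw [k3]
        calc _ ≤ 1 / τ * Real.exp (-((z - a) ^ 2 / (4 * τ ^ 2))) *
              (ρ * Real.exp (-((ρ - m) ^ 2 / (4 * τ ^ 2)))) := by gcongr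
          _ = _ := by ring
    _ ≤ ENNReal.ofReal (4 / (τ * m)) * (ENNReal.ofReal (1 / τ) *
        (ENNReal.ofReal (32 * τ * (√(a ^ 2 + m ^ 2) + τ) *
        (√((a - t) ^ 2 + m ^ 2) + B + 4 * τ) / t) * ∫⁻ u, J u)) := by
        rw [lintegral_const_mul]
        · gcongr
          exact lintegral_half_plane_le hτ ht hB hJ
        · have : Measurable fun p : ℝ × ℝ => ENNReal.ofReal
            (p.2 * Real.exp (-(((p.1 - a) ^ 2 + (p.2 - m) ^ 2) / (4 * τ ^ 2)))) *
            J (√(p.1 ^ 2 + p.2 ^ 2 + B ^ 2) - √((p.1 - t) ^ 2 + p.2 ^ 2 + B ^ 2)) := by fun_prop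
          exact this.lintegral_prod_right'
    _ = _ := by
        rw [← mul_assoc, ← mul_assoc, ← ENNReal.ofReal_mul (by positivity),
          ← ENNReal.ofReal_mul (by positivity)]
        congr 2
        field_simp
        norm_num1

/-! ### Negative moments of the norm of a Gaussian vector -/

/-- This is the Gamma integral, which turns negative moments into Laplace transforms; at v = 0 both
sides are infinite. -/
lemma ofReal_rpow_neg_le_lintegral {α v : ℝ} (hα : 0 < α) (hv : 0 ≤ v) :
    ENNReal.ofReal (Real.Gamma α) * ENNReal.ofReal v ^ (-α) ≤
      ∫⁻ l in Set.Ioi (0 : ℝ), ENNReal.ofReal (l ^ (α - 1)) * ENNReal.ofReal (Real.exp (-l * v)) := by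
  rcases hv.eq_or_lt with rfl | hv
  · have htop : ∫⁻ l in Set.Ioi (0 : ℝ), ENNReal.ofReal (l ^ (α - 1)) = ⊤ := by
      by_contra hne
      refine not_integrableOn_Ioi_rpow (α - 1) ⟨by fun_prop, ?_⟩
      rw [hasFiniteIntegral_iff_ofReal]
      · exact lt_top_iff_ne_top.2 hne
      · filter_upwards [ae_restrict_mem measurableSet_Ioi] with x hx
        exact Real.rpow_nonneg (le_of_lt hx) _
    simp [htop]
  · have h := Real.integral_rpow_mul_exp_neg_mul_Ioi hα hv
    have hG := Real.Gamma_pos_of_pos hα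
    have hint : IntegrableOn (fun t : ℝ => t ^ (α - 1) * Real.exp (-(v * t))) (Set.Ioi 0) := by
      apply Integrable.of_integral_ne_zero
      rw [h]
      positivity
    have h2 := ofReal_integral_eq_lintegral_ofReal hint (by
      filter_upwards [ae_restrict_mem measurableSet_Ioi] with x hx
      exact mul_nonneg (Real.rpow_nonneg (le_of_lt hx) _) (Real.exp_pos _).le)
    rw [h] at h2
    have e1 : ENNReal.ofReal (Real.Gamma α) * ENNReal.ofReal v ^ (-α) =
        ENNReal.ofReal ((1 / v) ^ α * Real.Gamma α) := by
      rw [ENNReal.ofReal_rpow_of_pos hv, ← ENNReal.ofReal_mul hG.le, mul_comm, one_div,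
        Real.inv_rpow hv.le, Real.rpow_neg hv.le]
    rw [e1, h2]
    refine setLIntegral_mono' measurableSet_Ioi fun l hl => ?_
    rw [← ENNReal.ofReal_mul (Real.rpow_nonneg (le_of_lt hl) _)]
    apply le_of_eq
    congr 3
    ring

/-- Completing the square leaves the factor exp(-l m²/A), with A = 1 + 2lτ², which is at most 1:
mean zero is the worst case. -/
lemma lintegral_exp_neg_mul_sq_gaussianReal_le {τ l : ℝ} (hτ : 0 < τ) (hl : 0 < l) (m : ℝ) :
    ∫⁻ x, ENNReal.ofReal (Real.exp (-l * x ^ 2)) ∂gaussianReal m (τ ^ 2).toNNReal ≤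
      ENNReal.ofReal ((1 + 2 * l * τ ^ 2) ^ (-(1 / 2) : ℝ)) := by
  have hpi := Real.pi_pos
  have hv : (τ ^ 2).toNNReal ≠ 0 := by
    rw [Ne, Real.toNNReal_eq_zero, not_le]; positivity
  set A := 1 + 2 * l * τ ^ 2 with hA
  have hA0 : 0 < A := by positivity
  set b := A / (2 * τ ^ 2) with hb
  have hb0 : 0 < b := by positivity
  rw [gaussianReal_of_var_ne_zero _ hv,
    lintegral_withDensity_eq_lintegral_mul _ (measurable_gaussianPDF _ _) (by fun_prop)]
  calc _ ≤ ∫⁻ x, ENNReal.ofReal (√(2 * Real.pi * τ ^ 2))⁻¹ *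
        ENNReal.ofReal (Real.exp (-b * (x - m / A) ^ 2)) := by
        refine lintegral_mono fun x => ?_
        rw [Pi.mul_apply, gaussianPDF, gaussianPDFReal, Real.coe_toNNReal _ (sq_nonneg τ),
          ← ENNReal.ofReal_mul (by positivity), ← ENNReal.ofReal_mul (by positivity), mul_assoc,
          ← Real.exp_add]
        apply ENNReal.ofReal_le_ofReal
        apply mul_le_mul_of_nonneg_left _ (by positivity)
        apply Real.exp_le_exp.2
        have : -b * (x - m / A) ^ 2 - (-(x - m) ^ 2 / (2 * τ ^ 2) + -l * x ^ 2) =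
            l * m ^ 2 / A := by
          have h2 : b = l + 1 / (2 * τ ^ 2) := by
            rw [hb, hA]; field_simp; ring
          have h3 : b / A = 1 / (2 * τ ^ 2) := by
            rw [hb]; field_simp
          have e : -b * (x - m / A) ^ 2 = -b * x ^ 2 + 2 * x * m * (b / A) - (b / A) * (m ^ 2 / A) := by
            field_simp; ring
          rw [e, h3, h2]
          have h4 : l * m ^ 2 / A = (m ^ 2 - m ^ 2 / A) / (2 * τ ^ 2) := by
            field_simp; rw [hA]; ring
          rw [h4]
          field_simp
          ring
        have h0 : 0 ≤ l * m ^ 2 / A := by positivity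
        linarith
    _ = ENNReal.ofReal (√(2 * Real.pi * τ ^ 2))⁻¹ * ENNReal.ofReal √(Real.pi / b) := by
        rw [lintegral_const_mul _ (by fun_prop), lintegral_ofReal_exp_neg_mul_sq hb0]
    _ = _ := by
        rw [← ENNReal.ofReal_mul (by positivity), ← Real.sqrt_inv, ← Real.sqrt_mul (by positivity),
          Real.rpow_neg hA0.le, ← Real.sqrt_eq_rpow, ← Real.sqrt_inv]
        congr 2
        rw [hb]
        field_simp

lemma lintegral_prod_pi_le {d : ℕ} (μ : Fin d → Measure ℝ) [∀ i, IsProbabilityMeasure (μ i)]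
    {f : ℝ → ℝ≥0∞} (hf : Measurable f) {c : ℝ≥0∞} (h : ∀ i, ∫⁻ x, f x ∂μ i ≤ c)
    (s : Finset (Fin d)) :
    ∫⁻ w, ∏ i ∈ s, f (w i) ∂Measure.pi μ ≤ c ^ s.card := by
  induction s using Finset.induction_on with
  | empty => simp
  | insert i s hi ih =>
    have hm : Measurable fun w : Fin d → ℝ => ∏ j ∈ insert i s, f (w j) :=
      Finset.measurable_prod _ fun j _ => by fun_prop
    have hm' : Measurable fun w : Fin d → ℝ => ∏ j ∈ s, f (w j) :=
      Finset.measurable_prod _ fun j _ => by fun_prop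
    rw [lintegral_pi_update μ i hm, Finset.card_insert_of_notMem hi, pow_succ]
    calc _ ≤ ∫⁻ w, (∏ j ∈ s, f (w j)) * c ∂Measure.pi μ := by
          refine lintegral_mono fun w => ?_
          have : ∀ z, ∏ j ∈ insert i s, f (Function.update w i z j) =
              (∏ j ∈ s, f (w j)) * f z := by
            intro z
            rw [Finset.prod_insert hi, Function.update_self, mul_comm]
            congr 1
            refine Finset.prod_congr rfl fun j hj => ?_
            rw [Function.update_of_ne]
            rintro rfl
            exact hi hj
          simp_rw [this]
          rw [lintegral_const_mul _ hf]
          gcongr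
          exact h i
      _ ≤ _ := by
          rw [lintegral_mul_const _ hm']
          gcongr

/-- The range is split at l = 1/c: below it the second factor is at most 1, above it at most
(cl)^(-p). -/
lemma lintegral_rpow_mul_one_add_le {α p c : ℝ} (hα : 0 < α) (hp : α < p) (hc : 0 < c) :
    ∫⁻ l in Set.Ioi (0 : ℝ), ENNReal.ofReal (l ^ (α - 1)) * ENNReal.ofReal ((1 + c * l) ^ (-p)) ≤
      ENNReal.ofReal (c ^ (-α) * (1 / α + 1 / (p - α))) := by
  have hc' : 0 < 1 / c := by positivity
  have hp' : 0 < p - α := by linarith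
  have hpow : (1 / c) ^ α = c ^ (-α) := by rw [one_div, Real.inv_rpow hc.le, Real.rpow_neg hc.le]
  rw [← Set.Ioc_union_Ioi_eq_Ioi hc'.le]
  refine (lintegral_union_le _ _ _).trans ?_
  rw [mul_add, ENNReal.ofReal_add (by positivity) (by positivity)]
  gcongr
  · have hint : IntegrableOn (fun l : ℝ => l ^ (α - 1)) (Set.Ioc 0 (1 / c)) := by
      have := intervalIntegral.intervalIntegrable_rpow' (a := 0) (b := 1 / c)
        (show -1 < α - 1 by linarith)
      rwa [intervalIntegrable_iff_integrableOn_Ioc_of_le hc'.le] at this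
    calc _ ≤ ∫⁻ l in Set.Ioc 0 (1 / c), ENNReal.ofReal (l ^ (α - 1)) := by
          refine setLIntegral_mono (by fun_prop) fun l hl => ?_
          have : ENNReal.ofReal ((1 + c * l) ^ (-p)) ≤ 1 := by
            rw [ENNReal.ofReal_le_one]
            apply Real.rpow_le_one_of_one_le_of_nonpos
            · have := mul_pos hc hl.1
              linarith
            · linarith
          calc _ ≤ ENNReal.ofReal (l ^ (α - 1)) * 1 := by gcongr
            _ = _ := mul_one _
      _ = ENNReal.ofReal (∫ l in Set.Ioc 0 (1 / c), l ^ (α - 1)) := by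
          rw [ofReal_integral_eq_lintegral_ofReal hint]
          filter_upwards [ae_restrict_mem measurableSet_Ioc] with x hx
          exact Real.rpow_nonneg hx.1.le _
      _ = _ := by
          rw [← intervalIntegral.integral_of_le hc'.le, integral_rpow (Or.inl (by linarith)),
            sub_add_cancel, Real.zero_rpow hα.ne', hpow]
          congr 1
          ring
  · have hint : IntegrableOn (fun l : ℝ => l ^ (α - 1 - p)) (Set.Ioi (1 / c)) :=
      integrableOn_Ioi_rpow_of_lt (by linarith) hc'
    calc _ ≤ ∫⁻ l in Set.Ioi (1 / c), ENNReal.ofReal (c ^ (-p)) * ENNReal.ofReal (l ^ (α - 1 - p)) := by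
          refine setLIntegral_mono (by fun_prop) fun l hl => ?_
          have hl0 : 0 < l := hc'.trans hl
          rw [← ENNReal.ofReal_mul (by positivity), ← ENNReal.ofReal_mul (by positivity)]
          apply ENNReal.ofReal_le_ofReal
          have h1 : (1 + c * l) ^ (-p) ≤ (c * l) ^ (-p) :=
            Real.rpow_le_rpow_of_nonpos (by positivity) (by linarith) (by linarith)
          rw [Real.mul_rpow hc.le hl0.le] at h1
          have h2 := mul_le_mul_of_nonneg_left h1 (show 0 ≤ l ^ (α - 1) by positivity)
          refine h2.trans (le_of_eq ?_)
          rw [show α - 1 - p = (α - 1) + (-p) by ring, Real.rpow_add hl0]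
          ring
      _ = ENNReal.ofReal (c ^ (-p)) * ENNReal.ofReal (∫ l in Set.Ioi (1 / c), l ^ (α - 1 - p)) := by
          rw [lintegral_const_mul _ (by fun_prop), ofReal_integral_eq_lintegral_ofReal hint]
          filter_upwards [ae_restrict_mem measurableSet_Ioi] with x hx
          exact Real.rpow_nonneg (hc'.trans hx).le _
      _ = _ := by
          rw [integral_Ioi_rpow_of_lt (by linarith) hc', ← ENNReal.ofReal_mul (by positivity)]
          congr 1
          have : (1 / c) ^ (α - 1 - p + 1) = c ^ (p - α) := by
            rw [one_div, Real.inv_rpow hc.le, ← Real.rpow_neg hc.le]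
            congr 1
            ring
          rw [this, show -α = -p + (p - α) by ring, Real.rpow_add hc]
          have : α - 1 - p + 1 = -(p - α) := by ring
          rw [this]
          field_simp

/-- The Laplace transform of the sum of N squares is at most (1 + 2lτ²)^(-N/2). Bernoulli's
inequality with exponent N/(2p) ≥ 1 replaces this by (1 + cl)^(-p), where c = Nτ²/p. Since p is
fixed, the constant does not depend on N, the dimension or the means. -/
lemma exists_lintegral_sum_sq_rpow_neg_le {α p : ℝ} (hα : 0 < α) (hp : α < p) :
    ∃ C : ℝ, 0 < C ∧ ∀ (d : ℕ) (m : Fin d → ℝ) (τ : ℝ), 0 < τ → ∀ s : Finset (Fin d),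
      2 * p ≤ s.card →
      ∫⁻ w, ENNReal.ofReal (∑ i ∈ s, w i ^ 2) ^ (-α)
        ∂(Measure.pi fun i => gaussianReal (m i) (τ ^ 2).toNNReal) ≤
      ENNReal.ofReal (C * (τ ^ 2 * s.card) ^ (-α)) := by
  have hG := Real.Gamma_pos_of_pos hα
  have hp0 : 0 < p := hα.trans hp
  have hp' : 0 < p - α := by linarith
  refine ⟨(Real.Gamma α)⁻¹ * (p ^ α * (1 / α + 1 / (p - α))), by positivity, ?_⟩
  intro d m τ hτ s hs
  set N : ℝ := (s.card : ℝ) with hN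
  have hN0 : 0 < N := by linarith
  set c := N * τ ^ 2 / p with hc
  have hc0 : 0 < c := by positivity
  set μ := Measure.pi fun i => gaussianReal (m i) (τ ^ 2).toNNReal with hμ
  have hb : ∀ l ∈ Set.Ioi (0 : ℝ), ∫⁻ w, ENNReal.ofReal (Real.exp (-l * ∑ i ∈ s, w i ^ 2)) ∂μ ≤
      ENNReal.ofReal ((1 + c * l) ^ (-p)) := by
    intro l hl
    have hl0 : (0 : ℝ) < l := hl
    have e1 : ∀ w : Fin d → ℝ, ENNReal.ofReal (Real.exp (-l * ∑ i ∈ s, w i ^ 2)) =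
        ∏ i ∈ s, ENNReal.ofReal (Real.exp (-l * w i ^ 2)) := by
      intro w
      rw [Finset.mul_sum, Real.exp_sum, ENNReal.ofReal_prod_of_nonneg]
      exact fun i _ => (Real.exp_pos _).le
    simp_rw [e1]
    refine (lintegral_prod_pi_le _ (f := fun x => ENNReal.ofReal (Real.exp (-l * x ^ 2)))
      (by fun_prop) (fun i => lintegral_exp_neg_mul_sq_gaussianReal_le hτ hl0 (m i)) s).trans ?_
    rw [← ENNReal.ofReal_pow (by positivity)]
    apply ENNReal.ofReal_le_ofReal
    have hA : (0 : ℝ) < 1 + 2 * l * τ ^ 2 := by positivity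
    rw [← Real.rpow_natCast, ← hN, ← Real.rpow_mul hA.le, Real.rpow_neg (by positivity),
      show -(1 / 2) * N = -(N / (2 * p) * p) by field_simp, Real.rpow_neg hA.le,
      Real.rpow_mul hA.le]
    apply inv_anti₀ (by positivity)
    apply Real.rpow_le_rpow (by positivity) _ hp0.le
    have := one_add_mul_self_le_rpow_one_add (s := 2 * l * τ ^ 2)
      (by have : 0 ≤ 2 * l * τ ^ 2 := by positivity
          linarith) (p := N / (2 * p)) ((one_le_div (by positivity)).2 hs)
    refine le_trans (le_of_eq ?_) this
    rw [hc]
    field_simp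
  have hmeas : Measurable fun q : (Fin d → ℝ) × ℝ => ENNReal.ofReal (q.2 ^ (α - 1)) *
      ENNReal.ofReal (Real.exp (-q.2 * ∑ i ∈ s, q.1 i ^ 2)) := by
    have : Measurable fun q : (Fin d → ℝ) × ℝ => ∑ i ∈ s, q.1 i ^ 2 :=
      Finset.measurable_sum _ fun i _ => by fun_prop
    fun_prop
  have hmeas0 : Measurable fun w : Fin d → ℝ => ENNReal.ofReal (∑ i ∈ s, w i ^ 2) ^ (-α) := by
    have : Measurable fun w : Fin d → ℝ => ∑ i ∈ s, w i ^ 2 :=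
      Finset.measurable_sum _ fun i _ => by fun_prop
    fun_prop
  have key : ENNReal.ofReal (Real.Gamma α) * ∫⁻ w, ENNReal.ofReal (∑ i ∈ s, w i ^ 2) ^ (-α) ∂μ ≤
      ENNReal.ofReal (c ^ (-α) * (1 / α + 1 / (p - α))) := by
    calc _ = ∫⁻ w, ENNReal.ofReal (Real.Gamma α) *
          ENNReal.ofReal (∑ i ∈ s, w i ^ 2) ^ (-α) ∂μ := by
          rw [lintegral_const_mul _ hmeas0]
      _ ≤ ∫⁻ w, ∫⁻ l in Set.Ioi (0 : ℝ), ENNReal.ofReal (l ^ (α - 1)) *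
          ENNReal.ofReal (Real.exp (-l * ∑ i ∈ s, w i ^ 2)) ∂volume ∂μ :=
          lintegral_mono fun w => ofReal_rpow_neg_le_lintegral hα
            (Finset.sum_nonneg fun i _ => sq_nonneg _)
      _ = ∫⁻ l in Set.Ioi (0 : ℝ), ∫⁻ w, ENNReal.ofReal (l ^ (α - 1)) *
          ENNReal.ofReal (Real.exp (-l * ∑ i ∈ s, w i ^ 2)) ∂μ :=
          lintegral_lintegral_swap hmeas.aemeasurable
      _ ≤ ∫⁻ l in Set.Ioi (0 : ℝ), ENNReal.ofReal (l ^ (α - 1)) *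
          ENNReal.ofReal ((1 + c * l) ^ (-p)) := by
          refine setLIntegral_mono (by fun_prop) fun l hl => ?_
          rw [lintegral_const_mul]
          · gcongr
            exact hb l hl
          · have : Measurable fun w : Fin d → ℝ => ∑ i ∈ s, w i ^ 2 :=
              Finset.measurable_sum _ fun i _ => by fun_prop
            fun_prop
      _ ≤ _ := lintegral_rpow_mul_one_add_le hα hp hc0
  rw [mul_comm, ← ENNReal.le_div_iff_mul_le (Or.inl (by simpa using hG))
    (Or.inl ENNReal.ofReal_ne_top), ← ENNReal.ofReal_div_of_pos hG] at key
  refine key.trans (ENNReal.ofReal_le_ofReal (le_of_eq ?_))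
  have e : c ^ (-α) = p ^ α * (τ ^ 2 * N) ^ (-α) := by
    rw [hc, div_eq_mul_inv, Real.mul_rpow (by positivity) (by positivity), Real.inv_rpow hp0.le,
      Real.rpow_neg hp0.le, inv_inv, mul_comm, mul_comm N]
  rw [e]
  field_simp

/-! ### The difference of the distances of a Gaussian point to two fixed points -/

lemma measurable_lintegral_update {ι : Type*} [DecidableEq ι]
    {f : (ι → ℝ) → ℝ≥0∞} (hf : Measurable f) (i : ι) (μ : Measure ℝ) [SFinite μ] :
    Measurable fun x => ∫⁻ z, f (Function.update x i z) ∂μ := by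
  have : Measurable fun q : (ι → ℝ) × ℝ => f (Function.update q.1 i q.2) :=
    hf.comp measurable_update'
  exact this.lintegral_prod_right'

/-- The coordinates `i₀`, `i₁`, `i₂` are integrated by `lintegral_three_gaussians_le`. The others
enter only through the norm B of their vector, linearly, and the expectation of B is at most τ√d
because their means vanish. -/
lemma lintegral_pi_gaussian_dist_sub_dist_le {d : ℕ} (hd : 0 < d) {τ t : ℝ} (hτ : 0 < τ)
    (ht : 0 < t)
    {a : Fin d → ℝ} {i₀ i₁ i₂ : Fin d} (h01 : i₀ ≠ i₁) (h02 : i₀ ≠ i₂) (h12 : i₁ ≠ i₂)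
    (ha : ∀ i, i ≠ i₀ → i ≠ i₁ → a i = 0) (ha1 : 0 < a i₁) {J : ℝ → ℝ≥0∞} (hJ : Measurable J) :
    ∫⁻ w, J (√(∑ i, w i ^ 2) - √((w i₀ - t) ^ 2 + ∑ i ∈ Finset.univ.erase i₀, w i ^ 2))
      ∂(Measure.pi fun i => gaussianReal (a i) (τ ^ 2).toNNReal) ≤
    ENNReal.ofReal (128 * (√(a i₀ ^ 2 + a i₁ ^ 2) + τ) *
        (√((a i₀ - t) ^ 2 + a i₁ ^ 2) + 5 * τ * √d) / (τ * t * a i₁)) * ∫⁻ u, J u := by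
  have hd1 : (1 : ℝ) ≤ √d := by
    rw [Real.one_le_sqrt]
    exact_mod_cast hd
  have hdsq : √(d : ℝ) ^ 2 = d := Real.sq_sqrt (by positivity)
  set S : Finset (Fin d) := ((Finset.univ.erase i₀).erase i₁).erase i₂ with hS
  have hsum : ∀ w : Fin d → ℝ, ∑ i ∈ Finset.univ.erase i₀, w i ^ 2 =
      w i₁ ^ 2 + w i₂ ^ 2 + ∑ i ∈ S, w i ^ 2 := by
    intro w
    rw [hS, ← Finset.add_sum_erase _ _ (show i₁ ∈ Finset.univ.erase i₀ by simp [h01.symm]),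
      ← Finset.add_sum_erase _ _
        (show i₂ ∈ (Finset.univ.erase i₀).erase i₁ by simp [h02.symm, h12.symm]), add_assoc]
  have hsum' : ∀ w : Fin d → ℝ, ∑ i, w i ^ 2 =
      w i₀ ^ 2 + (w i₁ ^ 2 + w i₂ ^ 2 + ∑ i ∈ S, w i ^ 2) := by
    intro w
    rw [← hsum, Finset.add_sum_erase _ (fun i => w i ^ 2) (Finset.mem_univ i₀)]
  simp_rw [hsum, hsum']
  set μ : Fin d → Measure ℝ := fun i => gaussianReal (a i) (τ ^ 2).toNNReal with hμ
  have hRm : Measurable fun w : Fin d → ℝ => ∑ i ∈ S, w i ^ 2 :=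
    Finset.measurable_sum _ fun i _ => by fun_prop
  set f : (Fin d → ℝ) → ℝ≥0∞ := fun w =>
    J (√(w i₀ ^ 2 + (w i₁ ^ 2 + w i₂ ^ 2 + ∑ i ∈ S, w i ^ 2)) -
      √((w i₀ - t) ^ 2 + (w i₁ ^ 2 + w i₂ ^ 2 + ∑ i ∈ S, w i ^ 2))) with hf
  have hfm : Measurable f := by fun_prop
  have hf1 := measurable_lintegral_update hfm i₂ (μ i₂)
  have hf2 := measurable_lintegral_update hf1 i₁ (μ i₁)
  set L := √((a i₀ - t) ^ 2 + a i₁ ^ 2) with hL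
  set M := √(a i₀ ^ 2 + a i₁ ^ 2) with hM
  have hL0 : 0 ≤ L := Real.sqrt_nonneg _
  have hM0 : 0 ≤ M := Real.sqrt_nonneg _
  set c := 128 * (M + τ) / (τ * t * a i₁) with hc
  have hc0 : 0 < c := by positivity
  rw [lintegral_pi_update μ i₂ hfm, lintegral_pi_update μ i₁ hf1, lintegral_pi_update μ i₀ hf2]
  have hcoord : ∀ x, ∫⁻ z, ∫⁻ w₁, ∫⁻ w₂,
      f (Function.update (Function.update (Function.update x i₀ z) i₁ w₁) i₂ w₂)
        ∂μ i₂ ∂μ i₁ ∂μ i₀ ≤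
      ENNReal.ofReal (c * (L + √(∑ i ∈ S, x i ^ 2) + 4 * τ)) * ∫⁻ u, J u := by
    intro x
    have hB0 : 0 ≤ ∑ i ∈ S, x i ^ 2 := Finset.sum_nonneg fun i _ => sq_nonneg _
    have key := lintegral_three_gaussians_le (a := a i₀) hτ ht
      (Real.sqrt_nonneg (∑ i ∈ S, x i ^ 2)) ha1 hJ
    rw [← hL, ← hM, Real.sq_sqrt hB0] at key
    have e : c * (L + √(∑ i ∈ S, x i ^ 2) + 4 * τ) =
        128 * (M + τ) * (L + √(∑ i ∈ S, x i ^ 2) + 4 * τ) / (τ * t * a i₁) := by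
      rw [hc]; ring
    rw [e]
    refine le_trans (le_of_eq ?_) key
    simp only [hμ, ha i₂ h02.symm h12.symm]
    refine lintegral_congr fun z => lintegral_congr fun w₁ => lintegral_congr fun w₂ => ?_
    have hSx : ∑ i ∈ S, (Function.update (Function.update (Function.update x i₀ z) i₁ w₁) i₂ w₂) i
        ^ 2 = ∑ i ∈ S, x i ^ 2 := by
      refine Finset.sum_congr rfl fun i hi => ?_
      simp only [hS, Finset.mem_erase] at hi
      rw [Function.update_of_ne hi.1, Function.update_of_ne hi.2.1, Function.update_of_ne hi.2.2.1]
    simp only [hf, hSx]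
    rw [Function.update_of_ne h02, Function.update_of_ne h01, Function.update_self,
      Function.update_of_ne h12, Function.update_self, Function.update_self]
    congr 3 <;> ring
  -- The bound r ≤ k/2 + r²/(2k) with k = τ√d reduces the first moment to the second.
  have hexp : ∫⁻ x, ENNReal.ofReal √(∑ i ∈ S, x i ^ 2) ∂Measure.pi μ ≤
      ENNReal.ofReal (τ * √d) := by
    have hk : (0 : ℝ) < 2 * (τ * √d) := by positivity
    calc _ ≤ ∫⁻ x, (ENNReal.ofReal (τ * √d / 2) + ENNReal.ofReal (1 / (2 * (τ * √d))) *
          ∑ i ∈ S, ENNReal.ofReal (x i ^ 2)) ∂Measure.pi μ := by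
          refine lintegral_mono fun x => ?_
          have hB0 : 0 ≤ ∑ i ∈ S, x i ^ 2 := Finset.sum_nonneg fun i _ => sq_nonneg _
          rw [← ENNReal.ofReal_sum_of_nonneg (fun i _ => sq_nonneg _),
            ← ENNReal.ofReal_mul (by positivity), ← ENNReal.ofReal_add (by positivity)
              (by positivity)]
          apply ENNReal.ofReal_le_ofReal
          have hsq := Real.sq_sqrt hB0
          set r := √(∑ i ∈ S, x i ^ 2) with hr
          rw [← hsq]
          have : τ * √d / 2 + 1 / (2 * (τ * √d)) * r ^ 2 - r =
            (τ * √d - r) ^ 2 / (2 * (τ * √d)) := by field_simp; ring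
          have h0 : 0 ≤ (τ * √d - r) ^ 2 / (2 * (τ * √d)) := by positivity
          linarith
      _ = ENNReal.ofReal (τ * √d / 2) + ENNReal.ofReal (1 / (2 * (τ * √d))) *
          ∑ i ∈ S, ENNReal.ofReal (τ ^ 2) := by
          rw [lintegral_add_left measurable_const, lintegral_const, measure_univ, mul_one,
            lintegral_const_mul _ (Finset.measurable_sum _ fun i _ => by fun_prop),
            lintegral_finsetSum _ fun i _ => by fun_prop]
          congr 2
          refine Finset.sum_congr rfl fun i hi => ?_
          simp only [hS, Finset.mem_erase] at hi
          rw [lintegral_pi_eval μ i (f := fun x => ENNReal.ofReal (x ^ 2)) (by fun_prop)]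
          simp only [hμ]
          rw [lintegral_sq_gaussianReal, ha i hi.2.2.1 hi.2.1]
          simp
      _ ≤ ENNReal.ofReal (τ * √d / 2) + ENNReal.ofReal (1 / (2 * (τ * √d))) *
          ENNReal.ofReal (d * τ ^ 2) := by
          gcongr
          rw [Finset.sum_const, nsmul_eq_mul, ENNReal.ofReal_mul (by positivity),
            ENNReal.ofReal_natCast]
          gcongr
          simpa using Finset.card_le_univ S
      _ = ENNReal.ofReal (τ * √d) := by
          rw [← ENNReal.ofReal_mul (by positivity), ← ENNReal.ofReal_add (by positivity)
            (by positivity)]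
          congr 1
          rw [← hdsq]
          field_simp
          rw [Real.sqrt_sq (by positivity)]
          ring
  calc _ ≤ ∫⁻ x, (ENNReal.ofReal (c * (L + √(∑ i ∈ S, x i ^ 2) + 4 * τ)) * ∫⁻ u, J u)
        ∂Measure.pi μ := lintegral_mono hcoord
    _ = ENNReal.ofReal c * (ENNReal.ofReal (L + 4 * τ) +
        ∫⁻ x, ENNReal.ofReal √(∑ i ∈ S, x i ^ 2) ∂Measure.pi μ) * ∫⁻ u, J u := by
        rw [lintegral_mul_const _ (by fun_prop)]
        congr 1
        have e : ∀ x : Fin d → ℝ, ENNReal.ofReal (c * (L + √(∑ i ∈ S, x i ^ 2) + 4 * τ)) =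
            ENNReal.ofReal c * (ENNReal.ofReal (L + 4 * τ) +
              ENNReal.ofReal √(∑ i ∈ S, x i ^ 2)) := by
          intro x
          rw [← ENNReal.ofReal_add (by positivity) (by positivity), ← ENNReal.ofReal_mul hc0.le]
          congr 1
          ring
        simp_rw [e]
        rw [lintegral_const_mul _ (by fun_prop), lintegral_add_left measurable_const,
          lintegral_const, measure_univ, mul_one]
    _ ≤ ENNReal.ofReal c * (ENNReal.ofReal (L + 4 * τ) + ENNReal.ofReal (τ * √d)) *
        ∫⁻ u, J u := by gcongr
    _ ≤ _ := by
        rw [← ENNReal.ofReal_add (by positivity) (by positivity), ← ENNReal.ofReal_mul hc0.le]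
        gcongr
        have : c * (L + 5 * τ * √d) =
          128 * (M + τ) * (L + 5 * τ * √d) / (τ * t * a i₁) := by rw [hc]; ring
        rw [← this]
        apply mul_le_mul_of_nonneg_left _ hc0.le
        nlinarith

/-! ### The density bound in terms of the triangle of the three points -/

/-- The Gram determinant of two vectors. -/
noncomputable def gram {d : ℕ} (u v : Space d) : ℝ := ‖u‖ ^ 2 * ‖v‖ ^ 2 - inner ℝ u v ^ 2

/-- The Gram determinant is four times the squared area of a triangle, so the base point may be
moved to another vertex. -/
lemma gram_sub_right {d : ℕ} (u v : Space d) : gram (u - v) (-v) = gram u v := by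
  simp only [gram, ← real_inner_self_eq_norm_sq, inner_sub_left, inner_sub_right, inner_neg_right,
    inner_neg_left, real_inner_comm u v]
  ring

lemma exists_orthonormalBasis_pair {d : ℕ} {i₀ i₁ : Fin d} (h : i₀ ≠ i₁) {e₀ e₁ : Space d}
    (h0 : ‖e₀‖ = 1) (h1 : ‖e₁‖ = 1) (h01 : inner ℝ e₀ e₁ = 0) :
    ∃ b : OrthonormalBasis (Fin d) ℝ (Space d), b i₀ = e₀ ∧ b i₁ = e₁ := by
  classical
  have hv : Orthonormal ℝ (({i₀, i₁} : Set (Fin d)).domRestrict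
      (fun i => if i = i₀ then e₀ else e₁)) := by
    rw [orthonormal_iff_ite]
    rintro ⟨i, hi⟩ ⟨j, hj⟩
    have h10 : inner ℝ e₁ e₀ = 0 := by rw [real_inner_comm]; exact h01
    rcases hi with rfl | rfl <;> rcases hj with rfl | rfl <;>
      simp only [Set.domRestrict, h.symm, if_true, if_false, h01, h10, real_inner_self_eq_norm_sq,
        h0, h1, one_pow]
    · exact (if_neg fun hh => h (congrArg Subtype.val hh)).symm
    · exact (if_neg fun hh => h (congrArg Subtype.val hh).symm).symm
  obtain ⟨b, hb⟩ := hv.exists_orthonormalBasis_extension_of_card_eq (by simp)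
  refine ⟨b, ?_, ?_⟩
  · rw [hb i₀ (by simp)]; simp
  · rw [hb i₁ (by simp)]; simp [h.symm]

/-- The frame has its origin at c, its first axis along b - c, of length t, and its second along the
component of m - c orthogonal to it, of length β. Then √gram = tβ, which is twice the area of the
triangle b, m, c, and all other coordinates of the mean vanish. -/
lemma lintegral_isoGaussian_dist_sub_dist_le {d : ℕ} (hd : 3 ≤ d) {τ : ℝ} (hτ : 0 < τ)
    (b c m : Space d) (hg : 0 < gram (b - m) (c - m)) {J : ℝ → ℝ≥0∞} (hJ : Measurable J) :
    ∫⁻ g, J (‖m + g - c‖ - ‖m + g - b‖) ∂isoGaussian d τ ≤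
      ENNReal.ofReal (128 * (‖m - c‖ + τ) * (‖m - b‖ + 5 * τ * √d) /
        (τ * √(gram (b - m) (c - m)))) * ∫⁻ u, J u := by
  have hgram : gram (b - m) (c - m) = gram (b - c) (m - c) := by
    have := gram_sub_right (b - m) (c - m)
    rwa [neg_sub, sub_sub_sub_cancel_right, eq_comm] at this
  rw [hgram] at hg ⊢
  set t := ‖b - c‖ with ht
  set v := m - c with hv
  have ht0 : 0 < t := by
    rw [ht, norm_pos_iff]
    intro h
    rw [h] at hg
    simp [gram] at hg
  set e₀ : Space d := t⁻¹ • (b - c) with he₀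
  have hbc : b - c = t • e₀ := by rw [he₀, smul_inv_smul₀ ht0.ne']
  have he₀1 : ‖e₀‖ = 1 := by
    rw [he₀, norm_smul, ← ht, norm_inv, Real.norm_of_nonneg ht0.le, inv_mul_cancel₀ ht0.ne']
  have he₀i : inner ℝ e₀ e₀ = 1 := by rw [real_inner_self_eq_norm_sq, he₀1]; norm_num
  clear_value e₀
  set α := inner ℝ e₀ v with hα
  have hα' : inner ℝ v e₀ = α := by rw [real_inner_comm]
  set p := v - α • e₀ with hp
  have hpi : inner ℝ e₀ p = 0 := by
    rw [hp, inner_sub_right, inner_smul_right, he₀i, ← hα]; ring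
  set β := ‖p‖ with hβ
  have hvp : v = α • e₀ + p := by rw [hp]; abel
  have hβsq : β ^ 2 = ‖v‖ ^ 2 - α ^ 2 := by
    rw [hβ, ← real_inner_self_eq_norm_sq, ← real_inner_self_eq_norm_sq, hp]
    simp only [inner_sub_left, inner_sub_right, inner_smul_left, inner_smul_right, he₀i,
      hα', ← hα, RCLike.conj_to_real]
    ring
  have hgb : gram (b - c) v = (t * β) ^ 2 := by
    rw [gram, mul_pow, hβsq, ← ht, hbc, inner_smul_left]
    simp only [RCLike.conj_to_real, ← hα]
    ring
  have hβ0 : 0 < β := by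
    rcases (norm_nonneg p).eq_or_lt with h | h
    · rw [hgb, hβ, ← h] at hg
      simp at hg
    · exact h
  have hsqrt : √(gram (b - c) v) = t * β := by rw [hgb, Real.sqrt_sq (by positivity)]
  set e₁ : Space d := β⁻¹ • p with he₁
  have hpe : p = β • e₁ := by rw [he₁, smul_inv_smul₀ hβ0.ne']
  have he₁1 : ‖e₁‖ = 1 := by
    rw [he₁, norm_smul, ← hβ, norm_inv, Real.norm_of_nonneg hβ0.le, inv_mul_cancel₀ hβ0.ne']
  clear_value e₁
  have he₀₁ : inner ℝ e₀ e₁ = 0 := by rw [he₁, inner_smul_right, hpi, mul_zero]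
  let i₀ : Fin d := ⟨0, by omega⟩
  let i₁ : Fin d := ⟨1, by omega⟩
  let i₂ : Fin d := ⟨2, by omega⟩
  have h01 : i₀ ≠ i₁ := by simp [i₀, i₁]
  have h02 : i₀ ≠ i₂ := by simp [i₀, i₂]
  have h12 : i₁ ≠ i₂ := by simp [i₁, i₂]
  obtain ⟨B, hB0, hB1⟩ := exists_orthonormalBasis_pair h01 he₀1 he₁1 he₀₁
  have hr0 : B.repr e₀ = EuclideanSpace.single i₀ 1 := by rw [← hB0, B.repr_self]
  have hr1 : B.repr e₁ = EuclideanSpace.single i₁ 1 := by rw [← hB1, B.repr_self]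
  have hvr : B.repr v = α • EuclideanSpace.single i₀ 1 + β • EuclideanSpace.single i₁ 1 := by
    rw [hvp, hpe, map_add, map_smul, map_smul, hr0, hr1]
  have ha0 : B.repr v i₀ = α := by rw [hvr]; simp [h01]
  have ha1 : B.repr v i₁ = β := by rw [hvr]; simp [h01.symm]
  have ha : ∀ i, i ≠ i₀ → i ≠ i₁ → B.repr v i = 0 := by
    intro i hi hi'
    rw [hvr]; simp [hi, hi']
  have hnorm : ∀ x : Space d, ‖x‖ = √(∑ i, B.repr x i ^ 2) := by
    intro x
    rw [← EuclideanSpace.real_norm_sq_eq, B.repr.norm_map, Real.sqrt_sq (norm_nonneg _)]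
  have hnorm' : ∀ x : Space d, ‖x - t • e₀‖ =
      √((B.repr x i₀ - t) ^ 2 + ∑ i ∈ Finset.univ.erase i₀, B.repr x i ^ 2) := by
    intro x
    rw [hnorm, ← Finset.add_sum_erase _ _ (Finset.mem_univ i₀)]
    congr 2
    · simp [hr0]
    · refine Finset.sum_congr rfl fun i hi => ?_
      have : i ≠ i₀ := (Finset.mem_erase.1 hi).1
      simp [hr0, this]
  set F : (Fin d → ℝ) → ℝ≥0∞ := fun w =>
    J (√(∑ i, w i ^ 2) - √((w i₀ - t) ^ 2 + ∑ i ∈ Finset.univ.erase i₀, w i ^ 2)) with hF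
  have hFm : Measurable F := by
    have : Measurable fun w : Fin d → ℝ => ∑ i, w i ^ 2 :=
      Finset.measurable_sum _ fun i _ => by fun_prop
    have : Measurable fun w : Fin d → ℝ => ∑ i ∈ Finset.univ.erase i₀, w i ^ 2 :=
      Finset.measurable_sum _ fun i _ => by fun_prop
    fun_prop
  have h1 : ∀ g : Space d, J (‖m + g - c‖ - ‖m + g - b‖) = F fun i => B.repr (v + g) i := by
    intro g
    simp only [hF]
    rw [← hnorm, ← hnorm', ← hbc]
    congr 3
    · rw [hv]; abel
    · rw [hv]; abel
  simp_rw [h1]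
  rw [lintegral_isoGaussian_repr τ B v hFm]
  have key := lintegral_pi_gaussian_dist_sub_dist_le (by omega : 0 < d) hτ ht0 h01 h02 h12 ha
    (by rw [ha1]; exact hβ0) hJ
  refine key.trans (le_of_eq ?_)
  have hn1 : √(α ^ 2 + β ^ 2) = ‖v‖ := by
    rw [hβsq, add_sub_cancel, Real.sqrt_sq (norm_nonneg _)]
  have hn2 : √((α - t) ^ 2 + β ^ 2) = ‖m - b‖ := by
    have : ‖m - b‖ = ‖v - t • e₀‖ := by rw [← hbc, hv]; congr 1; abel
    rw [this, hnorm', ha0, ← ha1]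
    congr 2
    rw [← Finset.add_sum_erase _ _ (show i₁ ∈ Finset.univ.erase i₀ by simp [h01.symm]),
      Finset.sum_eq_zero, add_zero]
    intro i hi
    simp only [Finset.mem_erase] at hi
    rw [ha i hi.2.1 hi.1]
    norm_num
  rw [ha0, ha1, hn1, hn2, hsqrt, mul_assoc τ]

/-- Bounds, up to a constant, the density of the difference of the distances of a Gaussian point
with mean `m` to the points `c` and `b`. -/
noncomputable def distKernel {d : ℕ} (τ : ℝ) (b m c : Space d) : ℝ≥0∞ :=
  ENNReal.ofReal (‖m - c‖ + τ) * ENNReal.ofReal (‖m - b‖ + τ * √d) * (ENNReal.ofReal τ)⁻¹ *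
    (ENNReal.ofReal √(gram (b - m) (c - m)))⁻¹

lemma measurable_distKernel {d : ℕ} (τ : ℝ) :
    Measurable fun q : Space d × Space d × Space d => distKernel τ q.1 q.2.1 q.2.2 := by
  unfold distKernel gram
  fun_prop

/-- The indicator function of `[s, s + ε]`. -/
noncomputable def window (s ε : ℝ) : ℝ → ℝ≥0∞ := (Set.Icc s (s + ε)).indicator 1

lemma measurable_window (s ε : ℝ) : Measurable (window s ε) :=
  measurable_one.indicator measurableSet_Icc

lemma window_le_one (s ε u : ℝ) : window s ε u ≤ 1 :=
  Set.indicator_le_self' (fun _ _ => zero_le) u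

lemma lintegral_window (s ε : ℝ) : ∫⁻ u, window s ε u = ENNReal.ofReal ε := by
  rw [window, lintegral_indicator_one measurableSet_Icc, Real.volume_Icc, add_sub_cancel_left]

lemma lintegral_window_le_distKernel {d : ℕ} (hd : 3 ≤ d) {τ ε : ℝ} (hτ : 0 < τ) (hε : 0 < ε)
    (s : ℝ) (b m c : Space d) :
    ∫⁻ g, window s ε (‖m + g - c‖ - ‖m + g - b‖) ∂isoGaussian d τ ≤
      ENNReal.ofReal (640 * ε) * distKernel τ b m c := by
  have hd0 : (0 : ℝ) < √d := Real.sqrt_pos.2 (by exact_mod_cast (by omega : 0 < d))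
  by_cases hg : 0 < gram (b - m) (c - m)
  · refine (lintegral_isoGaussian_dist_sub_dist_le hd hτ b c m hg
      (measurable_window s ε)).trans ?_
    have hg' : 0 < √(gram (b - m) (c - m)) := Real.sqrt_pos.2 hg
    rw [lintegral_window, distKernel, ← ENNReal.ofReal_inv_of_pos hτ,
      ← ENNReal.ofReal_inv_of_pos hg', ← ENNReal.ofReal_mul (by positivity),
      ← ENNReal.ofReal_mul (by positivity), ← ENNReal.ofReal_mul (by positivity),
      ← ENNReal.ofReal_mul (by positivity), ← ENNReal.ofReal_mul (by positivity)]
    apply ENNReal.ofReal_le_ofReal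
    calc _ ≤ 128 * (‖m - c‖ + τ) * (5 * (‖m - b‖ + τ * √d)) /
          (τ * √(gram (b - m) (c - m))) * ε := by
          gcongr
          nlinarith [norm_nonneg (m - b)]
      _ = _ := by field_simp; norm_num
  -- For collinear points the last factor of the kernel is infinite and the others are positive, so
  -- the bound is trivial.
  · have h1 : distKernel τ b m c = ⊤ := by
      rw [distKernel, Real.sqrt_eq_zero_of_nonpos (not_lt.1 hg), ENNReal.ofReal_zero,
        ENNReal.inv_zero]
      apply ENNReal.mul_top
      simp only [ne_eq, mul_eq_zero, ENNReal.ofReal_eq_zero, not_or, not_le,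
        ENNReal.inv_eq_zero, ENNReal.ofReal_ne_top, not_false_eq_true, and_true]
      constructor <;> positivity
    rw [h1, ENNReal.mul_top (by simpa using hε)]
    exact le_top

/-! ### Moments of the kernel -/

lemma exists_orthonormalBasis_single {d : ℕ} (i₀ : Fin d) {e₀ : Space d} (h0 : ‖e₀‖ = 1) :
    ∃ b : OrthonormalBasis (Fin d) ℝ (Space d), b i₀ = e₀ := by
  have hv : Orthonormal ℝ (({i₀} : Set (Fin d)).domRestrict (fun _ => e₀)) := by
    rw [orthonormal_iff_ite]
    rintro ⟨i, hi⟩ ⟨j, hj⟩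
    rw [Set.mem_singleton_iff] at hi hj
    subst hi
    subst hj
    simp [Set.domRestrict, h0]
  obtain ⟨b, hb⟩ := hv.exists_orthonormalBasis_extension_of_card_eq (by simp)
  exact ⟨b, hb i₀ (by simp)⟩

lemma lintegral_pi_mul_of_update {d : ℕ} (μ : Fin d → Measure ℝ) [∀ i, IsProbabilityMeasure (μ i)]
    (i : Fin d) {h : ℝ → ℝ≥0∞} {k : (Fin d → ℝ) → ℝ≥0∞} (hh : Measurable h) (hk : Measurable k)
    (hki : ∀ w z, k (Function.update w i z) = k w) :
    ∫⁻ w, h (w i) * k w ∂Measure.pi μ = (∫⁻ z, h z ∂μ i) * ∫⁻ w, k w ∂Measure.pi μ := by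
  rw [lintegral_pi_update μ i (by fun_prop)]
  simp only [Function.update_self, hki]
  rw [← lintegral_const_mul _ hk]
  refine lintegral_congr fun w => ?_
  rw [lintegral_mul_const _ hh]

/-- With S = |m| + τ one has x^(5/3) ≤ S^(5/3) (1 + (x/S)²), and the second moment of |z| + τ is at
most 6S². -/
lemma lintegral_abs_add_rpow_le {σ τ : ℝ} (hτ : 0 < τ) (hστ : σ ^ 2 = τ ^ 2 + τ ^ 2) (m : ℝ) :
    ∫⁻ z, ENNReal.ofReal (|z| + τ) ^ (5 / 3 : ℝ) ∂gaussianReal m (σ ^ 2).toNNReal ≤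
      ENNReal.ofReal (7 * (|m| + τ) ^ (5 / 3 : ℝ)) := by
  set S := |m| + τ with hS
  have hS0 : 0 < S := by positivity
  calc _ ≤ ∫⁻ z, (ENNReal.ofReal (S ^ (5 / 3 : ℝ)) + ENNReal.ofReal (S ^ (5 / 3 : ℝ) / S ^ 2) *
        (ENNReal.ofReal (2 * τ ^ 2) + ENNReal.ofReal 2 * ENNReal.ofReal (z ^ 2)))
          ∂gaussianReal m (σ ^ 2).toNNReal := by
        refine lintegral_mono fun z => ?_
        rw [← ENNReal.ofReal_mul (by positivity), ← ENNReal.ofReal_add (by positivity)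
          (by positivity), ← ENNReal.ofReal_mul (by positivity),
          ← ENNReal.ofReal_add (by positivity) (by positivity),
          ENNReal.ofReal_rpow_of_nonneg (by positivity) (by norm_num)]
        apply ENNReal.ofReal_le_ofReal
        set x := |z| + τ with hx
        have hx0 : 0 < x := by positivity
        have h1 : (x / S) ^ (5 / 3 : ℝ) ≤ 1 + (x / S) ^ 2 := by
          have h0 : 0 ≤ x / S := by positivity
          rcases le_total (x / S) 1 with h | h
          · have := Real.rpow_le_one h0 h (show (0 : ℝ) ≤ 5 / 3 by norm_num)
            nlinarith [sq_nonneg (x / S)]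
          · have := Real.rpow_le_rpow_of_exponent_le h (show (5 / 3 : ℝ) ≤ 2 by norm_num)
            rw [Real.rpow_two] at this
            linarith
        rw [Real.div_rpow hx0.le hS0.le, div_le_iff₀ (by positivity)] at h1
        have h2 : x ^ 2 ≤ 2 * τ ^ 2 + 2 * z ^ 2 := by
          rw [hx, ← sq_abs z]
          nlinarith [sq_nonneg (|z| - τ)]
        calc _ ≤ _ := h1
          _ = S ^ (5 / 3 : ℝ) + S ^ (5 / 3 : ℝ) / S ^ 2 * x ^ 2 := by
            rw [div_pow]
            field_simp
          _ ≤ _ := by gcongr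
    _ = ENNReal.ofReal (S ^ (5 / 3 : ℝ)) + ENNReal.ofReal (S ^ (5 / 3 : ℝ) / S ^ 2) *
        (ENNReal.ofReal (2 * τ ^ 2) + ENNReal.ofReal 2 * ENNReal.ofReal (m ^ 2 + σ ^ 2)) := by
        rw [lintegral_add_left measurable_const, lintegral_const, measure_univ, mul_one,
          lintegral_const_mul _ (by fun_prop), lintegral_add_left measurable_const,
          lintegral_const, measure_univ, mul_one, lintegral_const_mul _ (by fun_prop),
          lintegral_sq_gaussianReal]
    _ ≤ _ := by
        rw [← ENNReal.ofReal_mul (by positivity), ← ENNReal.ofReal_add (by positivity)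
          (by positivity), ← ENNReal.ofReal_mul (by positivity),
          ← ENNReal.ofReal_add (by positivity) (by positivity)]
        apply ENNReal.ofReal_le_ofReal
        have h2 : 2 * τ ^ 2 + 2 * (m ^ 2 + σ ^ 2) ≤ 6 * S ^ 2 := by
          rw [hστ, hS, ← sq_abs m]
          nlinarith [mul_nonneg (abs_nonneg m) hτ.le, sq_nonneg |m|]
        calc _ ≤ S ^ (5 / 3 : ℝ) + S ^ (5 / 3 : ℝ) / S ^ 2 * (6 * S ^ 2) := by gcongr
          _ = _ := by field_simp; norm_num

/-- Here √gram is ‖b - m‖ times the distance of c from the line through m and b. For a Gaussian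
point c this distance is the norm of d - 1 ≥ 2 coordinates, independent of the coordinate along the
line, so its moment of order -5/3 is finite. The numerator ‖m - c‖ is at most the coordinate along
the line plus that distance, which gives the two summands of the last factor. -/
lemma exists_lintegral_distKernel_rpow_le :
    ∃ C : ℝ, 0 < C ∧ ∀ (d : ℕ), 3 ≤ d → ∀ σ τ : ℝ, 0 < τ → σ ^ 2 = τ ^ 2 + τ ^ 2 → 0 < σ →
      ∀ b m y : Space d,
      ∫⁻ g, distKernel τ b m (y + g) ^ (5 / 3 : ℝ) ∂isoGaussian d σ ≤
        ENNReal.ofReal C * (ENNReal.ofReal (1 / τ) *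
          (1 + ENNReal.ofReal (τ * √d) * (ENNReal.ofReal ‖m - b‖)⁻¹)) ^ (5 / 3 : ℝ) *
        (1 + ENNReal.ofReal ((‖y - m‖ + τ) / (τ * √d)) ^ (5 / 3 : ℝ)) := by
  -- The exponent 5/6 on the sum of squares is 5/3 on the norm; p = 1 asks for two coordinates only.
  obtain ⟨C₁, hC₁, hinv⟩ := exists_lintegral_sum_sq_rpow_neg_le (α := 5 / 6) (p := 1)
    (by norm_num) (by norm_num)
  refine ⟨2 * (1 + 7 * C₁), by positivity, ?_⟩
  intro d hd σ τ hτ hστ hσ b m y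
  have hdpos : (0 : ℝ) < d := by exact_mod_cast (by omega : 0 < d)
  have hd0 : (0 : ℝ) < √d := Real.sqrt_pos.2 hdpos
  set A : ℝ≥0∞ := ENNReal.ofReal (1 / τ) *
    (1 + ENNReal.ofReal (τ * √d) * (ENNReal.ofReal ‖m - b‖)⁻¹) with hA
  -- For m = b the right-hand side is infinite.
  rcases eq_or_ne m b with rfl | hmb
  · have hAtop : A = ⊤ := by
      have h1 : ENNReal.ofReal (τ * √d) ≠ 0 := by
        rw [Ne, ENNReal.ofReal_eq_zero, not_le]; positivity
      have h2 : ENNReal.ofReal (1 / τ) ≠ 0 := by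
        rw [Ne, ENNReal.ofReal_eq_zero, not_le]; positivity
      rw [hA, sub_self, norm_zero, ENNReal.ofReal_zero, ENNReal.inv_zero, ENNReal.mul_top h1,
        add_top, ENNReal.mul_top h2]
    rw [hAtop, ENNReal.top_rpow_of_pos (by norm_num), ENNReal.mul_top, ENNReal.top_mul]
    · exact le_top
    · simp
    · rw [Ne, ENNReal.ofReal_eq_zero, not_le]; positivity
  set u := b - m with hu
  have hu0 : 0 < ‖u‖ := norm_pos_iff.2 (sub_ne_zero.2 hmb.symm)
  have hmb' : ‖m - b‖ = ‖u‖ := by rw [hu, norm_sub_rev]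
  set e₀ : Space d := ‖u‖⁻¹ • u with he₀
  have hue : u = ‖u‖ • e₀ := by rw [he₀, smul_inv_smul₀ hu0.ne']
  have he₀1 : ‖e₀‖ = 1 := by
    rw [he₀, norm_smul, norm_inv, norm_norm, inv_mul_cancel₀ hu0.ne']
  clear_value e₀
  let i₀ : Fin d := ⟨0, by omega⟩
  obtain ⟨B, hB⟩ := exists_orthonormalBasis_single i₀ he₀1
  set v := y - m with hv
  set N : Finset (Fin d) := Finset.univ.erase i₀ with hN
  have hQm : Measurable fun w : Fin d → ℝ => ∑ i ∈ N, w i ^ 2 :=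
    Finset.measurable_sum _ fun i _ => by fun_prop
  have hN0 : ∀ w : Fin d → ℝ, 0 ≤ ∑ i ∈ N, w i ^ 2 := fun w =>
    Finset.sum_nonneg fun i _ => sq_nonneg _
  set h : ℝ → ℝ≥0∞ := fun z => ENNReal.ofReal (|z| + τ) ^ (5 / 3 : ℝ) with hh
  set k : (Fin d → ℝ) → ℝ≥0∞ := fun w => ENNReal.ofReal (∑ i ∈ N, w i ^ 2) ^ (-(5 / 6) : ℝ) with hk
  have hpt : ∀ g : Space d, distKernel τ b m (y + g) ^ (5 / 3 : ℝ) ≤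
      A ^ (5 / 3 : ℝ) * (2 * (1 + h (B.repr (v + g) i₀) * k fun i => B.repr (v + g) i)) := by
    intro g
    set X := v + g with hX
    set w : Fin d → ℝ := fun i => B.repr X i with hw
    have hsplit : ‖X‖ ^ 2 = w i₀ ^ 2 + ∑ i ∈ N, w i ^ 2 := by
      rw [← B.repr.norm_map, EuclideanSpace.real_norm_sq_eq, hN,
        Finset.add_sum_erase _ (fun i => w i ^ 2) (Finset.mem_univ i₀)]
    have hgram : √(gram u X) = ‖u‖ * √(∑ i ∈ N, w i ^ 2) := by
      have : gram u X = ‖u‖ ^ 2 * ∑ i ∈ N, w i ^ 2 := by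
        have hin : inner ℝ u X = ‖u‖ * w i₀ := by
          conv_lhs => rw [hue]
          rw [inner_smul_left, ← hB, ← B.repr_apply_apply]
          simp [hw]
        rw [gram, hin, hsplit]
        ring
      rw [this, Real.sqrt_mul (sq_nonneg _), Real.sqrt_sq hu0.le]
    have hXn : ‖X‖ ≤ |w i₀| + √(∑ i ∈ N, w i ^ 2) := by
      apply le_of_sq_le_sq _ (by positivity)
      rw [hsplit, ← sq_abs (w i₀)]
      have := Real.sq_sqrt (hN0 w)
      nlinarith [mul_nonneg (abs_nonneg (w i₀)) (Real.sqrt_nonneg (∑ i ∈ N, w i ^ 2))]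
    set q := ENNReal.ofReal √(∑ i ∈ N, w i ^ 2) with hq
    have e1 : distKernel τ b m (y + g) ≤
        A * (1 + ENNReal.ofReal (|w i₀| + τ) * q⁻¹) := by
      have eX : y + g - m = X := by rw [hX, hv]; abel
      have eX' : ‖m - (y + g)‖ = ‖X‖ := by rw [norm_sub_rev, eX]
      rw [distKernel, eX, eX', hgram, hmb', ENNReal.ofReal_mul hu0.le, ← hq,
        ENNReal.mul_inv (Or.inr ENNReal.ofReal_ne_top) (Or.inl ENNReal.ofReal_ne_top)]
      have eA : A = ENNReal.ofReal (‖u‖ + τ * √d) * (ENNReal.ofReal τ)⁻¹ *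
          (ENNReal.ofReal ‖u‖)⁻¹ := by
        have hi : ENNReal.ofReal ‖u‖ * (ENNReal.ofReal ‖u‖)⁻¹ = 1 :=
          ENNReal.mul_inv_cancel (by rw [Ne, ENNReal.ofReal_eq_zero, not_le]; exact hu0)
            ENNReal.ofReal_ne_top
        rw [hA, hmb', ENNReal.ofReal_add hu0.le (by positivity), one_div,
          ENNReal.ofReal_inv_of_pos hτ, ← hi]
        ring
      calc _ = A * (ENNReal.ofReal (‖X‖ + τ) * q⁻¹) := by
            rw [eA]; ring
        _ ≤ A * ((ENNReal.ofReal (|w i₀| + τ) + q) * q⁻¹) := by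
            gcongr
            rw [hq, ← ENNReal.ofReal_add (by positivity) (by positivity)]
            apply ENNReal.ofReal_le_ofReal
            linarith
        _ ≤ _ := by
            rw [add_mul, add_comm]
            gcongr
            exact ENNReal.mul_inv_le_one _
    calc _ ≤ (A * (1 + ENNReal.ofReal (|w i₀| + τ) * q⁻¹)) ^ (5 / 3 : ℝ) := by gcongr
      _ = A ^ (5 / 3 : ℝ) * (1 + ENNReal.ofReal (|w i₀| + τ) * q⁻¹) ^ (5 / 3 : ℝ) :=
          ENNReal.mul_rpow_of_nonneg _ _ (by norm_num)
      _ ≤ A ^ (5 / 3 : ℝ) * (2 ^ (5 / 3 - 1 : ℝ) * (1 ^ (5 / 3 : ℝ) +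
          (ENNReal.ofReal (|w i₀| + τ) * q⁻¹) ^ (5 / 3 : ℝ))) := by
          gcongr
          exact ENNReal.rpow_add_le_mul_rpow_add_rpow _ _ (by norm_num)
      _ ≤ A ^ (5 / 3 : ℝ) * (2 ^ (1 : ℝ) * (1 ^ (5 / 3 : ℝ) +
          (ENNReal.ofReal (|w i₀| + τ) * q⁻¹) ^ (5 / 3 : ℝ))) := by
          gcongr
          · norm_num
          · norm_num
      _ = _ := by
          rw [ENNReal.rpow_one, ENNReal.one_rpow,
            ENNReal.mul_rpow_of_nonneg (ENNReal.ofReal (|w i₀| + τ)) q⁻¹ (by norm_num)]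
          have : q⁻¹ ^ (5 / 3 : ℝ) = k w := by
            simp only [hk, hq]
            rw [Real.sqrt_eq_rpow, ← ENNReal.ofReal_rpow_of_nonneg (hN0 w) (by norm_num),
              ENNReal.inv_rpow, ← ENNReal.rpow_neg, ← ENNReal.rpow_mul]
            norm_num
          rw [this]
  have hkm : Measurable k := by fun_prop
  have hhm : Measurable h := by fun_prop
  have hki : ∀ w z, k (Function.update w i₀ z) = k w := by
    intro w z
    simp only [hk]
    congr 2
    refine Finset.sum_congr rfl fun i hi => ?_
    rw [Function.update_of_ne (Finset.mem_erase.1 hi).1]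
  have hcard : (N.card : ℝ) = d - 1 := by
    rw [hN, Finset.card_erase_of_mem (Finset.mem_univ _), Finset.card_univ, Fintype.card_fin,
      Nat.cast_sub (by omega), Nat.cast_one]
  have hd3 : (3 : ℝ) ≤ d := by exact_mod_cast hd
  have hmain : ∫⁻ g, h (B.repr (v + g) i₀) * k (fun i => B.repr (v + g) i) ∂isoGaussian d σ ≤
      ENNReal.ofReal (7 * C₁) * ENNReal.ofReal ((‖v‖ + τ) / (τ * √d)) ^ (5 / 3 : ℝ) := by
    rw [lintegral_isoGaussian_repr σ B v (F := fun w => h (w i₀) * k w) (by fun_prop),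
      lintegral_pi_mul_of_update _ i₀ hhm hkm hki]
    have hv0 : |B.repr v i₀| ≤ ‖v‖ := by
      rw [B.repr_apply_apply]
      refine (abs_real_inner_le_norm _ _).trans ?_
      rw [hB, he₀1, one_mul]
    calc _ ≤ ENNReal.ofReal (7 * (|B.repr v i₀| + τ) ^ (5 / 3 : ℝ)) *
          ENNReal.ofReal (C₁ * (σ ^ 2 * N.card) ^ (-(5 / 6) : ℝ)) := by
          gcongr
          · exact lintegral_abs_add_rpow_le hτ hστ _
          · exact hinv d _ σ hσ N (by rw [hcard]; linarith)
      _ ≤ ENNReal.ofReal (7 * (‖v‖ + τ) ^ (5 / 3 : ℝ)) *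
          ENNReal.ofReal (C₁ * ((τ * √d) ^ 2) ^ (-(5 / 6) : ℝ)) := by
          gcongr ENNReal.ofReal (7 * ?_ ^ _) * ENNReal.ofReal (_ * ?_)
          · linarith
          · apply Real.rpow_le_rpow_of_nonpos (by positivity) _ (by norm_num)
            rw [hcard, mul_pow, Real.sq_sqrt hdpos.le, hστ]
            nlinarith [sq_nonneg τ]
      _ = _ := by
          rw [← ENNReal.ofReal_mul (by positivity),
            ENNReal.ofReal_rpow_of_nonneg (by positivity) (by norm_num),
            ← ENNReal.ofReal_mul (by positivity)]
          congr 1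
          rw [Real.div_rpow (by positivity) (by positivity), ← Real.rpow_natCast (τ * √d) 2,
            ← Real.rpow_mul (by positivity),
            show ((2 : ℕ) : ℝ) * -(5 / 6) = -(5 / 3) by norm_num, Real.rpow_neg (by positivity)]
          ring
  have hm' : Measurable fun g : Space d =>
      h (B.repr (v + g) i₀) * k fun i => B.repr (v + g) i := by
    have : Measurable fun g : Space d => (fun i => B.repr (v + g) i : Fin d → ℝ) := by
      have hc : Continuous fun g : Space d => B.repr (v + g) := by fun_prop
      exact (by fun_prop : Measurable fun x : Space d => (fun i => x i : Fin d → ℝ)).comp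
        hc.measurable
    exact (by fun_prop : Measurable fun w : Fin d → ℝ => h (w i₀) * k w).comp this
  calc _ ≤ ∫⁻ g, A ^ (5 / 3 : ℝ) * (2 * (1 + h (B.repr (v + g) i₀) *
        k fun i => B.repr (v + g) i)) ∂isoGaussian d σ := lintegral_mono hpt
    _ = A ^ (5 / 3 : ℝ) * (2 * (1 + ∫⁻ g, h (B.repr (v + g) i₀) *
        k (fun i => B.repr (v + g) i) ∂isoGaussian d σ)) := by
        rw [lintegral_const_mul _ (by fun_prop), lintegral_const_mul _ (by fun_prop),
          lintegral_add_left measurable_const, lintegral_const, measure_univ, mul_one]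
    _ ≤ A ^ (5 / 3 : ℝ) * (2 * (1 + ENNReal.ofReal (7 * C₁) *
        ENNReal.ofReal ((‖v‖ + τ) / (τ * √d)) ^ (5 / 3 : ℝ))) := by gcongr
    _ ≤ A ^ (5 / 3 : ℝ) * (2 * (ENNReal.ofReal (1 + 7 * C₁) * (1 +
        ENNReal.ofReal ((‖v‖ + τ) / (τ * √d)) ^ (5 / 3 : ℝ)))) := by
        rw [ENNReal.ofReal_add (by norm_num) (by positivity), ENNReal.ofReal_one,
          mul_add (1 + ENNReal.ofReal (7 * C₁)), mul_one]
        gcongr A ^ _ * (2 * (?_ + ?_ * _))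
        · exact le_self_add
        · exact le_add_self
    _ = _ := by
        rw [ENNReal.ofReal_mul (by norm_num), ENNReal.ofReal_ofNat]
        ring

lemma rpow_lintegral_le_lintegral_rpow {α : Type*} [MeasurableSpace α] (μ : Measure α)
    [IsProbabilityMeasure μ] {p : ℝ} (hp : 1 < p) {f : α → ℝ≥0∞} (hf : AEMeasurable f μ) :
    (∫⁻ a, f a ∂μ) ^ p ≤ ∫⁻ a, f a ^ p ∂μ := by
  have hp0 : 0 < p := by linarith
  have h := ENNReal.lintegral_mul_le_Lp_mul_Lq μ (Real.HolderConjugate.conjExponent hp) hf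
    (g := fun _ => 1) measurable_const.aemeasurable
  simp only [Pi.mul_apply, mul_one, ENNReal.one_rpow, lintegral_const, measure_univ] at h
  calc _ ≤ ((∫⁻ a, f a ^ p ∂μ) ^ (1 / p)) ^ p := by gcongr
    _ = _ := by
      rw [← ENNReal.rpow_mul, one_div_mul_cancel hp0.ne', ENNReal.rpow_one]

/-- This is Young's inequality with exponents 6/5 and 6, without its constants. It separates the
factor 1/‖m - b‖, for which second moments are used, from a factor that has all moments. -/
lemma mul_rpow_le_sq_add_pow (x y : ℝ≥0∞) : (x * y) ^ (5 / 3 : ℝ) ≤ x ^ 2 + y ^ 10 := by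
  rcases le_total x (y ^ 5) with h | h
  · refine le_trans ?_ le_add_self
    calc (x * y) ^ (5 / 3 : ℝ) ≤ (y ^ 5 * y) ^ (5 / 3 : ℝ) := by gcongr
      _ = y ^ 10 := by
        rw [← pow_succ, ← ENNReal.rpow_natCast, ← ENNReal.rpow_natCast, ← ENNReal.rpow_mul]
        norm_num
  · refine le_trans ?_ le_self_add
    have hy : y ≤ x ^ (1 / 5 : ℝ) := by
      have : (y ^ 5) ^ (1 / 5 : ℝ) ≤ x ^ (1 / 5 : ℝ) := by gcongr
      rwa [← ENNReal.rpow_natCast, ← ENNReal.rpow_mul, show ((5 : ℕ) : ℝ) * (1 / 5) = 1 by norm_num,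
        ENNReal.rpow_one] at this
    calc (x * y) ^ (5 / 3 : ℝ) ≤ (x ^ (1 : ℝ) * x ^ (1 / 5 : ℝ)) ^ (5 / 3 : ℝ) := by
          rw [ENNReal.rpow_one]; gcongr
      _ = x ^ 2 := by
        rw [← ENNReal.rpow_add_of_nonneg _ _ (by norm_num) (by norm_num), ← ENNReal.rpow_mul,
          ← ENNReal.rpow_natCast]
        norm_num

lemma sq_add_le (x y : ℝ≥0∞) : (x + y) ^ 2 ≤ 2 * (x ^ 2 + y ^ 2) := by
  have := ENNReal.rpow_add_le_mul_rpow_add_rpow x y (show (1 : ℝ) ≤ 2 by norm_num)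
  norm_num at this
  exact this

/-- Taking p = 3/2 > 1 = α is possible because 2p = 3 ≤ d. -/
lemma exists_lintegral_inv_norm_sq_le :
    ∃ C : ℝ, 0 < C ∧ ∀ (d : ℕ), 3 ≤ d → ∀ τ : ℝ, 0 < τ → ∀ v : Space d,
      ∫⁻ g, (ENNReal.ofReal ‖v + g‖)⁻¹ ^ 2 ∂isoGaussian d τ ≤
        ENNReal.ofReal (C * (τ ^ 2 * d)⁻¹) := by
  obtain ⟨C, hC, h⟩ := exists_lintegral_sum_sq_rpow_neg_le (α := 1) (p := 3 / 2)
    (by norm_num) (by norm_num)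
  refine ⟨C, hC, fun d hd τ hτ v => ?_⟩
  have hm : Measurable fun w : Fin d → ℝ => ENNReal.ofReal (∑ i, w i ^ 2) ^ (-1 : ℝ) := by
    have : Measurable fun w : Fin d → ℝ => ∑ i, w i ^ 2 :=
      Finset.measurable_sum _ fun i _ => by fun_prop
    fun_prop
  have h1 := h d (fun i => v i) τ hτ Finset.univ (by
    rw [Finset.card_univ, Fintype.card_fin]
    have : (3 : ℝ) ≤ d := by exact_mod_cast hd
    linarith)
  have h2 := lintegral_isoGaussian_repr τ (EuclideanSpace.basisFun (Fin d) ℝ) v hm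
  simp only [EuclideanSpace.basisFun_repr] at h2
  rw [Finset.card_univ, Fintype.card_fin, ← h2, Real.rpow_neg_one] at h1
  refine le_trans (le_of_eq (lintegral_congr fun g => ?_)) h1
  rw [← EuclideanSpace.real_norm_sq_eq, ENNReal.ofReal_pow (norm_nonneg _), ENNReal.rpow_neg_one,
    ENNReal.inv_pow]

/-- The probability that the difference of the distances of a Gaussian point to `c` and `b` lies in
a given interval of length `ε` is controlled, uniformly in the interval, by a function of `b` and
`c` whose moment of order `5 / 3` over a Gaussian point `c` is of order `(ε / σ²) ^ (5 / 3)`. -/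
lemma exists_window_bound :
    ∃ C : ℝ, 0 < C ∧ ∀ (d : ℕ), 3 ≤ d → ∀ σ : ℝ, 0 < σ → σ ≤ 1 → ∀ y : Space d,
      ∀ ε : ℝ, 0 < ε → ∃ Q : Space d × Space d → ℝ≥0∞, Measurable Q ∧ (∀ q, Q q ≤ 1) ∧
        (∀ b c s, ∫⁻ g, window s ε (‖y + g - c‖ - ‖y + g - b‖) ∂isoGaussian d σ ≤ Q (b, c)) ∧
        ∀ b y' : Space d, ‖y' - y‖ ≤ 2 * √d →
          ∫⁻ g, Q (b, y' + g) ^ (5 / 3 : ℝ) ∂isoGaussian d σ ≤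
            ENNReal.ofReal (C * ε / σ ^ 2) ^ (5 / 3 : ℝ) := by
  obtain ⟨C₁, hC₁, hker⟩ := exists_lintegral_distKernel_rpow_le
  obtain ⟨C₂, hC₂, hinv⟩ := exists_lintegral_inv_norm_sq_le
  -- The two summands bound the second moment of `A` and the tenth moment of `W` below. The factor 6
  -- in the witness is the 3 of 3/τ², doubled because τ² = σ²/2; the power 3/5 undoes the exponent
  -- 5/3.
  set C₀ : ℝ := 2 * C₁ * (2 * (1 + C₂) + 2 ^ 9 * (1 + 4 * (2 * 5).factorial)) with hC₀
  have hC₀0 : 0 < C₀ := by positivity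
  refine ⟨640 * 6 * C₀ ^ (3 / 5 : ℝ), by positivity, ?_⟩
  intro d hd σ hσ hσ1 y ε hε
  have hdpos : (0 : ℝ) < d := by exact_mod_cast (by omega : 0 < d)
  have hd0 : (0 : ℝ) < √d := Real.sqrt_pos.2 hdpos
  have hd1 : (1 : ℝ) ≤ √d := by
    rw [Real.one_le_sqrt]
    exact_mod_cast (by omega : 1 ≤ d)
  have h2 : (0 : ℝ) < √2 := by positivity
  set τ := σ / √2 with hτdef
  have hτ : 0 < τ := by positivity
  have hτsq : 2 * τ ^ 2 = σ ^ 2 := by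
    rw [hτdef, div_pow, Real.sq_sqrt (by norm_num)]; ring
  have hστ : σ ^ 2 = τ ^ 2 + τ ^ 2 := by linarith
  have hτ1 : τ ≤ 1 := by nlinarith
  clear_value τ
  have hkm := measurable_distKernel (d := d) τ
  have hkm' : Measurable fun q : (Space d × Space d) × Space d =>
      distKernel τ q.1.1 (y + q.2) q.1.2 :=
    hkm.comp (f := fun q : (Space d × Space d) × Space d => (q.1.1, y + q.2, q.1.2))
      (by fun_prop)
  have hKm : Measurable fun q : Space d × Space d =>
      ∫⁻ g, distKernel τ q.1 (y + g) q.2 ∂isoGaussian d τ := hkm'.lintegral_prod_right'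
  -- The kernel is averaged over the first half of the noise of the moving point. The minimum with 1
  -- is what `mul_le_rpow_add_rpow` needs later.
  refine ⟨fun q => min 1 (ENNReal.ofReal (640 * ε) *
    ∫⁻ g, distKernel τ q.1 (y + g) q.2 ∂isoGaussian d τ), by fun_prop, fun q => min_le_left _ _,
    ?_, ?_⟩
  · intro b c s
    apply le_min
    · calc _ ≤ ∫⁻ g : Space d, 1 ∂isoGaussian d σ := lintegral_mono fun g => window_le_one _ _ _
        _ = 1 := by simp
    · have hwm := measurable_window s ε
      -- Given the first half u of the noise, the point is Gaussian with mean y + u and standard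
      -- deviation τ.
      rw [lintegral_isoGaussian_add d hστ (by fun_prop)]
      have hkm2 : Measurable fun g : Space d => distKernel τ b (y + g) c :=
        hkm.comp (f := fun g : Space d => (b, y + g, c)) (by fun_prop)
      rw [← lintegral_const_mul _ hkm2]
      refine lintegral_mono fun u => ?_
      simp only [← add_assoc]
      exact lintegral_window_le_distKernel hd hτ hε s b (y + u) c
  · intro b y' hy
    have hkm3 : Measurable fun q : Space d × Space d => distKernel τ b (y + q.2) (y' + q.1) :=
      hkm.comp (f := fun q : Space d × Space d => (b, y + q.2, y' + q.1)) (by fun_prop)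
    have hkm4 : ∀ g, Measurable fun u : Space d => distKernel τ b (y + u) (y' + g) := fun g =>
      hkm.comp (f := fun u : Space d => (b, y + u, y' + g)) (by fun_prop)
    set W : Space d → ℝ≥0∞ := fun g => 1 + ENNReal.ofReal (‖g‖ / √d) with hW
    set A : Space d → ℝ≥0∞ := fun g =>
      1 + ENNReal.ofReal (τ * √d) * (ENNReal.ofReal ‖y - b + g‖)⁻¹ with hA
    have hpt : ∀ u : Space d,
        ∫⁻ g, distKernel τ b (y + u) (y' + g) ^ (5 / 3 : ℝ) ∂isoGaussian d σ ≤
        ENNReal.ofReal (2 * C₁) * ENNReal.ofReal (3 / τ ^ 2) ^ (5 / 3 : ℝ) *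
          (A u ^ 2 + W u ^ 10) := by
      intro u
      have hW1 : 1 ≤ W u := le_self_add
      -- Since ‖y' - y‖ ≤ 2√d, the division by √d removes the dimension from this bound.
      have e1 : ENNReal.ofReal ((‖y' - (y + u)‖ + τ) / (τ * √d)) ≤ ENNReal.ofReal (3 / τ) * W u := by
        rw [hW]
        simp only
        rw [← ENNReal.ofReal_one, ← ENNReal.ofReal_add (by norm_num) (by positivity),
          ← ENNReal.ofReal_mul (by positivity)]
        apply ENNReal.ofReal_le_ofReal
        rw [div_mul_eq_mul_div, div_le_div_iff₀ (by positivity) hτ]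
        have : ‖y' - (y + u)‖ ≤ 2 * √d + ‖u‖ := by
          have : y' - (y + u) = (y' - y) - u := by abel
          rw [this]
          exact (norm_sub_le _ _).trans (by linarith)
        have e : 3 * (1 + ‖u‖ / √d) * (τ * √d) = τ * (3 * √d + 3 * ‖u‖) := by field_simp
        rw [e, mul_comm]
        apply mul_le_mul_of_nonneg_left _ hτ.le
        linarith [norm_nonneg u]
      have e2 : 1 ≤ ENNReal.ofReal (3 / τ) * W u := by
        have : 1 ≤ ENNReal.ofReal (3 / τ) := by
          rw [ENNReal.one_le_ofReal, one_le_div hτ]; linarith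
        calc (1 : ℝ≥0∞) = 1 * 1 := (one_mul 1).symm
          _ ≤ _ := by gcongr
      have e3 : 1 ≤ (ENNReal.ofReal (3 / τ) * W u) ^ (5 / 3 : ℝ) :=
        ENNReal.one_le_rpow e2 (by norm_num)
      have e4 : ‖y + u - b‖ = ‖y - b + u‖ := by congr 1; abel
      calc _ ≤ _ := hker d hd σ τ hτ hστ hσ b (y + u) y'
        _ ≤ ENNReal.ofReal C₁ * (ENNReal.ofReal (1 / τ) * A u) ^ (5 / 3 : ℝ) *
            ((ENNReal.ofReal (3 / τ) * W u) ^ (5 / 3 : ℝ) +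
              (ENNReal.ofReal (3 / τ) * W u) ^ (5 / 3 : ℝ)) := by
            rw [e4]
            gcongr
        _ = ENNReal.ofReal (2 * C₁) * ENNReal.ofReal (3 / τ ^ 2) ^ (5 / 3 : ℝ) *
            (A u * W u) ^ (5 / 3 : ℝ) := by
            have : ENNReal.ofReal (3 / τ ^ 2) = ENNReal.ofReal (1 / τ) * ENNReal.ofReal (3 / τ) := by
              rw [← ENNReal.ofReal_mul (by positivity)]
              congr 1
              field_simp
            rw [this, ENNReal.ofReal_mul (by norm_num), ENNReal.ofReal_ofNat]
            simp only [ENNReal.mul_rpow_of_nonneg _ _ (show (0 : ℝ) ≤ 5 / 3 by norm_num)]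
            ring
        _ ≤ _ := by
            gcongr
            exact mul_rpow_le_sq_add_pow _ _
    have hAint : ∫⁻ u, A u ^ 2 ∂isoGaussian d τ ≤ ENNReal.ofReal (2 * (1 + C₂)) := by
      calc _ ≤ ∫⁻ u, 2 * (1 + ENNReal.ofReal ((τ * √d) ^ 2) *
            (ENNReal.ofReal ‖y - b + u‖)⁻¹ ^ 2) ∂isoGaussian d τ := by
            refine lintegral_mono fun u => (sq_add_le _ _).trans ?_
            rw [one_pow, mul_pow, ENNReal.ofReal_pow (by positivity)]
        _ = 2 * (1 + ENNReal.ofReal ((τ * √d) ^ 2) *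
            ∫⁻ u, (ENNReal.ofReal ‖y - b + u‖)⁻¹ ^ 2 ∂isoGaussian d τ) := by
            rw [lintegral_const_mul _ (by fun_prop), lintegral_add_left measurable_const,
              lintegral_const, measure_univ, mul_one, lintegral_const_mul _ (by fun_prop)]
        _ ≤ 2 * (1 + ENNReal.ofReal ((τ * √d) ^ 2) * ENNReal.ofReal (C₂ * (τ ^ 2 * d)⁻¹)) := by
            gcongr
            exact hinv d hd τ hτ _
        _ = _ := by
            have e : (τ * √d) ^ 2 * (C₂ * (τ ^ 2 * d)⁻¹) = C₂ := by
              rw [mul_pow, Real.sq_sqrt hdpos.le]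
              field_simp
            rw [← ENNReal.ofReal_mul (by positivity), e, ENNReal.ofReal_mul (p := 2) (by norm_num),
              ENNReal.ofReal_add (by norm_num) hC₂.le, ENNReal.ofReal_ofNat, ENNReal.ofReal_one]
    have hWint : ∫⁻ u, W u ^ 10 ∂isoGaussian d τ ≤
        ENNReal.ofReal (2 ^ 9 * (1 + 4 * (2 * 5).factorial)) := by
      calc _ ≤ ∫⁻ u, ENNReal.ofReal (2 ^ 9) *
            (1 + ENNReal.ofReal ((‖u‖ / √d) ^ (2 * 5))) ∂isoGaussian d τ := by
            refine lintegral_mono fun u => ?_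
            simp only [hW]
            rw [← ENNReal.ofReal_one, ← ENNReal.ofReal_add (by norm_num) (by positivity),
              ← ENNReal.ofReal_pow (by positivity), ← ENNReal.ofReal_add (by norm_num)
              (by positivity), ← ENNReal.ofReal_mul (by norm_num)]
            apply ENNReal.ofReal_le_ofReal
            have := add_pow_le (show (0 : ℝ) ≤ 1 by norm_num)
              (show 0 ≤ ‖u‖ / √d by positivity) 10
            simpa using this
        _ = ENNReal.ofReal (2 ^ 9) * (1 + ∫⁻ u, ENNReal.ofReal ((‖u‖ / √d) ^ (2 * 5))
            ∂isoGaussian d τ) := by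
            rw [lintegral_const_mul _ (by fun_prop), lintegral_add_left measurable_const,
              lintegral_const, measure_univ, mul_one]
        _ ≤ ENNReal.ofReal (2 ^ 9) * (1 + ENNReal.ofReal (4 * (2 * 5).factorial)) := by
            gcongr
            exact lintegral_norm_pow_isoGaussian_le (by omega) hτ.le hτ1 5
        _ = _ := by
            rw [← ENNReal.ofReal_one, ← ENNReal.ofReal_add (by norm_num) (by positivity),
              ← ENNReal.ofReal_mul (by norm_num)]
    calc _ ≤ ∫⁻ g, ENNReal.ofReal (640 * ε) ^ (5 / 3 : ℝ) *
          ∫⁻ u, distKernel τ b (y + u) (y' + g) ^ (5 / 3 : ℝ) ∂isoGaussian d τ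
            ∂isoGaussian d σ := by
          refine lintegral_mono fun g => ?_
          calc _ ≤ (ENNReal.ofReal (640 * ε) *
                ∫⁻ u, distKernel τ b (y + u) (y' + g) ∂isoGaussian d τ) ^ (5 / 3 : ℝ) := by
                gcongr
                exact min_le_right _ _
            _ ≤ _ := by
                rw [ENNReal.mul_rpow_of_nonneg _ _ (by norm_num)]
                gcongr
                exact rpow_lintegral_le_lintegral_rpow _ (by norm_num) (hkm4 g).aemeasurable
      _ = ENNReal.ofReal (640 * ε) ^ (5 / 3 : ℝ) * ∫⁻ u, ∫⁻ g,
          distKernel τ b (y + u) (y' + g) ^ (5 / 3 : ℝ) ∂isoGaussian d σ ∂isoGaussian d τ := by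
          have hm : Measurable fun q : Space d × Space d =>
              distKernel τ b (y + q.2) (y' + q.1) ^ (5 / 3 : ℝ) := by fun_prop
          rw [lintegral_const_mul _ hm.lintegral_prod_right',
            lintegral_lintegral_swap hm.aemeasurable]
      _ ≤ ENNReal.ofReal (640 * ε) ^ (5 / 3 : ℝ) * ∫⁻ u, ENNReal.ofReal (2 * C₁) *
          ENNReal.ofReal (3 / τ ^ 2) ^ (5 / 3 : ℝ) * (A u ^ 2 + W u ^ 10) ∂isoGaussian d τ := by
          gcongr with u
          exact hpt u
      _ = ENNReal.ofReal (640 * ε) ^ (5 / 3 : ℝ) * (ENNReal.ofReal (2 * C₁) *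
          ENNReal.ofReal (3 / τ ^ 2) ^ (5 / 3 : ℝ) *
          (∫⁻ u, A u ^ 2 ∂isoGaussian d τ + ∫⁻ u, W u ^ 10 ∂isoGaussian d τ)) := by
          rw [lintegral_const_mul _ (by fun_prop), lintegral_add_left (by fun_prop)]
      _ ≤ ENNReal.ofReal (640 * ε) ^ (5 / 3 : ℝ) * (ENNReal.ofReal (2 * C₁) *
          ENNReal.ofReal (3 / τ ^ 2) ^ (5 / 3 : ℝ) *
          (ENNReal.ofReal (2 * (1 + C₂)) +
            ENNReal.ofReal (2 ^ 9 * (1 + 4 * (2 * 5).factorial)))) := by gcongr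
      _ = ENNReal.ofReal (640 * ε) ^ (5 / 3 : ℝ) * ENNReal.ofReal (3 / τ ^ 2) ^ (5 / 3 : ℝ) *
          ENNReal.ofReal C₀ := by
          rw [← ENNReal.ofReal_add (by positivity) (by positivity), hC₀,
            ENNReal.ofReal_mul (p := 2 * C₁) (by positivity)]
          ring
      _ = _ := by
          have : ENNReal.ofReal C₀ = ENNReal.ofReal (C₀ ^ (3 / 5 : ℝ)) ^ (5 / 3 : ℝ) := by
            rw [ENNReal.ofReal_rpow_of_pos (by positivity), ← Real.rpow_mul hC₀0.le]
            norm_num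
          rw [this, ← ENNReal.mul_rpow_of_nonneg _ _ (by norm_num),
            ← ENNReal.mul_rpow_of_nonneg _ _ (by norm_num), ← ENNReal.ofReal_mul (by positivity),
            ← ENNReal.ofReal_mul (by positivity), ← hτsq]
          congr 2
          field_simp
          norm_num

/-! ### Pairs of small improvements -/

/-- The amount by which the tour becomes shorter when the edges `{a, b}` and `{c, e}` are exchanged
for `{a, c}` and `{b, e}`. -/
noncomputable def gain {n d : ℕ} (x : Fin n → Space d) (a b c e : Fin n) : ℝ :=
  ‖x a - x b‖ + ‖x c - x e‖ - ‖x a - x c‖ - ‖x b - x e‖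

lemma measurable_gain {n d : ℕ} (a b c e : Fin n) :
    Measurable fun x : Fin n → Space d => gain x a b c e := by
  unfold gain
  fun_prop

/-- This is the device for averaging over one point while the others stay fixed: the integrand is
replaced by a bound for its conditional expectation. -/
lemma lintegral_perturb_le {n d : ℕ} (y : Fin n → Space d) (σ : ℝ)
    {f h : (Fin n → Space d) → ℝ≥0∞} (hf : Measurable f) (i : Fin n)
    (H : ∀ x, ∫⁻ u, f (Function.update x i (y i + u)) ∂isoGaussian d σ ≤ h x) :
    ∫⁻ g, f (perturb y g) ∂gaussianNoise n d σ ≤ ∫⁻ g, h (perturb y g) ∂gaussianNoise n d σ := by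
  have hp : Measurable fun g : Fin n → Fin d → ℝ => perturb y g := by
    unfold perturb
    fun_prop
  rw [gaussianNoise, lintegral_pi_update _ i (f := fun g => f (perturb y g)) (hf.comp hp)]
  refine lintegral_mono fun g => ?_
  refine le_trans (le_of_eq ?_) (H (perturb y g))
  have hm : Measurable fun u : Space d => f (Function.update (perturb y g) i (y i + u)) := by
    apply hf.comp
    exact (measurable_update (perturb y g)).comp (by fun_prop)
  rw [lintegral_isoGaussian d σ hm]
  refine lintegral_congr fun z => ?_
  congr 1
  ext1 j
  by_cases hj : j = i
  · subst hj
    simp [perturb]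
  · simp [perturb, Function.update_of_ne hj]

lemma window_sub (ε r t : ℝ) : window 0 ε (r - t) = window (r - ε) ε t := by
  simp only [window, Set.indicator, Set.mem_Icc, Pi.one_apply]
  congr 1
  rw [eq_iff_iff]
  constructor <;> rintro ⟨h1, h2⟩ <;> constructor <;> linarith

lemma window_add (ε r t : ℝ) : window 0 ε (r + t) = window (-r) ε t := by
  simp only [window, Set.indicator, Set.mem_Icc, Pi.one_apply]
  congr 1
  rw [eq_iff_iff]
  constructor <;> rintro ⟨h1, h2⟩ <;> constructor <;> linarith

/-- The product is at most the square of the larger factor, which lies in [0, 1]. This handles two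
kernels that share their Gaussian argument, where independence is not available and second moments
are not at hand. -/
lemma mul_le_rpow_add_rpow {a b : ℝ≥0∞} (ha : a ≤ 1) (hb : b ≤ 1) :
    a * b ≤ a ^ (5 / 3 : ℝ) + b ^ (5 / 3 : ℝ) := by
  have key : ∀ x : ℝ≥0∞, x ≤ 1 → x * x ≤ x ^ (5 / 3 : ℝ) := by
    intro x hx
    calc x * x = x ^ (2 : ℝ) := by rw [← sq, ← ENNReal.rpow_natCast]; norm_num
      _ ≤ _ := ENNReal.rpow_le_rpow_of_exponent_ge hx (by norm_num)
  rcases le_total a b with h | h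
  · calc a * b ≤ b * b := by gcongr
      _ ≤ _ := (key b hb).trans le_add_self
  · calc a * b ≤ a * a := by gcongr
      _ ≤ _ := (key a ha).trans le_self_add

/-- The expected indicator of the event that two given improvements are both small. -/
noncomputable def pairMass {n d : ℕ} (y : Fin n → Space d) (σ ε : ℝ) (v : Fin 6 → Fin n) : ℝ≥0∞ :=
  ∫⁻ g, window 0 ε (gain (perturb y g) (v 0) (v 1) (v 2) (v 3)) *
    window 0 ε (gain (perturb y g) (v 0) (v 2) (v 4) (v 5)) ∂gaussianNoise n d σ

lemma norm_sub_le_of_mem_Icc {d : ℕ} {u v : Space d} (hu : ∀ j, u j ∈ Set.Icc (-1 : ℝ) 1)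
    (hv : ∀ j, v j ∈ Set.Icc (-1 : ℝ) 1) : ‖u - v‖ ≤ 2 * √d := by
  apply le_of_sq_le_sq _ (by positivity)
  rw [EuclideanSpace.real_norm_sq_eq, mul_pow, Real.sq_sqrt (by positivity)]
  calc ∑ i, (u - v) i ^ 2 ≤ ∑ _i : Fin d, (2 : ℝ) ^ 2 := by
        refine Finset.sum_le_sum fun i _ => ?_
        have h1 := hu i
        have h2 := hv i
        rw [Set.mem_Icc] at h1 h2
        rw [PiLp.sub_apply]
        apply sq_le_sq.2
        rw [abs_le, abs_of_pos (by norm_num : (0 : ℝ) < 2)]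
        constructor <;> linarith
    _ = 2 ^ 2 * d := by simp [mul_comm]

/-- The vertex `v 3` occurs only in the first gain; averaging over it replaces the first window by a
kernel with arguments `v 2` and `v 1`. Averaging over `v 5`, or over `v 4` if `v 5 = v 1`, treats
the second window in the same way. If all six vertices differ, the two kernels have separate free
arguments `v 1` and `v 4`, each contributing a factor η. With a coincidence both kernels share the
argument `v 1`, and their moments of order 5/3 give 2η^(5/3). -/
lemma exists_pairMass_le :
    ∃ C : ℝ, 0 < C ∧ ∀ (d : ℕ), 3 ≤ d → ∀ (n : ℕ) (σ : ℝ), 0 < σ → σ ≤ 1 →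
      ∀ y : Fin n → Space d, (∀ i j, y i j ∈ Set.Icc (-1 : ℝ) 1) → ∀ ε : ℝ, 0 < ε →
      ∀ v : Fin 6 → Fin n,
        (Function.Injective v → pairMass y σ ε v ≤ ENNReal.ofReal (C * ε / σ ^ 2) ^ 2) ∧
        ([v 0, v 1, v 2, v 3, v 5].Nodup → v 4 = v 1 →
          pairMass y σ ε v ≤ 2 * ENNReal.ofReal (C * ε / σ ^ 2) ^ (5 / 3 : ℝ)) ∧
        ([v 0, v 1, v 2, v 3, v 4].Nodup → v 5 = v 1 →
          pairMass y σ ε v ≤ 2 * ENNReal.ofReal (C * ε / σ ^ 2) ^ (5 / 3 : ℝ)) := by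
  obtain ⟨C, hC, hwin⟩ := exists_window_bound
  refine ⟨C, hC, ?_⟩
  intro d hd n σ hσ hσ1 y hy ε hε v
  choose Q hQm hQ1 hQ hQp using fun i : Fin n => hwin d hd σ hσ hσ1 (y i) ε hε
  set η := ENNReal.ofReal (C * ε / σ ^ 2) with hη
  have hadd : ∀ i b c r, ∫⁻ u, window 0 ε (r + (‖y i + u - c‖ - ‖y i + u - b‖))
      ∂isoGaussian d σ ≤ Q i (b, c) := by
    intro i b c r
    simp only [window_add]
    exact hQ i b c _
  have hsub : ∀ i b c r, ∫⁻ u, window 0 ε (r - (‖y i + u - c‖ - ‖y i + u - b‖))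
      ∂isoGaussian d σ ≤ Q i (b, c) := by
    intro i b c r
    simp only [window_sub]
    exact hQ i b c _
  have hQp' : ∀ i j b, ∫⁻ u, Q i (b, y j + u) ^ (5 / 3 : ℝ) ∂isoGaussian d σ ≤ η ^ (5 / 3 : ℝ) :=
    fun i j b => hQp i b (y j) (norm_sub_le_of_mem_Icc (hy j) (hy i))
  have hQ2 : ∀ i (b : Space d) j, Measurable fun u : Space d => Q i (b, y j + u) := fun i b j =>
    (hQm i).comp (by fun_prop)
  have hQ1' : ∀ i j b, ∫⁻ u, Q i (b, y j + u) ∂isoGaussian d σ ≤ η := by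
    intro i j b
    have h := (rpow_lintegral_le_lintegral_rpow (isoGaussian d σ) (show (1 : ℝ) < 5 / 3 by norm_num)
      (hQ2 i b j).aemeasurable).trans (hQp' i j b)
    rwa [ENNReal.rpow_le_rpow_iff (by norm_num)] at h
  have hwm := measurable_window 0 ε
  have hgm : ∀ a b c e, Measurable fun x : Fin n → Space d => window 0 ε (gain x a b c e) :=
    fun a b c e => hwm.comp (measurable_gain a b c e)
  have hQx : ∀ i j k, Measurable fun x : Fin n → Space d => Q i (x j, x k) := fun i j k =>
    (hQm i).comp (by fun_prop)
  -- averaging over the last vertex of the first exchange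
  have hfirst : ∀ a b c e : Fin n, e ≠ a → e ≠ b → e ≠ c → ∀ x : Fin n → Space d,
      ∫⁻ u, window 0 ε (gain (Function.update x e (y e + u)) a b c e) ∂isoGaussian d σ ≤
        Q e (x c, x b) := by
    intro a b c e h1 h2 h3 x
    refine le_trans (le_of_eq (lintegral_congr fun u => ?_))
      (hsub e (x c) (x b) (‖x a - x b‖ - ‖x a - x c‖))
    congr 1
    simp only [gain, Function.update_self, Function.update_of_ne h1.symm,
      Function.update_of_ne h2.symm, Function.update_of_ne h3.symm]
    rw [norm_sub_rev (x c), norm_sub_rev (x b) (y e + u)]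
    ring
  -- The same average with the arguments of the kernel in the other order: only the second argument
  -- can be averaged over afterwards.
  have hlast : ∀ a b c e : Fin n, e ≠ a → e ≠ b → e ≠ c → ∀ x : Fin n → Space d,
      ∫⁻ u, window 0 ε (gain (Function.update x e (y e + u)) a b c e) ∂isoGaussian d σ ≤
        Q e (x b, x c) := by
    intro a b c e h1 h2 h3 x
    refine le_trans (le_of_eq (lintegral_congr fun u => ?_))
      (hadd e (x b) (x c) (‖x a - x b‖ - ‖x a - x c‖))
    congr 1
    simp only [gain, Function.update_self, Function.update_of_ne h1.symm,
      Function.update_of_ne h2.symm, Function.update_of_ne h3.symm]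
    rw [norm_sub_rev (x c), norm_sub_rev (x b) (y e + u)]
    ring
  have hthird : ∀ a b c e : Fin n, c ≠ a → c ≠ b → c ≠ e → ∀ x : Fin n → Space d,
      ∫⁻ u, window 0 ε (gain (Function.update x c (y c + u)) a b c e) ∂isoGaussian d σ ≤
        Q c (x a, x e) := by
    intro a b c e h1 h2 h3 x
    refine le_trans (le_of_eq (lintegral_congr fun u => ?_))
      (hadd c (x a) (x e) (‖x a - x b‖ - ‖x b - x e‖))
    congr 1
    simp only [gain, Function.update_self, Function.update_of_ne h1.symm,
      Function.update_of_ne h2.symm, Function.update_of_ne h3.symm]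
    rw [norm_sub_rev (x a) (y c + u)]
    ring
  have hgupd : ∀ (a b c e i : Fin n), i ≠ a → i ≠ b → i ≠ c → i ≠ e →
      ∀ (x : Fin n → Space d) u, gain (Function.update x i u) a b c e = gain x a b c e := by
    intro a b c e i h1 h2 h3 h4 x u
    simp only [gain, Function.update_of_ne h1.symm, Function.update_of_ne h2.symm,
      Function.update_of_ne h3.symm, Function.update_of_ne h4.symm]
  have hone : ∀ e b c (q : Space d), ∫⁻ u, Q e (q, y b + u) * c ∂isoGaussian d σ ≤ η * c := by
    intro e b c q
    rw [lintegral_mul_const _ (hQ2 e q b)]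
    gcongr
    exact hQ1' e b q
  -- averaging over the common argument of two kernels
  have htwo : ∀ i j b c k : Fin n, k ≠ b → k ≠ c →
      ∫⁻ g, Q i (perturb y g b, perturb y g k) * Q j (perturb y g c, perturb y g k)
        ∂gaussianNoise n d σ ≤ 2 * η ^ (5 / 3 : ℝ) := by
    intro i j b c k hb hc
    calc _ ≤ ∫⁻ g, (fun _ : Fin n → Space d => 2 * η ^ (5 / 3 : ℝ)) (perturb y g)
          ∂gaussianNoise n d σ := by
          refine lintegral_perturb_le y σ (f := fun x => Q i (x b, x k) * Q j (x c, x k))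
            (h := fun _ => 2 * η ^ (5 / 3 : ℝ))
            ((hQx _ _ _).mul (hQx _ _ _)) k fun x => ?_
          simp only [Function.update_self, Function.update_of_ne hb.symm,
            Function.update_of_ne hc.symm]
          calc _ ≤ ∫⁻ u, Q i (x b, y k + u) ^ (5 / 3 : ℝ) + Q j (x c, y k + u) ^ (5 / 3 : ℝ)
                ∂isoGaussian d σ :=
                lintegral_mono fun u => mul_le_rpow_add_rpow (hQ1 _ _) (hQ1 _ _)
            _ ≤ _ := by
                rw [lintegral_add_left ((hQ2 _ _ _).pow_const _), two_mul]
                exact add_le_add (hQp' _ _ _) (hQp' _ _ _)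
      _ = 2 * η ^ (5 / 3 : ℝ) := by
          rw [lintegral_const, gaussianNoise, measure_univ, mul_one]
  have hstep1 : v 3 ≠ v 0 → v 3 ≠ v 1 → v 3 ≠ v 2 → v 3 ≠ v 4 → v 3 ≠ v 5 →
      pairMass y σ ε v ≤ ∫⁻ g, Q (v 3) (perturb y g (v 2), perturb y g (v 1)) *
        window 0 ε (gain (perturb y g) (v 0) (v 2) (v 4) (v 5)) ∂gaussianNoise n d σ := by
    intro h0 h1 h2 h4 h5
    refine lintegral_perturb_le y σ (f := fun x => window 0 ε (gain x (v 0) (v 1) (v 2) (v 3)) *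
      window 0 ε (gain x (v 0) (v 2) (v 4) (v 5))) (h := fun x => Q (v 3) (x (v 2), x (v 1)) *
        window 0 ε (gain x (v 0) (v 2) (v 4) (v 5))) ((hgm _ _ _ _).mul (hgm _ _ _ _)) (v 3)
        fun x => ?_
    simp only [hgupd _ _ _ _ _ h0 h2 h4 h5]
    rw [lintegral_mul_const]
    · gcongr
      exact hfirst _ _ _ _ h0 h1 h2 x
    · exact (hgm _ _ _ _).comp ((measurable_update x).comp (by fun_prop))
  refine ⟨?_, ?_, ?_⟩
  · intro hv
    have ne : ∀ {i j : Fin 6}, i ≠ j → v i ≠ v j := fun h => hv.ne h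
    refine (hstep1 (ne (by decide)) (ne (by decide)) (ne (by decide)) (ne (by decide))
      (ne (by decide))).trans ?_
    calc _ ≤ ∫⁻ g, (fun x : Fin n → Space d => Q (v 3) (x (v 2), x (v 1)) *
          Q (v 5) (x (v 2), x (v 4))) (perturb y g) ∂gaussianNoise n d σ := by
          refine lintegral_perturb_le y σ (f := fun x => Q (v 3) (x (v 2), x (v 1)) *
            window 0 ε (gain x (v 0) (v 2) (v 4) (v 5)))
            (h := fun x => Q (v 3) (x (v 2), x (v 1)) * Q (v 5) (x (v 2), x (v 4)))
            ((hQx _ _ _).mul (hgm _ _ _ _)) (v 5)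
            fun x => ?_
          simp only [Function.update_of_ne (ne (show (2 : Fin 6) ≠ 5 by decide)),
            Function.update_of_ne (ne (show (1 : Fin 6) ≠ 5 by decide))]
          rw [lintegral_const_mul]
          · gcongr
            exact hlast _ _ _ _ (ne (by decide)) (ne (by decide)) (ne (by decide)) x
          · exact (hgm _ _ _ _).comp ((measurable_update x).comp (by fun_prop))
      _ ≤ ∫⁻ g, (fun x : Fin n → Space d => η * Q (v 5) (x (v 2), x (v 4))) (perturb y g)
          ∂gaussianNoise n d σ := by
          refine lintegral_perturb_le y σ
            (f := fun x => Q (v 3) (x (v 2), x (v 1)) * Q (v 5) (x (v 2), x (v 4)))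
            (h := fun x => η * Q (v 5) (x (v 2), x (v 4)))
            ((hQx _ _ _).mul (hQx _ _ _)) (v 1) fun x => ?_
          simp only [Function.update_of_ne (ne (show (2 : Fin 6) ≠ 1 by decide)),
            Function.update_of_ne (ne (show (4 : Fin 6) ≠ 1 by decide)), Function.update_self]
          exact hone _ _ _ _
      _ ≤ ∫⁻ g, (fun _ : Fin n → Space d => η * η) (perturb y g) ∂gaussianNoise n d σ := by
          refine lintegral_perturb_le y σ (f := fun x => η * Q (v 5) (x (v 2), x (v 4)))
            (h := fun _ => η * η) ((hQx _ _ _).const_mul _) (v 4) fun x => ?_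
          simp only [Function.update_of_ne (ne (show (2 : Fin 6) ≠ 4 by decide)),
            Function.update_self]
          rw [lintegral_const_mul _ (hQ2 _ _ _)]
          gcongr
          exact hQ1' _ _ _
      _ = η ^ 2 := by
          rw [lintegral_const, gaussianNoise, measure_univ, mul_one, sq]
  · intro hnd h41
    simp only [List.nodup_cons, List.mem_cons, List.not_mem_nil, or_false, not_or] at hnd
    obtain ⟨⟨h01, h02, h03, h05⟩, ⟨h12, h13, h15⟩, ⟨h23, h25⟩, h35, -⟩ := hnd
    refine (hstep1 (Ne.symm h03) (Ne.symm h13) (Ne.symm h23) (by rw [h41]; exact Ne.symm h13)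
      h35).trans ?_
    rw [h41]
    calc _ ≤ ∫⁻ g, (fun x : Fin n → Space d => Q (v 3) (x (v 2), x (v 1)) *
          Q (v 5) (x (v 2), x (v 1))) (perturb y g) ∂gaussianNoise n d σ := by
          refine lintegral_perturb_le y σ (f := fun x => Q (v 3) (x (v 2), x (v 1)) *
            window 0 ε (gain x (v 0) (v 2) (v 1) (v 5)))
            (h := fun x => Q (v 3) (x (v 2), x (v 1)) * Q (v 5) (x (v 2), x (v 1)))
            ((hQx _ _ _).mul (hgm _ _ _ _)) (v 5)
            fun x => ?_
          simp only [Function.update_of_ne h25, Function.update_of_ne h15]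
          rw [lintegral_const_mul]
          · gcongr
            exact hlast _ _ _ _ (Ne.symm h05) (Ne.symm h25) (Ne.symm h15) x
          · exact (hgm _ _ _ _).comp ((measurable_update x).comp (by fun_prop))
      _ ≤ _ := htwo _ _ _ _ _ h12 h12
  · intro hnd h51
    simp only [List.nodup_cons, List.mem_cons, List.not_mem_nil, or_false, not_or] at hnd
    obtain ⟨⟨h01, h02, h03, h04⟩, ⟨h12, h13, h14⟩, ⟨h23, h24⟩, h34, -⟩ := hnd
    refine (hstep1 (Ne.symm h03) (Ne.symm h13) (Ne.symm h23) h34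
      (by rw [h51]; exact Ne.symm h13)).trans ?_
    rw [h51]
    calc _ ≤ ∫⁻ g, (fun x : Fin n → Space d => Q (v 3) (x (v 2), x (v 1)) *
          Q (v 4) (x (v 0), x (v 1))) (perturb y g) ∂gaussianNoise n d σ := by
          refine lintegral_perturb_le y σ (f := fun x => Q (v 3) (x (v 2), x (v 1)) *
            window 0 ε (gain x (v 0) (v 2) (v 4) (v 1)))
            (h := fun x => Q (v 3) (x (v 2), x (v 1)) * Q (v 4) (x (v 0), x (v 1)))
            ((hQx _ _ _).mul (hgm _ _ _ _)) (v 4)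
            fun x => ?_
          simp only [Function.update_of_ne h24, Function.update_of_ne h14]
          rw [lintegral_const_mul]
          · gcongr
            exact hthird _ _ _ _ (Ne.symm h04) (Ne.symm h24) (Ne.symm h14) x
          · exact (hgm _ _ _ _).comp ((measurable_update x).comp (by fun_prop))
      _ ≤ _ := htwo _ _ _ _ _ h12 (Ne.symm h01)

/-! ### The edges of a tour and 2-changes -/

lemma val_finRotate {m : ℕ} (i : Fin (m + 1)) :
    (finRotate (m + 1) i : ℕ) = if (i : ℕ) = m then 0 else (i : ℕ) + 1 := by
  rw [coe_finRotate]
  simp only [Fin.ext_iff, Fin.val_last]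

lemma finRotate_ne_self {n : ℕ} (hn : 2 ≤ n) (i : Fin n) : finRotate n i ≠ i := by
  obtain ⟨m, rfl⟩ : ∃ m, n = m + 1 := ⟨n - 1, by omega⟩
  intro h
  have h2 := congrArg Fin.val h
  rw [val_finRotate] at h2
  split_ifs at h2 <;> omega

lemma finRotate_finRotate_ne_self {n : ℕ} (hn : 3 ≤ n) (i : Fin n) :
    finRotate n (finRotate n i) ≠ i := by
  obtain ⟨m, rfl⟩ : ∃ m, n = m + 1 := ⟨n - 1, by omega⟩
  intro h
  have h2 := congrArg Fin.val h
  rw [val_finRotate, val_finRotate] at h2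
  split_ifs at h2 <;> omega

namespace Tour

/-- Two positions could share an edge only in opposite directions, which would close the tour after
two steps. -/
lemma edge_injective {n : ℕ} (hn : 3 ≤ n) (π : Tour n) :
    Function.Injective fun i => s(π i, π (finRotate n i)) := by
  intro i j h
  rcases Sym2.eq_iff.1 h with ⟨h1, -⟩ | ⟨h1, h2⟩
  · exact π.injective h1
  · have h3 := π.injective h1
    have h4 := π.injective h2
    rw [h3] at h4
    exact absurd h4 (finRotate_finRotate_ne_self hn j)

lemma sum_edges {n : ℕ} (hn : 3 ≤ n) (π : Tour n) {M : Type*} [AddCommMonoid M]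
    (w : Sym2 (Fin n) → M) : ∑ e ∈ π.edges, w e = ∑ i, w s(π i, π (finRotate n i)) := by
  rw [edges, Finset.sum_image fun i _ j _ h => edge_injective hn π h]

lemma card_edges {n : ℕ} (hn : 3 ≤ n) (π : Tour n) : π.edges.card = n := by
  rw [edges, Finset.card_image_of_injective _ (edge_injective hn π), Finset.card_univ,
    Fintype.card_fin]

lemma not_isDiag_of_mem_edges {n : ℕ} (hn : 2 ≤ n) {π : Tour n} {e : Sym2 (Fin n)}
    (he : e ∈ π.edges) : ¬ e.IsDiag := by
  rw [edges, Finset.mem_image] at he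
  obtain ⟨i, -, rfl⟩ := he
  rw [Sym2.mk_isDiag_iff]
  exact fun h => finRotate_ne_self hn i (π.injective h).symm

/-- The endpoints of an edge, as a multiset. -/
def endpoints {n : ℕ} : Sym2 (Fin n) → Multiset (Fin n) :=
  Sym2.lift ⟨fun a b => {a} + {b}, fun _ _ => add_comm _ _⟩

/-- Every vertex of a tour has degree two. This is the only property of the new edge set, besides
its size and the absence of loops, that is used to analyse a 2-change. -/
lemma sum_endpoints {n : ℕ} (hn : 3 ≤ n) (π : Tour n) :
    ∑ e ∈ π.edges, endpoints e = ∑ i, {i} + ∑ i, {i} := by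
  rw [sum_edges hn]
  simp only [endpoints, Sym2.lift_mk, Finset.sum_add_distrib]
  congr 1
  · exact Equiv.sum_comp π fun i => ({i} : Multiset (Fin n))
  · exact Equiv.sum_comp ((finRotate n).trans π) fun i => ({i} : Multiset (Fin n))

end Tour

/-- The length of an edge. -/
noncomputable def edgeLength {n d : ℕ} (x : Fin n → Space d) : Sym2 (Fin n) → ℝ :=
  Sym2.lift ⟨fun a b => ‖x a - x b‖, fun _ _ => norm_sub_rev _ _⟩

lemma Tour.length_eq_sum_edges {n d : ℕ} (hn : 3 ≤ n) (x : Fin n → Space d) (π : Tour n) :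
    π.length x = ∑ e ∈ π.edges, edgeLength x e := by
  rw [Tour.sum_edges hn]
  rfl

lemma Tour.length_le {n d : ℕ} (x : Fin n → Space d) (π : Tour n) :
    π.length x ≤ 2 * ∑ i, ‖x i‖ := by
  calc π.length x ≤ ∑ i, (‖x (π i)‖ + ‖x (π (finRotate n i))‖) :=
        Finset.sum_le_sum fun i _ => norm_sub_le _ _
    _ = 2 * ∑ i, ‖x i‖ := by
        rw [Finset.sum_add_distrib, two_mul]
        congr 1
        · exact Equiv.sum_comp π fun i => ‖x i‖
        · exact Equiv.sum_comp ((finRotate n).trans π) fun i => ‖x i‖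

lemma Tour.length_nonneg {n d : ℕ} (x : Fin n → Space d) (π : Tour n) : 0 ≤ π.length x :=
  Finset.sum_nonneg fun _ _ => norm_nonneg _

/-- The edges `{a, b}` and `{c, e}` of the edge set `E` are exchanged for `{a, c}` and `{b, e}`. -/
def IsExchange {n : ℕ} (E E' : Finset (Sym2 (Fin n))) (a b c e : Fin n) : Prop :=
  [a, b, c, e].Nodup ∧ s(a, b) ∈ E ∧ s(c, e) ∈ E ∧ s(a, c) ∉ E ∧ s(b, e) ∉ E ∧
    E' = (E \ {s(a, b), s(c, e)}) ∪ {s(a, c), s(b, e)}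

lemma sum_exchange {α M : Type*} [DecidableEq α] [AddCommMonoid M] {E : Finset α}
    {e₁ e₂ f₁ f₂ : α} (he : e₁ ≠ e₂) (hf : f₁ ≠ f₂) (h : {e₁, e₂} ⊆ E)
    (hd : Disjoint (E \ {e₁, e₂}) {f₁, f₂}) (w : α → M) :
    ∑ e ∈ (E \ {e₁, e₂}) ∪ {f₁, f₂}, w e + (w e₁ + w e₂) = ∑ e ∈ E, w e + (w f₁ + w f₂) := by
  rw [Finset.sum_union hd, Finset.sum_pair hf, ← Finset.sum_sdiff h, Finset.sum_pair he]
  abel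

/-- Old and new edges cover the same four endpoints with multiplicity. After a is matched with p,
the partner b must lie in the second new edge, and each accidental equality of endpoints would put
both new edges back into `E`, against `hf`. Hence the four vertices are distinct and the exchange
has the standard form up to naming. -/
lemma exists_exchange_of_endpoints {n : ℕ} {E : Finset (Sym2 (Fin n))} {a b c e p q r t : Fin n}
    (hab : s(a, b) ∈ E) (hce : s(c, e) ∈ E) (hpq : p ≠ q) (hrt : r ≠ t)
    (hf : ¬ ({s(p, q), s(r, t)} ⊆ E))
    (hd : Disjoint (E \ {s(a, b), s(c, e)}) {s(p, q), s(r, t)})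
    (hab' : a ≠ b) (hce' : c ≠ e)
    (hm : ({a, b, c, e} : Multiset (Fin n)) = {p, q, r, t}) (hap : a = p) :
    ∃ a' b' c' e', IsExchange E ((E \ {s(a, b), s(c, e)}) ∪ {s(p, q), s(r, t)}) a' b' c' e' := by
  subst hap
  have hm1 : ({b, c, e} : Multiset (Fin n)) = {q, r, t} := by
    simpa using hm
  have hf' : ¬ (s(a, q) ∈ E ∧ s(r, t) ∈ E) := by
    intro h
    apply hf
    simp [Finset.insert_subset_iff, h.1, h.2]
  have pair : ∀ {u v u' v' : Fin n}, ({u, v} : Multiset (Fin n)) = {u', v'} →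
      (u = u' ∧ v = v') ∨ (u = v' ∧ v = u') := by
    intro u v u' v' h
    have hu : u ∈ ({u', v'} : Multiset (Fin n)) := by rw [← h]; simp
    simp only [Multiset.insert_eq_cons, Multiset.mem_cons, Multiset.mem_singleton] at hu
    rcases hu with rfl | rfl
    · left; refine ⟨rfl, ?_⟩; simpa using h
    · right
      refine ⟨rfl, ?_⟩
      rw [Multiset.pair_comm u' u] at h
      simpa using h
  have notE : ∀ f, f ∈ ({s(a, q), s(r, t)} : Finset (Sym2 (Fin n))) → f ≠ s(a, b) → f ≠ s(c, e) →
      f ∉ E := by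
    intro f hf1 h1 h2 h3
    exact Finset.disjoint_left.1 hd (by simp [h1, h2, h3]) hf1
  have hb : b ∈ ({q, r, t} : Multiset (Fin n)) := by rw [← hm1]; simp
  -- the case in which `b` is the first endpoint of the second new edge
  have main : ∀ r t : Fin n, r ≠ t → b = r → ({c, e} : Multiset (Fin n)) = {q, t} →
      ¬ (s(a, q) ∈ E ∧ s(r, t) ∈ E) →
      (∀ f, f ∈ ({s(a, q), s(r, t)} : Finset (Sym2 (Fin n))) → f ≠ s(a, b) → f ≠ s(c, e) → f ∉ E) →
      ∃ a' b' c' e', IsExchange E ((E \ {s(a, b), s(c, e)}) ∪ {s(a, q), s(r, t)}) a' b' c' e' := by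
    rintro r t hrt rfl h2 hf' notE
    rcases pair h2 with ⟨rfl, rfl⟩ | ⟨rfl, rfl⟩
    · have hae : a ≠ e := by
        rintro rfl
        exact hf' ⟨by rwa [Sym2.eq_swap], by rwa [Sym2.eq_swap]⟩
      have hbc : b ≠ c := by
        rintro rfl
        exact hf' ⟨hab, hce⟩
      refine ⟨a, b, c, e, by simp [hab', hpq, hae, hbc, hrt, hce'], hab, hce, ?_, ?_, rfl⟩
      · apply notE _ (by simp)
        · simp [hbc.symm, hab']
        · simp [hpq, hae]
      · apply notE _ (by simp)
        · simp [hae.symm, hrt.symm]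
        · simp [hbc, hrt]
    · have hac : a ≠ c := by
        rintro rfl
        exact hf' ⟨hce, by rwa [Sym2.eq_swap]⟩
      have hbe : b ≠ e := by
        rintro rfl
        exact hf' ⟨hab, by rwa [Sym2.eq_swap]⟩
      refine ⟨a, b, e, c, by simp [hab', hpq, hac, hbe, hrt, hce'.symm], hab,
        by rwa [Sym2.eq_swap], ?_, ?_, ?_⟩
      · apply notE _ (by simp)
        · simp [hbe.symm, hab']
        · simp [hpq, hac]
      · apply notE _ (by simp)
        · simp [hac.symm, hrt.symm]
        · simp [hbe, hrt]
      · rw [Sym2.eq_swap (a := e) (b := c)]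
  simp only [Multiset.insert_eq_cons, Multiset.mem_cons, Multiset.mem_singleton] at hb
  -- If b = q, then {r, t} = {c, e}, and both new edges already belong to `E`.
  rcases hb with rfl | hbr | hbt
  · exfalso
    have h2 : ({c, e} : Multiset (Fin n)) = {r, t} := by simpa using hm1
    rcases pair h2 with ⟨rfl, rfl⟩ | ⟨rfl, rfl⟩
    · exact hf' ⟨hab, hce⟩
    · exact hf' ⟨hab, by rwa [Sym2.eq_swap]⟩
  · refine main r t hrt hbr ?_ hf' notE
    rw [hbr] at hm1
    have : ({q, r, t} : Multiset (Fin n)) = r ::ₘ {q, t} := by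
      simp only [Multiset.insert_eq_cons]; rw [Multiset.cons_swap]
    rw [this] at hm1
    simpa using hm1
  · have e1 : s(r, t) = s(t, r) := Sym2.eq_swap
    rw [e1] at hf' notE ⊢
    refine main t r hrt.symm hbt ?_ hf' notE
    rw [hbt] at hm1
    have : ({q, r, t} : Multiset (Fin n)) = t ::ₘ {q, r} := by
      simp only [Multiset.insert_eq_cons]
      rw [Multiset.cons_swap t q]
      congr 1
      exact Multiset.pair_comm r t
    rw [this] at hm1
    simpa using hm1

/-- Both tours have n edges, so neither new edge is among the n - 2 retained ones; comparing
degrees, the removed and the added edges have the same multiset of endpoints. -/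
lemma IsTwoChange.exists_exchange {n : ℕ} (hn : 3 ≤ n) {π π' : Tour n} (h : IsTwoChange π π') :
    ∃ a b c e, IsExchange π.edges π'.edges a b c e := by
  obtain ⟨e₁, e₂, f₁, f₂, he, hf, heE, hfE, hE'⟩ := h
  have hcard : (π.edges \ {e₁, e₂}).card = n - 2 := by
    rw [Finset.card_sdiff_of_subset heE, Tour.card_edges hn, Finset.card_pair he]
  have hd : Disjoint (π.edges \ {e₁, e₂}) {f₁, f₂} := by
    rw [← Finset.card_union_eq_card_add_card, ← hE', Tour.card_edges hn, hcard,
      Finset.card_pair hf]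
    omega
  have hsum := sum_exchange he hf heE hd Tour.endpoints
  rw [← hE', Tour.sum_endpoints hn, Tour.sum_endpoints hn] at hsum
  have hm := add_left_cancel hsum
  have hf₁' : f₁ ∈ π'.edges := by rw [hE']; simp
  have hf₂' : f₂ ∈ π'.edges := by rw [hE']; simp
  have hfd₁ := Tour.not_isDiag_of_mem_edges (by omega) hf₁'
  have hfd₂ := Tour.not_isDiag_of_mem_edges (by omega) hf₂'
  have he₁ : e₁ ∈ π.edges := heE (by simp)
  have he₂ : e₂ ∈ π.edges := heE (by simp)
  have hed₁ := Tour.not_isDiag_of_mem_edges (by omega) he₁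
  have hed₂ := Tour.not_isDiag_of_mem_edges (by omega) he₂
  rw [hE']
  clear hE' hf₁' hf₂' hsum hcard heE hf he
  induction e₁ using Sym2.ind with | _ a b =>
  induction e₂ using Sym2.ind with | _ c e =>
  induction f₁ using Sym2.ind with | _ p q =>
  induction f₂ using Sym2.ind with | _ r t =>
  rw [Sym2.mk_isDiag_iff] at hfd₁ hfd₂ hed₁ hed₂
  have hm' : ({a, b, c, e} : Multiset (Fin n)) = {p, q, r, t} := by
    exact hm
  have ha : a ∈ ({p, q, r, t} : Multiset (Fin n)) := by rw [← hm']; simp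
  simp only [Multiset.insert_eq_cons, Multiset.mem_cons, Multiset.mem_singleton] at ha
  have swap1 : ({p, q, r, t} : Multiset (Fin n)) = {q, p, r, t} := by
    simp only [Multiset.insert_eq_cons]; rw [Multiset.cons_swap]
  have swap2 : ∀ p q r t : Fin n, ({p, q, r, t} : Multiset (Fin n)) = {r, t, p, q} := by
    intro p q r t
    exact add_comm ({p, q} : Multiset (Fin n)) {r, t}
  rcases ha with ha | ha | ha | ha
  · exact exists_exchange_of_endpoints he₁ he₂ hfd₁ hfd₂ hfE hd hed₁ hed₂ hm' ha
  · rw [Sym2.eq_swap (a := p) (b := q)] at hfE hd ⊢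
    rw [swap1] at hm'
    exact exists_exchange_of_endpoints he₁ he₂ (Ne.symm hfd₁) hfd₂ hfE hd hed₁ hed₂ hm' ha
  · rw [Finset.pair_comm s(p, q)] at hfE hd ⊢
    rw [swap2 p q r t] at hm'
    exact exists_exchange_of_endpoints he₁ he₂ hfd₂ hfd₁ hfE hd hed₁ hed₂ hm' ha
  · rw [Finset.pair_comm s(p, q), Sym2.eq_swap (a := r) (b := t)] at hfE hd ⊢
    rw [swap2 p q r t] at hm'
    have : ({r, t, p, q} : Multiset (Fin n)) = {t, r, p, q} := by
      simp only [Multiset.insert_eq_cons]; rw [Multiset.cons_swap]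
    rw [this] at hm'
    exact exists_exchange_of_endpoints he₁ he₂ (Ne.symm hfd₂) hfd₁ hfE hd hed₁ hed₂ hm' ha

lemma IsExchange.length_sub_length {n d : ℕ} (hn : 3 ≤ n) (x : Fin n → Space d) {π π' : Tour n}
    {a b c e : Fin n} (h : IsExchange π.edges π'.edges a b c e) :
    π.length x - π'.length x = gain x a b c e := by
  obtain ⟨hnd, hab, hce, hac, hbe, hE'⟩ := h
  simp only [List.nodup_cons, List.mem_cons, List.not_mem_nil, or_false, not_or] at hnd
  obtain ⟨⟨h1, h2, h3⟩, ⟨h4, h5⟩, h6, -⟩ := hnd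
  have hd : Disjoint (π.edges \ {s(a, b), s(c, e)}) {s(a, c), s(b, e)} := by
    rw [Finset.disjoint_left]
    intro f hf hf'
    simp only [Finset.mem_insert, Finset.mem_singleton] at hf'
    rcases hf' with rfl | rfl
    · exact hac (Finset.mem_sdiff.1 hf).1
    · exact hbe (Finset.mem_sdiff.1 hf).1
  have hs := sum_exchange (e₁ := s(a, b)) (e₂ := s(c, e)) (f₁ := s(a, c)) (f₂ := s(b, e))
    (by simp [h2, h3]) (by simp [h1, h3]) (by simp [Finset.insert_subset_iff, hab, hce]) hd
    (edgeLength x)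
  rw [← hE', ← Tour.length_eq_sum_edges hn, ← Tour.length_eq_sum_edges hn] at hs
  simp only [edgeLength, Sym2.lift_mk] at hs
  rw [gain]
  linarith

/-! ### Linked pairs of exchanges -/

section Exchanges

variable {α : Type*} [DecidableEq α] {t : ℕ} {E R A : ℕ → Finset α}

lemma mem_of_forall_notMem_removed (hE : ∀ k < t, E (k + 1) = (E k \ R k) ∪ A k) {k j : ℕ} {f : α}
    (hf : f ∈ A k) (hkj : k < j) (hjt : j ≤ t) (h : ∀ l, k < l → l < j → f ∉ R l) : f ∈ E j := by
  induction j, hkj using Nat.le_induction with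
  | base => rw [hE k (by omega)]; exact Finset.mem_union_right _ hf
  | succ j hkj ih =>
    rw [hE j (by omega)]
    refine Finset.mem_union_left _ (Finset.mem_sdiff.2 ⟨?_, h j (by omega) (by omega)⟩)
    exact ih (by omega) fun l h1 h2 => h l h1 (by omega)

/-- An edge present in the tour cannot be added again, so between two additions of the same edge
there is a removal. -/
lemma eq_of_mem_added (hE : ∀ k < t, E (k + 1) = (E k \ R k) ∪ A k)
    (hA : ∀ k < t, Disjoint (A k) (E k)) {k k' j : ℕ} {f : α} (hf : f ∈ A k) (hf' : f ∈ A k')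
    (hkj : k < j) (hkj' : k' < j) (hjt : j ≤ t)
    (h : ∀ l, k < l → l < j → f ∉ R l) (h' : ∀ l, k' < l → l < j → f ∉ R l) : k = k' := by
  rcases lt_trichotomy k k' with hlt | heq | hlt
  · exact absurd (mem_of_forall_notMem_removed hE hf hlt (by omega) fun l h1 h2 =>
      h l h1 (by omega)) (Finset.disjoint_left.1 (hA k' (by omega)) hf')
  · exact heq
  · exact absurd (mem_of_forall_notMem_removed hE hf' hlt (by omega) fun l h1 h2 =>
      h' l h1 (by omega)) (Finset.disjoint_left.1 (hA k (by omega)) hf)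

lemma exists_link (hA0 : ∀ k < t, (A k).Nonempty) {k : ℕ} (hk : k < t)
    (hfin : ¬ ∃ f ∈ A k, ∀ l, k < l → l < t → f ∉ R l) :
    ∃ f j, k < j ∧ j < t ∧ f ∈ A k ∧ f ∈ R j ∧ ∀ l, k < l → l < j → f ∉ R l := by
  classical
  obtain ⟨f, hf⟩ := hA0 k hk
  push Not at hfin
  have hex := hfin f hf
  refine ⟨f, Nat.find hex, (Nat.find_spec hex).1, (Nat.find_spec hex).2.1, hf,
    (Nat.find_spec hex).2.2, fun l h1 h2 h3 => ?_⟩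
  have h4 := (Nat.find_spec hex).2.1
  exact Nat.find_min hex h2 ⟨h1, by omega, h3⟩

/-- A long sequence of exchanges in which every two linked exchanges have a large gain has a large
total gain, except that the links of a special kind may have a small gain; no two of these are
consecutive. -/
theorem card_mul_le_of_links (hE : ∀ k < t, E (k + 1) = (E k \ R k) ∪ A k)
    (hA : ∀ k < t, Disjoint (A k) (E k)) (hA0 : ∀ k < t, (A k).Nonempty)
    (hR : ∀ k < t, (R k).card ≤ 2) {W₁ W₂ W₃ : ℕ → ℝ} (hpos : ∀ k < t, W₂ k < W₁ k) {δ : ℝ}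
    (hδ : 0 ≤ δ)
    (hlink : ∀ k j f, k < j → j < t → f ∈ A k → f ∈ R j →
      δ ≤ max (W₁ k - W₂ k) (W₁ j - W₂ j) ∨
      (A k = R j ∧ W₁ j = W₂ k ∧ W₂ j = W₃ k ∧ W₃ j = W₁ k)) :
    t * δ ≤ 2 * (E t).card * δ + 6 * ∑ k ∈ Finset.range t, (W₁ k - W₂ k) := by
  classical
  rcases Nat.eq_zero_or_pos t with rfl | ht0
  · simp only [CharP.cast_eq_zero, zero_mul, Finset.range_zero, Finset.sum_empty, mul_zero,
      add_zero]
    positivity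
  -- `F` holds the steps with an added edge that survives to the end. Every other step k gets a link
  -- `p k`: an edge it adds, and the first later time at which this edge is removed.
  set F := (Finset.range t).filter fun k => ∃ f ∈ A k, ∀ l, k < l → l < t → f ∉ R l with hF
  have hl : ∀ k, ∃ p : α × ℕ, k ∈ Finset.range t \ F → k < p.2 ∧ p.2 < t ∧ p.1 ∈ A k ∧ p.1 ∈ R p.2 ∧
      ∀ l, k < l → l < p.2 → p.1 ∉ R l := by
    intro k
    by_cases hk : k ∈ Finset.range t \ F
    · obtain ⟨hk1, hk2⟩ := Finset.mem_sdiff.1 hk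
      have hk3 := Finset.mem_range.1 hk1
      obtain ⟨f, j, h⟩ := exists_link hA0 hk3 fun h => hk2 (Finset.mem_filter.2 ⟨hk1, h⟩)
      exact ⟨(f, j), fun _ => h⟩
    · obtain ⟨f, -⟩ := hA0 0 ht0
      exact ⟨(f, 0), fun h => absurd h hk⟩
  choose p hp using hl
  set Δ : ℕ → ℝ := fun k => W₁ k - W₂ k with hΔ
  have hΔ0 : ∀ k < t, 0 < Δ k := fun k hk => sub_pos.2 (hpos k hk)
  -- The links are divided into those with a large gain, `G`, and those without, `B`; the latter are
  -- all of the special kind.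
  set G := (Finset.range t \ F).filter fun k => δ ≤ max (Δ k) (Δ (p k).2) with hG
  set B := (Finset.range t \ F).filter fun k => ¬ δ ≤ max (Δ k) (Δ (p k).2) with hB
  have hcard : F.card + (G.card + B.card) = t := by
    rw [hG, hB, Finset.card_filter_add_card_filter_not]
    have hFsub : F ⊆ Finset.range t := Finset.filter_subset _ _
    have := Finset.card_sdiff_add_card_eq_card hFsub
    rw [Finset.card_range] at this
    omega
  have hFcard : F.card ≤ (E t).card := by
    have hf : ∀ k, ∃ f, k ∈ F → f ∈ A k ∧ ∀ l, k < l → l < t → f ∉ R l := by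
      intro k
      by_cases hk : k ∈ F
      · obtain ⟨f, hf1, hf2⟩ := (Finset.mem_filter.1 hk).2
        exact ⟨f, fun _ => ⟨hf1, hf2⟩⟩
      · exact ⟨(p 0).1, fun h => absurd h hk⟩
    choose f hf using hf
    refine Finset.card_le_card_of_injOn f ?_ ?_
    · intro k hk
      have hkt := Finset.mem_range.1 (Finset.mem_filter.1 hk).1
      exact mem_of_forall_notMem_removed hE (hf k hk).1 hkt le_rfl (hf k hk).2
    · intro k hk k' hk' heq
      have hkt := Finset.mem_range.1 (Finset.mem_filter.1 hk).1
      have hkt' := Finset.mem_range.1 (Finset.mem_filter.1 hk').1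
      have h' := hf k' hk'
      rw [← heq] at h'
      exact eq_of_mem_added hE hA (hf k hk).1 h'.1 hkt hkt' le_rfl (hf k hk).2 h'.2
  have hbad : ∀ k ∈ B, A k = R (p k).2 ∧ W₁ (p k).2 = W₂ k ∧ W₂ (p k).2 = W₃ k ∧
      W₃ (p k).2 = W₁ k := by
    intro k hk
    obtain ⟨hk1, hk2⟩ := Finset.mem_filter.1 hk
    obtain ⟨h1, h2, h3, h4, -⟩ := hp k hk1
    exact (hlink k _ _ h1 h2 h3 h4).resolve_left hk2
  -- Sending a step of `B` to its partner is injective and lands outside `B`, so `B` contains at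
  -- most half of all steps.
  have hBcard : B.card ≤ F.card + G.card := by
    have h1 : B.card ≤ (Finset.range t \ B).card := by
      refine Finset.card_le_card_of_injOn (fun k => (p k).2) ?_ ?_
      · intro k hk
        obtain ⟨h1, h2, h3, h4, -⟩ := hp k (Finset.mem_filter.1 hk).1
        simp only [Finset.coe_sdiff, Set.mem_sdiff, Finset.mem_coe, Finset.mem_range]
        refine ⟨h2, fun hj => ?_⟩
        obtain ⟨-, h5, -⟩ := hp _ (Finset.mem_filter.1 hj).1
        obtain ⟨-, e1, e2, e3⟩ := hbad k hk
        obtain ⟨-, e4, e5, e6⟩ := hbad _ hj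
        have := hpos k (by omega)
        have := hpos _ h2
        have := hpos _ h5
        -- Two consecutive special links would go around the three pairings of the same four
        -- vertices, giving W₁ k > W₂ k > W₃ k > W₁ k.
        linarith
      · intro k hk k' hk' heq
        obtain ⟨h1, h2, h3, h4, h5⟩ := hp k (Finset.mem_filter.1 hk).1
        obtain ⟨h1', h2', h3', h4', h5'⟩ := hp k' (Finset.mem_filter.1 hk').1
        simp only at heq
        -- A common partner removes all edges added by either step. The edges added by the earlier
        -- one are then still present when the later one adds them, a contradiction.
        have hAA : A k = A k' := by rw [(hbad k hk).1, (hbad k' hk').1, heq]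
        rw [← heq] at h1' h5'
        rcases lt_trichotomy k k' with hlt | heq' | hlt
        · exact absurd (mem_of_forall_notMem_removed hE h3 hlt (by omega) fun l a1 a2 =>
            h5 l a1 (by omega)) (Finset.disjoint_left.1 (hA k' (by omega)) (hAA ▸ h3))
        · exact heq'
        · exact absurd (mem_of_forall_notMem_removed hE h3' hlt (by omega) fun l a1 a2 =>
            h5' l a1 (by omega)) (Finset.disjoint_left.1 (hA k (by omega)) (hAA ▸ h3'))
    have hBsub : B ⊆ Finset.range t := (Finset.filter_subset _ _).trans Finset.sdiff_subset
    have h2 := Finset.card_sdiff_add_card_eq_card hBsub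
    rw [Finset.card_range] at h2
    omega
  have hGsub : G ⊆ Finset.range t := (Finset.filter_subset _ _).trans Finset.sdiff_subset
  have hG1 : ∑ k ∈ G, Δ k ≤ ∑ k ∈ Finset.range t, Δ k :=
    Finset.sum_le_sum_of_subset_of_nonneg hGsub fun k hk _ => (hΔ0 k (Finset.mem_range.1 hk)).le
  have hG2 : ∑ k ∈ G, Δ (p k).2 ≤ 2 * ∑ k ∈ Finset.range t, Δ k := by
    -- The removal time and the edge determine the step that added it. As each step removes at most
    -- two edges, it is a partner at most twice.
    have hinj : Set.InjOn (fun k => (⟨(p k).2, (p k).1⟩ : Σ _ : ℕ, α)) G := by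
      intro k hk k' hk' heq
      obtain ⟨h1, h2, h3, h4, h5⟩ := hp k (Finset.mem_filter.1 hk).1
      obtain ⟨h1', h2', h3', h4', h5'⟩ := hp k' (Finset.mem_filter.1 hk').1
      simp only [Sigma.mk.injEq, heq_eq_eq] at heq
      rw [← heq.1, ← heq.2] at h5'
      rw [← heq.1] at h1'
      rw [← heq.2] at h3'
      exact eq_of_mem_added hE hA h3 h3' h1 h1' h2.le h5 h5'
    calc ∑ k ∈ G, Δ (p k).2
        = ∑ q ∈ G.image fun k => (⟨(p k).2, (p k).1⟩ : Σ _ : ℕ, α), Δ q.1 := by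
          rw [Finset.sum_image hinj]
      _ ≤ ∑ q ∈ (Finset.range t).sigma R, Δ q.1 := by
          refine Finset.sum_le_sum_of_subset_of_nonneg ?_ ?_
          · intro q hq
            obtain ⟨k, hk, rfl⟩ := Finset.mem_image.1 hq
            obtain ⟨h1, h2, h3, h4, h5⟩ := hp k (Finset.mem_filter.1 hk).1
            exact Finset.mem_sigma.2 ⟨Finset.mem_range.2 h2, h4⟩
          · intro q hq _
            exact (hΔ0 _ (Finset.mem_range.1 (Finset.mem_sigma.1 hq).1)).le
      _ = ∑ j ∈ Finset.range t, (R j).card * Δ j := by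
          rw [Finset.sum_sigma]
          exact Finset.sum_congr rfl fun j _ => by simp
      _ ≤ ∑ j ∈ Finset.range t, 2 * Δ j := by
          refine Finset.sum_le_sum fun j hj => ?_
          have hj' := Finset.mem_range.1 hj
          exact mul_le_mul_of_nonneg_right (by exact_mod_cast hR j hj') (hΔ0 j hj').le
      _ = 2 * ∑ k ∈ Finset.range t, Δ k := by rw [Finset.mul_sum]
  have hG3 : G.card * δ ≤ 3 * ∑ k ∈ Finset.range t, Δ k := by
    calc G.card * δ = ∑ k ∈ G, δ := by simp
      _ ≤ ∑ k ∈ G, (Δ k + Δ (p k).2) := by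
          refine Finset.sum_le_sum fun k hk => ?_
          obtain ⟨hk1, hk2⟩ := Finset.mem_filter.1 hk
          obtain ⟨h1, h2, -⟩ := hp k hk1
          have := hΔ0 k (by omega)
          have := hΔ0 _ h2
          exact hk2.trans (max_le (by linarith) (by linarith))
      _ ≤ 3 * ∑ k ∈ Finset.range t, Δ k := by
          rw [Finset.sum_add_distrib]
          linarith
  have ht : (t : ℝ) ≤ 2 * (E t).card + 2 * G.card := by
    have : t ≤ 2 * (E t).card + 2 * G.card := by omega
    exact_mod_cast this
  calc t * δ ≤ (2 * (E t).card + 2 * G.card) * δ := mul_le_mul_of_nonneg_right ht hδ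
    _ = 2 * (E t).card * δ + 2 * (G.card * δ) := by ring
    _ ≤ 2 * (E t).card * δ + 6 * ∑ k ∈ Finset.range t, Δ k := by linarith

end Exchanges

/-! ### Symmetries of an exchange, and coincidences in a linked pair -/

/-- The quadruples `(a, b, c, e)` and `(a', b', c', e')` describe the same exchange. -/
def SameMove {n : ℕ} (a b c e a' b' c' e' : Fin n) : Prop :=
  (a' = a ∧ b' = b ∧ c' = c ∧ e' = e) ∨ (a' = b ∧ b' = a ∧ c' = e ∧ e' = c) ∨
    (a' = c ∧ b' = e ∧ c' = a ∧ e' = b) ∨ (a' = e ∧ b' = c ∧ c' = b ∧ e' = a)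

lemma exists_sameMove_of_mem_added {n : ℕ} {a b c e u w : Fin n}
    (h : s(u, w) ∈ ({s(a, c), s(b, e)} : Finset (Sym2 (Fin n)))) :
    ∃ b' e', SameMove a b c e u b' w e' := by
  simp only [Finset.mem_insert, Finset.mem_singleton, Sym2.eq_iff] at h
  unfold SameMove
  aesop

lemma exists_sameMove_of_mem_removed {n : ℕ} {a b c e u w : Fin n}
    (h : s(u, w) ∈ ({s(a, b), s(c, e)} : Finset (Sym2 (Fin n)))) :
    ∃ c' e', SameMove a b c e u w c' e' := by
  simp only [Finset.mem_insert, Finset.mem_singleton, Sym2.eq_iff] at h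
  unfold SameMove
  aesop

/-- The total length of the two edges `{a, b}` and `{c, e}`. -/
noncomputable def pairLength {n d : ℕ} (x : Fin n → Space d) (a b c e : Fin n) : ℝ :=
  ‖x a - x b‖ + ‖x c - x e‖

lemma pairLength_rev {n d : ℕ} (x : Fin n → Space d) (a b c e : Fin n) :
    pairLength x b a e c = pairLength x a b c e := by
  rw [pairLength, pairLength, norm_sub_rev (x b), norm_sub_rev (x e)]

lemma pairLength_comm {n d : ℕ} (x : Fin n → Space d) (a b c e : Fin n) :
    pairLength x c e a b = pairLength x a b c e := add_comm _ _

lemma gain_eq {n d : ℕ} (x : Fin n → Space d) (a b c e : Fin n) :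
    gain x a b c e = pairLength x a b c e - pairLength x a c b e := by
  rw [gain, pairLength, pairLength]; ring

namespace SameMove

variable {n : ℕ} {a b c e a' b' c' e' : Fin n}

lemma nodup (h : SameMove a b c e a' b' c' e') (hnd : [a, b, c, e].Nodup) :
    [a', b', c', e'].Nodup := by
  simp only [List.nodup_cons, List.mem_cons, List.not_mem_nil, or_false, not_or,
    not_false_eq_true, List.nodup_nil, and_true] at hnd ⊢
  rcases h with ⟨rfl, rfl, rfl, rfl⟩ | ⟨rfl, rfl, rfl, rfl⟩ | ⟨rfl, rfl, rfl, rfl⟩ |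
    ⟨rfl, rfl, rfl, rfl⟩ <;> tauto

lemma removed_eq (h : SameMove a b c e a' b' c' e') :
    ({s(a', b'), s(c', e')} : Finset (Sym2 (Fin n))) = {s(a, b), s(c, e)} := by
  rcases h with ⟨rfl, rfl, rfl, rfl⟩ | ⟨rfl, rfl, rfl, rfl⟩ | ⟨rfl, rfl, rfl, rfl⟩ |
    ⟨rfl, rfl, rfl, rfl⟩
  · rfl
  · rw [Sym2.eq_swap, Sym2.eq_swap (a := c')]
  · rw [Finset.pair_comm]
  · rw [Finset.pair_comm, Sym2.eq_swap, Sym2.eq_swap (a := a')]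

lemma swap (h : SameMove a b c e a' b' c' e') : SameMove a c b e a' c' b' e' := by
  unfold SameMove at h ⊢
  tauto

lemma pairLength_eq (h : SameMove a b c e a' b' c' e') {d : ℕ} (x : Fin n → Space d) :
    pairLength x a' b' c' e' = pairLength x a b c e := by
  rcases h with ⟨rfl, rfl, rfl, rfl⟩ | ⟨rfl, rfl, rfl, rfl⟩ | ⟨rfl, rfl, rfl, rfl⟩ |
    ⟨rfl, rfl, rfl, rfl⟩
  · rfl
  · rw [pairLength_rev]
  · rw [pairLength_comm]
  · rw [pairLength_comm, pairLength_rev]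

/-- This concerns the third pairing of the four vertices, neither removed nor added, which the
second exchange of a special link adds. -/
lemma pairLength_eq' (h : SameMove a b c e a' b' c' e') {d : ℕ} (x : Fin n → Space d) :
    pairLength x a' e' b' c' = pairLength x a e b c := by
  simp only [pairLength]
  rcases h with ⟨rfl, rfl, rfl, rfl⟩ | ⟨rfl, rfl, rfl, rfl⟩ | ⟨rfl, rfl, rfl, rfl⟩ |
    ⟨rfl, rfl, rfl, rfl⟩
  · rfl
  · rw [add_comm]
  · rw [norm_sub_rev (x b'), norm_sub_rev (x a'), add_comm]
  · rw [norm_sub_rev (x a'), norm_sub_rev (x b')]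

end SameMove

/-- The coincidences among the six vertices of two linked exchanges. -/
def IsLinkedPair {n : ℕ} (v : Fin 6 → Fin n) : Prop :=
  Function.Injective v ∨ ([v 0, v 1, v 2, v 3, v 5].Nodup ∧ v 4 = v 1) ∨
    ([v 0, v 1, v 2, v 3, v 4].Nodup ∧ v 5 = v 1)

/-- The shared edge is {a, c}. Of the other two vertices g, h of the second exchange, either may
coincide with b or e; reading both exchanges from c instead of a turns a coincidence with e into one
with b, the vertex in position 1. -/
lemma exists_linkedPair_of_eq {n d : ℕ} {x : Fin n → Space d} {a b c e g h : Fin n}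
    (hnd : [a, b, c, e].Nodup) (hnd' : [a, c, g, h].Nodup) (hpos : 0 < gain x a b c e)
    (hpos' : 0 < gain x a c g h) :
    (∃ v : Fin 6 → Fin n, IsLinkedPair v ∧ gain x (v 0) (v 1) (v 2) (v 3) = gain x a b c e ∧
      gain x (v 0) (v 2) (v 4) (v 5) = gain x a c g h) ∨ (g = e ∧ h = b) := by
  simp only [List.nodup_cons, List.mem_cons, List.not_mem_nil, or_false, not_or,
    not_false_eq_true, List.nodup_nil, and_true] at hnd hnd'
  obtain ⟨⟨h1, h2, h3⟩, ⟨h4, h5⟩, h6⟩ := hnd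
  obtain ⟨⟨-, h8, h9⟩, ⟨h10, h11⟩, h12⟩ := hnd'
  have e1 : gain x c e a b = gain x a b c e := by
    simp only [gain, norm_sub_rev (x c) (x a), norm_sub_rev (x e) (x b)]; ring
  have e2 : gain x c a h g = gain x a c g h := by
    simp only [gain, norm_sub_rev (x c) (x a), norm_sub_rev (x h) (x g)]; ring
  by_cases hge : g = e
  · by_cases hhb : h = b
    · exact Or.inr ⟨hge, hhb⟩
    · refine Or.inl ⟨![c, e, a, b, h, g], Or.inr (Or.inr ⟨?_, hge⟩), e1, e2⟩
      subst hge
      simp only [List.nodup_cons, List.mem_cons, List.not_mem_nil, or_false, not_or,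
        not_false_eq_true, List.nodup_nil, and_true]
      simp
      tauto
  left
  by_cases hhe : h = e
  -- If g = b and h = e, the second exchange undoes the first, so the gains are opposite and cannot
  -- both be positive.
  · by_cases hgb : g = b
    · exfalso
      subst hhe hgb
      have : gain x a c g h = - gain x a g c h := by rw [gain, gain]; ring
      linarith
    · refine ⟨![c, e, a, b, h, g], Or.inr (Or.inl ⟨?_, hhe⟩), e1, e2⟩
      subst hhe
      simp
      tauto
  by_cases hgb : g = b
  · refine ⟨![a, b, c, e, g, h], Or.inr (Or.inl ⟨?_, hgb⟩), rfl, rfl⟩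
    subst hgb
    simp
    tauto
  by_cases hhb : h = b
  · refine ⟨![a, b, c, e, g, h], Or.inr (Or.inr ⟨?_, hhb⟩), rfl, rfl⟩
    subst hhb
    simp
    tauto
  refine ⟨![a, b, c, e, g, h], Or.inl ?_, rfl, rfl⟩
  rw [← List.nodup_ofFn]
  simp
  tauto

/-- Two exchanges, the second of which removes an edge that the first adds. -/
lemma linked_exchanges {n d : ℕ} {x : Fin n → Space d} {a b c e a' b' c' e' : Fin n}
    (hnd : [a, b, c, e].Nodup) (hnd' : [a', b', c', e'].Nodup) (hpos : 0 < gain x a b c e)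
    (hpos' : 0 < gain x a' b' c' e') {f : Sym2 (Fin n)}
    (hf : f ∈ ({s(a, c), s(b, e)} : Finset (Sym2 (Fin n))))
    (hf' : f ∈ ({s(a', b'), s(c', e')} : Finset (Sym2 (Fin n)))) :
    (∃ v : Fin 6 → Fin n, IsLinkedPair v ∧ gain x (v 0) (v 1) (v 2) (v 3) = gain x a b c e ∧
      gain x (v 0) (v 2) (v 4) (v 5) = gain x a' b' c' e') ∨
    (({s(a, c), s(b, e)} : Finset (Sym2 (Fin n))) = {s(a', b'), s(c', e')} ∧
      pairLength x a' b' c' e' = pairLength x a c b e ∧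
      pairLength x a' c' b' e' = pairLength x a e b c ∧
      pairLength x a' e' b' c' = pairLength x a b c e) := by
  induction f using Sym2.ind with | _ u w =>
  obtain ⟨p, q, h⟩ := exists_sameMove_of_mem_added hf
  obtain ⟨g, k, h'⟩ := exists_sameMove_of_mem_removed hf'
  have hg : gain x u p w q = gain x a b c e := by
    rw [gain_eq, gain_eq, h.pairLength_eq, h.swap.pairLength_eq]
  have hg' : gain x u w g k = gain x a' b' c' e' := by
    rw [gain_eq, gain_eq, h'.pairLength_eq, h'.swap.pairLength_eq]
  rw [← hg] at hpos
  rw [← hg'] at hpos'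
  rcases exists_linkedPair_of_eq (h.nodup hnd) (h'.nodup hnd') hpos hpos' with
    ⟨v, hv, hv1, hv2⟩ | ⟨rfl, rfl⟩
  · exact Or.inl ⟨v, hv, hv1.trans hg, hv2.trans hg'⟩
  · right
    rw [← h.swap.removed_eq, ← h'.removed_eq, ← h'.pairLength_eq, ← h'.swap.pairLength_eq,
      ← h'.pairLength_eq', ← h.pairLength_eq, ← h.swap.pairLength_eq, ← h.pairLength_eq']
    refine ⟨by rw [Sym2.eq_swap (a := k)], ?_, ?_, ?_⟩
    · simp only [pairLength, norm_sub_rev (x g)]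
    · simp only [pairLength, norm_sub_rev (x k)]
    · simp only [pairLength]

/-- Such tours have at most one edge: for n = 2 both positions carry the same edge. -/
lemma not_isTwoChange_of_le_two {n : ℕ} (hn : n ≤ 2) {π π' : Tour n} : ¬ IsTwoChange π π' := by
  rintro ⟨e₁, e₂, f₁, f₂, he, -, heE, -, -⟩
  have h2 : 2 ≤ π.edges.card := by
    rw [← Finset.card_pair he]; exact Finset.card_le_card heE
  have h3 : π.edges.card ≤ 1 := by
    interval_cases n
    · simp [Tour.edges]
    · exact Finset.card_image_le.trans (by simp)
    · refine Finset.card_le_one.2 ?_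
      intro e he f hf
      rw [Tour.edges, Finset.mem_image] at he hf
      obtain ⟨i, -, rfl⟩ := he
      obtain ⟨j, -, rfl⟩ := hf
      have hij : j = i ∨ j = finRotate 2 i := by revert i j; decide
      rcases hij with rfl | rfl
      · rfl
      · have : finRotate 2 (finRotate 2 i) = i := by revert i; decide
        rw [this, Sym2.eq_swap]
  omega

/-- If linked exchanges have large gains, then 2-opt performs few iterations. -/
theorem HasRun.mul_le {n d : ℕ} {x : Fin n → Space d} {t : ℕ} (h : HasRun x t) {δ : ℝ}
    (hδ : 0 ≤ δ)
    (hlink : ∀ v : Fin 6 → Fin n, IsLinkedPair v → 0 < gain x (v 0) (v 1) (v 2) (v 3) →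
      0 < gain x (v 0) (v 2) (v 4) (v 5) →
      δ ≤ max (gain x (v 0) (v 1) (v 2) (v 3)) (gain x (v 0) (v 2) (v 4) (v 5))) :
    t * δ ≤ 2 * n * δ + 12 * ∑ i, ‖x i‖ := by
  obtain ⟨T, hT⟩ := h
  have hsum0 : 0 ≤ ∑ i, ‖x i‖ := Finset.sum_nonneg fun _ _ => norm_nonneg _
  rcases Nat.eq_zero_or_pos t with rfl | ht
  · simp only [CharP.cast_eq_zero, zero_mul]
    positivity
  have hn : 3 ≤ n := by
    by_contra hn
    exact not_isTwoChange_of_le_two (by omega) (hT 0 ht).1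
  have hq : ∀ k, ∃ q : Fin 4 → Fin n, k < t →
      IsExchange (T k).edges (T (k + 1)).edges (q 0) (q 1) (q 2) (q 3) := by
    intro k
    by_cases hk : k < t
    · obtain ⟨a, b, c, e, h⟩ := (hT k hk).1.exists_exchange hn
      exact ⟨![a, b, c, e], fun _ => h⟩
    · exact ⟨fun _ => ⟨0, by omega⟩, fun h => absurd h hk⟩
  choose q hq using hq
  have hgain : ∀ k < t, (T k).length x - (T (k + 1)).length x =
      gain x (q k 0) (q k 1) (q k 2) (q k 3) := fun k hk => (hq k hk).length_sub_length hn x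
  have hpos : ∀ k < t, 0 < gain x (q k 0) (q k 1) (q k 2) (q k 3) := by
    intro k hk
    rw [← hgain k hk]
    exact sub_pos.2 (hT k hk).2
  have hmain := card_mul_le_of_links (t := t) (E := fun k => (T k).edges)
    (R := fun k => {s(q k 0, q k 1), s(q k 2, q k 3)})
    (A := fun k => {s(q k 0, q k 2), s(q k 1, q k 3)})
    (fun k hk => (hq k hk).2.2.2.2.2)
    (fun k hk => by
      rw [Finset.disjoint_left]
      intro f hf
      rcases Finset.mem_insert.1 hf with rfl | hf
      · exact (hq k hk).2.2.2.1
      · rw [Finset.mem_singleton.1 hf]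
        exact (hq k hk).2.2.2.2.1)
    (fun k _ => Finset.insert_nonempty _ _)
    (fun k _ => Finset.card_le_two)
    (W₁ := fun k => pairLength x (q k 0) (q k 1) (q k 2) (q k 3))
    (W₂ := fun k => pairLength x (q k 0) (q k 2) (q k 1) (q k 3))
    (W₃ := fun k => pairLength x (q k 0) (q k 3) (q k 1) (q k 2))
    (fun k hk => by
      have := hpos k hk
      rw [gain_eq] at this
      linarith)
    hδ
    (by
      intro k j f hkj hjt hf hf'
      have hkt : k < t := hkj.trans hjt
      simp only [← gain_eq]
      rcases linked_exchanges (hq k hkt).1 (hq j hjt).1 (hpos k hkt) (hpos j hjt) hf hf' with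
        ⟨v, hv, hv1, hv2⟩ | h
      · left
        have := hlink v hv (hv1 ▸ hpos k hkt) (hv2 ▸ hpos j hjt)
        rwa [hv1, hv2] at this
      · exact Or.inr h)
  rw [Tour.card_edges hn] at hmain
  refine hmain.trans ?_
  have htel : ∑ k ∈ Finset.range t, (pairLength x (q k 0) (q k 1) (q k 2) (q k 3) -
      pairLength x (q k 0) (q k 2) (q k 1) (q k 3)) = (T 0).length x - (T t).length x := by
    rw [← Finset.sum_range_sub' fun k => (T k).length x]
    refine Finset.sum_congr rfl fun k hk => ?_
    rw [hgain k (Finset.mem_range.1 hk), gain_eq]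
  rw [htel]
  -- The total gain is at most the initial length, hence at most `2 * ∑ i, ‖x i‖`; together with the
  -- factor 6 this gives 12.
  have := (T 0).length_le x
  have := (T t).length_nonneg x
  linarith

/-! ### The expected number of iterations -/

open Classical in
/-- The number of linked pairs of exchanges both of whose gains lie in `[0, ε]`. -/
noncomputable def smallPairs {n d : ℕ} (x : Fin n → Space d) (ε : ℝ) : ℝ≥0∞ :=
  ∑ v : Fin 6 → Fin n with IsLinkedPair v,
    window 0 ε (gain x (v 0) (v 1) (v 2) (v 3)) * window 0 ε (gain x (v 0) (v 2) (v 4) (v 5))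

lemma measurable_smallPairs {n d : ℕ} (y : Fin n → Space d) (ε : ℝ) :
    Measurable fun g => smallPairs (perturb y g) ε := by
  have hp : Measurable fun g : Fin n → Fin d → ℝ => perturb y g := by
    unfold perturb
    fun_prop
  unfold smallPairs
  refine Finset.measurable_sum _ fun v _ => ?_
  exact (((measurable_window 0 ε).comp (measurable_gain _ _ _ _)).comp hp).mul
    (((measurable_window 0 ε).comp (measurable_gain _ _ _ _)).comp hp)

/-- `smallPairs` is a sum of zeros and ones, so a value below 1 means that no linked pair is small.
-/
lemma HasRun.mul_le_of_smallPairs_lt_one {n d : ℕ} {x : Fin n → Space d} {t : ℕ} (h : HasRun x t)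
    {ε : ℝ} (hε : 0 ≤ ε) (hs : smallPairs x ε < 1) :
    t * ε ≤ 2 * n * ε + 12 * ∑ i, ‖x i‖ := by
  classical
  refine h.mul_le hε fun v hv h1 h2 => ?_
  by_contra hlt
  rw [not_le, max_lt_iff] at hlt
  refine absurd hs (not_lt.2 ?_)
  have hw : ∀ r : ℝ, 0 < r → r < ε → window 0 ε r = 1 := by
    intro r hr hr'
    rw [window, Set.indicator_of_mem (by rw [zero_add]; exact ⟨hr.le, hr'.le⟩), Pi.one_apply]
  rw [smallPairs]
  refine le_trans ?_ (Finset.single_le_sum (fun _ _ => zero_le)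
    (Finset.mem_filter.2 ⟨Finset.mem_univ v, hv⟩))
  rw [hw _ h1 hlt.1, hw _ h2 hlt.2, one_mul]

lemma lintegral_smallPairs {n d : ℕ} (y : Fin n → Space d) (σ ε : ℝ)
    [DecidablePred (IsLinkedPair (n := n))] :
    ∫⁻ g, smallPairs (perturb y g) ε ∂gaussianNoise n d σ =
      ∑ v : Fin 6 → Fin n with IsLinkedPair v, pairMass y σ ε v := by
  have hp : Measurable fun g : Fin n → Fin d → ℝ => perturb y g := by
    unfold perturb
    fun_prop
  unfold smallPairs pairMass
  rw [lintegral_finsetSum]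
  · congr!
  · intro v _
    exact (((measurable_window 0 ε).comp (measurable_gain _ _ _ _)).comp hp).mul
      (((measurable_window 0 ε).comp (measurable_gain _ _ _ _)).comp hp)

lemma card_filter_eq_le (n : ℕ) (i j : Fin 6) (hij : i ≠ j) :
    (Finset.univ.filter fun v : Fin 6 → Fin n => v i = v j).card ≤ n ^ 5 := by
  have hcard : Fintype.card ({k : Fin 6 // k ≠ i} → Fin n) = n ^ 5 := by
    simp [Fintype.card_subtype_compl]
  rw [← hcard, ← Finset.card_univ]
  refine Finset.card_le_card_of_injOn (fun v k => v k)
    (fun _ _ => Finset.mem_coe.2 (Finset.mem_univ _)) ?_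
  intro v hv w hw h
  have h' : ∀ k, k ≠ i → v k = w k := fun k hk => congrFun h ⟨k, hk⟩
  funext k
  by_cases hk : k = i
  · subst hk
    rw [(Finset.mem_filter.1 hv).2, (Finset.mem_filter.1 hw).2, h' j hij.symm]
  · exact h' k hk

/-- Here q stands for η^(1/3). With this normalisation the n^6 injective tuples and the at most n^5
tuples for each coincidence both lead to powers of nq. -/
lemma sum_pairMass_le {n d : ℕ} {y : Fin n → Space d} {σ ε : ℝ} {q : ℝ≥0∞}
    [DecidablePred (IsLinkedPair (n := n))]
    (h0 : ∀ v : Fin 6 → Fin n, Function.Injective v → pairMass y σ ε v ≤ q ^ 6)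
    (h1 : ∀ v : Fin 6 → Fin n, [v 0, v 1, v 2, v 3, v 5].Nodup → v 4 = v 1 →
      pairMass y σ ε v ≤ 2 * q ^ 5)
    (h2 : ∀ v : Fin 6 → Fin n, [v 0, v 1, v 2, v 3, v 4].Nodup → v 5 = v 1 →
      pairMass y σ ε v ≤ 2 * q ^ 5) :
    ∑ v : Fin 6 → Fin n with IsLinkedPair v, pairMass y σ ε v ≤
      (n * q) ^ 6 + 4 * (n * q) ^ 5 := by
  calc ∑ v : Fin 6 → Fin n with IsLinkedPair v, pairMass y σ ε v
      ≤ ∑ v : Fin 6 → Fin n with IsLinkedPair v, (q ^ 6 +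
          ((if v 4 = v 1 then 2 * q ^ 5 else 0) + if v 5 = v 1 then 2 * q ^ 5 else 0)) := by
        refine Finset.sum_le_sum fun v hv => ?_
        rcases (Finset.mem_filter.1 hv).2 with h | ⟨h, h'⟩ | ⟨h, h'⟩
        · exact (h0 v h).trans le_self_add
        · rw [if_pos h']
          exact (h1 v h h').trans (le_self_add.trans le_add_self)
        · rw [if_pos h']
          exact (h2 v h h').trans (le_add_self.trans le_add_self)
    _ ≤ ∑ v : Fin 6 → Fin n, (q ^ 6 +
          ((if v 4 = v 1 then 2 * q ^ 5 else 0) + if v 5 = v 1 then 2 * q ^ 5 else 0)) :=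
        Finset.sum_le_sum_of_subset (Finset.filter_subset _ _)
    _ = n ^ 6 * q ^ 6 +
        ((Finset.univ.filter fun v : Fin 6 → Fin n => v 4 = v 1).card * (2 * q ^ 5) +
        (Finset.univ.filter fun v : Fin 6 → Fin n => v 5 = v 1).card * (2 * q ^ 5)) := by
        rw [Finset.sum_add_distrib, Finset.sum_add_distrib, ← Finset.sum_filter,
          ← Finset.sum_filter]
        simp
    _ ≤ n ^ 6 * q ^ 6 + ((n ^ 5 : ℕ) * (2 * q ^ 5) + (n ^ 5 : ℕ) * (2 * q ^ 5)) := by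
        gcongr
        · exact card_filter_eq_le n 4 1 (by decide)
        · exact card_filter_eq_le n 5 1 (by decide)
    _ = (n * q) ^ 6 + 4 * (n * q) ^ 5 := by
        push_cast
        ring

/-- The growth 16^k of the weights loses against the decay 32^(-k), because 16/32 = 1/2. -/
lemma tsum_sixteen_mul_half : ∑' k : ℕ, (16 : ℝ≥0∞) ^ (k + 1) * (5 * (2⁻¹ ^ k) ^ 5) = 160 := by
  have h1 : (16 : ℝ≥0∞) * 2⁻¹ ^ 5 = 2⁻¹ := by
    have h : (16 : ℝ≥0∞) * 2⁻¹ ^ 5 = (2 * 2⁻¹) ^ 4 * 2⁻¹ := by ring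
    rw [h, ENNReal.mul_inv_cancel (by norm_num) (by norm_num), one_pow, one_mul]
  have h2 : ∀ k : ℕ, (16 : ℝ≥0∞) ^ (k + 1) * (5 * (2⁻¹ ^ k) ^ 5) = 80 * 2⁻¹ ^ k := by
    intro k
    have : (16 : ℝ≥0∞) ^ (k + 1) * (5 * (2⁻¹ ^ k) ^ 5) = 80 * (16 * 2⁻¹ ^ 5) ^ k := by ring
    rw [this, h1]
  simp_rw [h2]
  rw [ENNReal.tsum_mul_left, ENNReal.tsum_geometric, ENNReal.one_sub_inv_two, inv_inv]
  norm_num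

/-- With w = 2^k this separates the size of the instance from the random scale 8^k, so that their
dependence does not matter. -/
lemma mul_pow_le_pow_add_pow {s w : ℝ} (hs : 0 ≤ s) (hw : 0 ≤ w) : s * w ^ 3 ≤ s ^ 4 + w ^ 4 := by
  rcases le_total s w with h | h
  · calc s * w ^ 3 ≤ w * w ^ 3 := by gcongr
      _ ≤ s ^ 4 + w ^ 4 := by nlinarith [pow_nonneg hs 4]
  · calc s * w ^ 3 ≤ s * s ^ 3 := by gcongr
      _ ≤ s ^ 4 + w ^ 4 := by nlinarith [pow_nonneg hw 4]

/-- The number of iterations is controlled by the numbers of small pairs at the scales `8⁻ᵏ/M`. -/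
lemma iterations_le {n d : ℕ} (x : Fin n → Space d) {M Λ : ℝ} (hM : 0 < M) (hΛ : 0 < Λ) :
    iterations x ≤ 2 * n + ENNReal.ofReal (12 * Λ * M) *
      (ENNReal.ofReal (((∑ i, ‖x i‖) / Λ) ^ 4) +
        (1 + ∑' k : ℕ, 16 ^ (k + 1) * smallPairs x (1 / (8 ^ k * M)))) := by
  set S := ∑ i, ‖x i‖ with hS
  have hS0 : 0 ≤ S := Finset.sum_nonneg fun _ _ => norm_nonneg _
  refine iSup₂_le fun t ht => ?_
  by_cases hex : ∃ k : ℕ, smallPairs x (1 / (8 ^ k * M)) < 1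
  · classical
    set k := Nat.find hex with hk
    have hrun := ht.mul_le_of_smallPairs_lt_one (by positivity) (Nat.find_spec hex)
    rw [← hk] at hrun
    have h1 : (t : ℝ) ≤ 2 * n + 12 * Λ * M * ((S / Λ) ^ 4 + 16 ^ k) := by
      have h2 : (t : ℝ) ≤ 2 * n + 12 * S * (8 ^ k * M) := by
        have h8 : (0 : ℝ) < 8 ^ k * M := by positivity
        have := mul_le_mul_of_nonneg_right hrun h8.le
        calc (t : ℝ) = t * (1 / (8 ^ k * M)) * (8 ^ k * M) := by field_simp
          _ ≤ _ := this
          _ = _ := by rw [← hS]; field_simp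
      have h3 := mul_pow_le_pow_add_pow (s := S / Λ) (w := 2 ^ k) (by positivity) (by positivity)
      have e3 : ((2 : ℝ) ^ k) ^ 3 = 8 ^ k := by rw [← pow_mul, mul_comm, pow_mul]; norm_num
      have e4 : ((2 : ℝ) ^ k) ^ 4 = 16 ^ k := by rw [← pow_mul, mul_comm, pow_mul]; norm_num
      rw [e3, e4] at h3
      calc (t : ℝ) ≤ 2 * n + 12 * S * (8 ^ k * M) := h2
        _ = 2 * n + 12 * Λ * M * (S / Λ * 8 ^ k) := by field_simp
        _ ≤ _ := by gcongr
    -- Scale k - 1 still has a small pair because k is the first without one; its term in the series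
    -- is therefore at least 16^k. For k = 0 the summand 1 suffices.
    have h16 : (16 : ℝ≥0∞) ^ k ≤ 1 + ∑' k : ℕ, 16 ^ (k + 1) * smallPairs x (1 / (8 ^ k * M)) := by
      rcases Nat.eq_zero_or_pos k with h0 | h0
      · rw [h0, pow_zero]; exact le_self_add
      · refine le_trans ?_ (le_add_self.trans le_rfl)
        refine le_trans ?_ (ENNReal.le_tsum (k - 1))
        have h4 : 1 ≤ smallPairs x (1 / (8 ^ (k - 1) * M)) :=
          not_lt.1 (Nat.find_min hex (by omega))
        rw [Nat.sub_add_cancel h0]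
        exact le_mul_of_one_le_right zero_le h4
    calc (t : ℝ≥0∞) = ENNReal.ofReal t := (ENNReal.ofReal_natCast t).symm
      _ ≤ ENNReal.ofReal (2 * n + 12 * Λ * M * ((S / Λ) ^ 4 + 16 ^ k)) :=
          ENNReal.ofReal_le_ofReal h1
      _ = 2 * n + ENNReal.ofReal (12 * Λ * M) * (ENNReal.ofReal ((S / Λ) ^ 4) + 16 ^ k) := by
          rw [ENNReal.ofReal_add (by positivity) (by positivity),
            ENNReal.ofReal_mul (p := 12 * Λ * M) (by positivity),
            ENNReal.ofReal_add (by positivity) (by positivity), ENNReal.ofReal_mul (by norm_num),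
            ENNReal.ofReal_natCast, ENNReal.ofReal_pow (by norm_num) k]
          norm_num
      _ ≤ _ := by gcongr
  -- If there are small pairs at every scale, all terms of the series are at least 1 and the bound
  -- is infinite.
  · push Not at hex
    have htop : ∑' k : ℕ, (16 : ℝ≥0∞) ^ (k + 1) * smallPairs x (1 / (8 ^ k * M)) = ⊤ := by
      rw [eq_top_iff, ← ENNReal.tsum_const_eq_top_of_ne_zero (α := ℕ) (c := 1) one_ne_zero]
      refine ENNReal.tsum_le_tsum fun k => ?_
      calc (1 : ℝ≥0∞) = 1 * 1 := (one_mul 1).symm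
        _ ≤ _ := mul_le_mul' (one_le_pow₀ (by norm_num)) (hex k)
    rw [htop, add_top, add_top, ENNReal.mul_top, add_top]
    · exact le_top
    · rw [ne_eq, ENNReal.ofReal_eq_zero, not_le]
      positivity

/-- Each ‖x i‖/√d is at most 1 + ‖g i‖/√d. Two applications of convexity give the fourth moment 8 (1
+ 4 · 4!) = 776. -/
lemma lintegral_sum_norm_pow_le {n d : ℕ} (hn : 0 < n) (hd : 0 < d) {σ : ℝ} (hσ : 0 < σ)
    (hσ1 : σ ≤ 1) {y : Fin n → Space d} (hy : ∀ i j, y i j ∈ Set.Icc (-1 : ℝ) 1) :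
    ∫⁻ g, ENNReal.ofReal (((∑ i, ‖perturb y g i‖) / (n * √d)) ^ 4) ∂gaussianNoise n d σ ≤ 776 := by
  have hn' : (0 : ℝ) < n := by exact_mod_cast hn
  have hd' : (0 : ℝ) < √d := Real.sqrt_pos.2 (by exact_mod_cast hd)
  have hy' : ∀ i, ‖y i‖ ≤ √d := by
    intro i
    rw [EuclideanSpace.norm_eq]
    apply Real.sqrt_le_sqrt
    calc ∑ j, ‖y i j‖ ^ 2 ≤ ∑ _j : Fin d, (1 : ℝ) := by
          refine Finset.sum_le_sum fun j _ => ?_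
          rw [Real.norm_eq_abs, sq_abs]
          have := hy i j
          rw [Set.mem_Icc] at this
          nlinarith
      _ = d := by simp
  have hpt : ∀ g : Fin n → Fin d → ℝ, ((∑ i, ‖perturb y g i‖) / (n * √d)) ^ 4 ≤
      ∑ i, 8 / n * (1 + (‖WithLp.toLp 2 (g i)‖ / √d) ^ (2 * 2)) := by
    intro g
    set r : Fin n → ℝ := fun i => ‖WithLp.toLp 2 (g i)‖ / √d with hr
    have hr0 : ∀ i, 0 ≤ r i := fun i => by positivity
    have h1 : (∑ i, ‖perturb y g i‖) / (n * √d) ≤ (∑ i, (1 + r i)) / n := by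
      rw [div_le_div_iff₀ (by positivity) hn', Finset.sum_mul, Finset.sum_mul]
      refine Finset.sum_le_sum fun i _ => ?_
      have h2 : ‖perturb y g i‖ ≤ √d + ‖WithLp.toLp 2 (g i)‖ :=
        (norm_add_le _ _).trans (by linarith [hy' i])
      calc ‖perturb y g i‖ * n ≤ (√d + ‖WithLp.toLp 2 (g i)‖) * n := by gcongr
        _ = (1 + r i) * (n * √d) := by rw [hr]; field_simp
    calc _ ≤ ((∑ i, (1 + r i)) / n) ^ 4 := by gcongr
      _ ≤ (∑ i, (1 + r i) ^ 4) / n := by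
          have h3 := pow_sum_div_card_le_sum_pow (s := Finset.univ) (f := fun i => 1 + r i)
            (fun i _ => by have := hr0 i; positivity) 3
          rw [Finset.card_univ, Fintype.card_fin] at h3
          rw [div_pow, div_le_div_iff₀ (by positivity) hn']
          rw [div_le_iff₀ (by positivity)] at h3
          calc _ ≤ _ := mul_le_mul_of_nonneg_right h3 hn'.le
            _ = _ := by ring
      _ ≤ ∑ i, 8 / n * (1 + r i ^ (2 * 2)) := by
          rw [Finset.sum_div]
          refine Finset.sum_le_sum fun i _ => ?_
          rw [div_eq_mul_inv, div_eq_mul_inv, mul_right_comm]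
          gcongr
          have h4 := add_pow_le zero_le_one (hr0 i) 4
          norm_num at h4 ⊢
          exact h4
  have hmarg : ∀ i, ∫⁻ g, ENNReal.ofReal ((‖WithLp.toLp 2 (g i)‖ / √d) ^ (2 * 2))
      ∂gaussianNoise n d σ ≤ ENNReal.ofReal 96 := by
    intro i
    have hm := (measurePreserving_eval (fun _ : Fin n =>
      Measure.pi fun _ : Fin d => gaussianReal 0 (σ ^ 2).toNNReal) i).lintegral_comp
      (f := fun w => ENNReal.ofReal ((‖WithLp.toLp 2 w‖ / √d) ^ (2 * 2))) (by fun_prop)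
    rw [gaussianNoise]
    refine hm.le.trans ?_
    have := lintegral_norm_pow_isoGaussian_le hd hσ.le hσ1 2
    rw [lintegral_isoGaussian d σ (by fun_prop)] at this
    refine this.trans (ENNReal.ofReal_le_ofReal ?_)
    norm_num [Nat.factorial]
  have hprob : IsProbabilityMeasure (gaussianNoise n d σ) := by
    unfold gaussianNoise; infer_instance
  calc _ ≤ ∫⁻ g, ∑ i : Fin n, ENNReal.ofReal (8 / n) *
        (1 + ENNReal.ofReal ((‖WithLp.toLp 2 (g i)‖ / √d) ^ (2 * 2))) ∂gaussianNoise n d σ := by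
        refine lintegral_mono fun g => ?_
        refine (ENNReal.ofReal_le_ofReal (hpt g)).trans_eq ?_
        rw [ENNReal.ofReal_sum_of_nonneg fun i _ => by positivity]
        refine Finset.sum_congr rfl fun i _ => ?_
        rw [ENNReal.ofReal_mul (by positivity), ENNReal.ofReal_add zero_le_one (by positivity),
          ENNReal.ofReal_one]
    _ = ∑ i : Fin n, ENNReal.ofReal (8 / n) *
        (1 + ∫⁻ g, ENNReal.ofReal ((‖WithLp.toLp 2 (g i)‖ / √d) ^ (2 * 2))
          ∂gaussianNoise n d σ) := by
        rw [lintegral_finsetSum]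
        · refine Finset.sum_congr rfl fun i _ => ?_
          rw [lintegral_const_mul _ (by fun_prop), lintegral_add_left measurable_const,
            lintegral_const, measure_univ, one_mul]
        · intro i _
          fun_prop
    _ ≤ ∑ _i : Fin n, ENNReal.ofReal (8 / n) * (1 + ENNReal.ofReal 96) := by
        gcongr with i
        exact hmarg i
    _ = ENNReal.ofReal 776 := by
        rw [Finset.sum_const, Finset.card_univ, Fintype.card_fin, nsmul_eq_mul,
          ← ENNReal.ofReal_one, ← ENNReal.ofReal_add (by norm_num) (by norm_num),
          ← ENNReal.ofReal_mul (by positivity), ← ENNReal.ofReal_natCast,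
          ← ENNReal.ofReal_mul (by positivity)]
        congr 1
        field_simp
        norm_num
    _ = 776 := by norm_num

lemma one_le_boxSize {c σ : ℝ} (hc : 2 ≤ c) (hσ : 0 < σ) (n : ℕ) : 1 ≤ boxSize c σ n := by
  rw [boxSize]
  have : 0 ≤ σ * √(n * Real.log n) := by positivity
  nlinarith

theorem exists_expectedIterations_le :
    ∃ K : ℝ, 0 < K ∧ ∀ (d : ℕ), 3 ≤ d → ∀ (n : ℕ), 0 < n → ∀ σ : ℝ, 0 < σ → σ ≤ 1 →
      ∀ y : Fin n → Space d, (∀ i j, y i j ∈ Set.Icc (-1 : ℝ) 1) →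
        expectedIterations y σ ≤ ENNReal.ofReal (K * (√d * n ^ 4 / σ ^ 2)) := by
  classical
  obtain ⟨C, hC, hmass⟩ := exists_pairMass_le
  refine ⟨2 + 12 * C * 937, by positivity, ?_⟩
  intro d hd n hn σ hσ hσ1 y hy
  have hn' : (0 : ℝ) < n := by exact_mod_cast hn
  have hn1 : (1 : ℝ) ≤ n := by exact_mod_cast hn
  have hd1 : 1 ≤ √d := by
    rw [Real.one_le_sqrt]
    exact_mod_cast (by omega : 1 ≤ d)
  -- This choice makes η at the scale 8^(-k)/M equal to q³ with q = 2^(-k)/n, so that nq = 2^(-k).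
  set M := C * n ^ 3 / σ ^ 2 with hM
  have hM0 : 0 < M := by positivity
  have hprob : IsProbabilityMeasure (gaussianNoise n d σ) := by
    unfold gaussianNoise; infer_instance
  have hsmall : ∀ k : ℕ, ∫⁻ g, smallPairs (perturb y g) (1 / (8 ^ k * M)) ∂gaussianNoise n d σ ≤
      5 * (2⁻¹ ^ k) ^ 5 := by
    intro k
    set q : ℝ := 1 / (2 ^ k * n) with hq
    have hη : ENNReal.ofReal (C * (1 / (8 ^ k * M)) / σ ^ 2) = ENNReal.ofReal q ^ 3 := by
      rw [← ENNReal.ofReal_pow (by positivity), hM, hq]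
      congr 1
      have e3 : ((2 : ℝ) ^ k) ^ 3 = 8 ^ k := by rw [← pow_mul, mul_comm, pow_mul]; norm_num
      rw [div_pow, mul_pow, e3]
      field_simp
    have h53 : (ENNReal.ofReal q ^ 3) ^ (5 / 3 : ℝ) = ENNReal.ofReal q ^ 5 := by
      rw [← ENNReal.rpow_natCast, ← ENNReal.rpow_mul, ← ENNReal.rpow_natCast]
      norm_num
    have hnq : (n : ℝ≥0∞) * ENNReal.ofReal q = 2⁻¹ ^ k := by
      rw [← ENNReal.ofReal_natCast, ← ENNReal.ofReal_mul hn'.le, hq,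
        show (n : ℝ) * (1 / (2 ^ k * n)) = 2⁻¹ ^ k by rw [inv_pow]; field_simp,
        ENNReal.ofReal_pow (by norm_num), ENNReal.ofReal_inv_of_pos (by norm_num)]
      norm_num
    have hm := hmass d hd n σ hσ hσ1 y hy (1 / (8 ^ k * M)) (by positivity)
    rw [hη, h53, ← pow_mul] at hm
    rw [lintegral_smallPairs]
    refine (sum_pairMass_le (fun v => (hm v).1) (fun v => (hm v).2.1) fun v => (hm v).2.2).trans ?_
    rw [hnq]
    have h65 : ((2⁻¹ : ℝ≥0∞) ^ k) ^ 6 ≤ (2⁻¹ ^ k) ^ 5 :=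
      pow_le_pow_of_le_one zero_le (pow_le_one₀ zero_le (by simp)) (by norm_num)
    calc _ ≤ ((2⁻¹ : ℝ≥0∞) ^ k) ^ 5 + 4 * (2⁻¹ ^ k) ^ 5 := by gcongr
      _ = _ := by ring
  have hm4 : Measurable fun g : Fin n → Fin d → ℝ =>
      ENNReal.ofReal (((∑ i, ‖perturb y g i‖) / (n * √d)) ^ 4) := by
    unfold perturb
    fun_prop
  have hmS : ∀ k : ℕ, Measurable fun g : Fin n → Fin d → ℝ =>
      (16 : ℝ≥0∞) ^ (k + 1) * smallPairs (perturb y g) (1 / (8 ^ k * M)) := fun k =>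
    (measurable_smallPairs y _).const_mul _
  rw [expectedIterations]
  calc ∫⁻ g, iterations (perturb y g) ∂gaussianNoise n d σ
      ≤ ∫⁻ g, (2 * n + ENNReal.ofReal (12 * (n * √d) * M) *
        (ENNReal.ofReal (((∑ i, ‖perturb y g i‖) / (n * √d)) ^ 4) +
          (1 + ∑' k : ℕ, 16 ^ (k + 1) * smallPairs (perturb y g) (1 / (8 ^ k * M)))))
        ∂gaussianNoise n d σ :=
        lintegral_mono fun g => iterations_le (perturb y g) hM0 (by positivity)
    _ = 2 * n + ENNReal.ofReal (12 * (n * √d) * M) *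
        (∫⁻ g, ENNReal.ofReal (((∑ i, ‖perturb y g i‖) / (n * √d)) ^ 4) ∂gaussianNoise n d σ +
          (1 + ∑' k : ℕ, 16 ^ (k + 1) *
            ∫⁻ g, smallPairs (perturb y g) (1 / (8 ^ k * M)) ∂gaussianNoise n d σ)) := by
        rw [lintegral_add_left measurable_const, lintegral_const, measure_univ, mul_one,
          lintegral_const_mul' _ _ ENNReal.ofReal_ne_top, lintegral_add_left hm4,
          lintegral_add_left measurable_const, lintegral_const, measure_univ, mul_one,
          lintegral_tsum fun k => (hmS k).aemeasurable]
        simp_rw [lintegral_const_mul _ (measurable_smallPairs y _)]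
    _ ≤ 2 * n + ENNReal.ofReal (12 * (n * √d) * M) *
        (776 + (1 + ∑' k : ℕ, 16 ^ (k + 1) * (5 * (2⁻¹ ^ k) ^ 5))) := by
        gcongr with k
        · exact lintegral_sum_norm_pow_le hn (by omega) hσ hσ1 hy
        · exact hsmall k
    -- The constant is 937 = 776 + 1 + 160.
    _ = ENNReal.ofReal (2 * n + 12 * (n * √d) * M * 937) := by
        rw [tsum_sixteen_mul_half, ENNReal.ofReal_add (by positivity) (by positivity),
          ENNReal.ofReal_mul (p := 12 * (n * √d) * M) (by positivity),
          ENNReal.ofReal_mul (p := 2) (by norm_num), ENNReal.ofReal_natCast]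
        norm_num
    _ ≤ ENNReal.ofReal ((2 + 12 * C * 937) * (√d * n ^ 4 / σ ^ 2)) := by
        apply ENNReal.ofReal_le_ofReal
        have h1 : (n : ℝ) ≤ √d * n ^ 4 / σ ^ 2 := by
          rw [le_div_iff₀ (by positivity)]
          calc (n : ℝ) * σ ^ 2 ≤ n * 1 := by gcongr; exact pow_le_one₀ hσ.le hσ1
            _ = 1 * n ^ 1 := by ring
            _ ≤ √d * n ^ 4 := by gcongr; norm_num
        calc 2 * (n : ℝ) + 12 * (n * √d) * M * 937
            ≤ 2 * (√d * n ^ 4 / σ ^ 2) + 12 * (n * √d) * M * 937 := by gcongr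
          _ = _ := by rw [hM]; ring

end TwoOpt

theorem mainTheorem2 :
    ∃ K : ℝ, 0 < K ∧
      ∀ (c : ℝ), 2 ≤ c →
      ∀ (d : ℕ), 3 ≤ d →
      ∀ (n : ℕ) (σ : ℝ), 0 < σ → σ ≤ 1 →
      ∀ (y : Fin n → TwoOpt.Space d), (∀ i j, y i j ∈ Set.Icc (-1 : ℝ) 1) →
        TwoOpt.expectedIterations y σ ≤
          ENNReal.ofReal (K * (Real.sqrt d * TwoOpt.boxSize c σ n ^ 2 * (n : ℝ) ^ 4 / σ ^ 2)) := by
  obtain ⟨K, hK, h⟩ := TwoOpt.exists_expectedIterations_le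
  refine ⟨K, hK, fun c hc d hd n σ hσ hσ1 y hy => ?_⟩
  -- For n = 0 the right-hand side is 0, so it must be shown that no iteration is possible at all.
  rcases Nat.eq_zero_or_pos n with rfl | hn
  · have h0 : ∀ g, TwoOpt.iterations (TwoOpt.perturb y g) = 0 := by
      intro g
      rw [← nonpos_iff_eq_zero]
      refine iSup₂_le fun t ht => ?_
      obtain ⟨T, hT⟩ := ht
      rcases Nat.eq_zero_or_pos t with rfl | ht
      · simp
      · exact absurd (hT 0 ht).1 (TwoOpt.not_isTwoChange_of_le_two (by norm_num))
    rw [TwoOpt.expectedIterations]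
    simp [h0]
  · refine (h d hd n hn σ hσ hσ1 y hy).trans (ENNReal.ofReal_le_ofReal ?_)
    -- The bound already holds without D², so only D ≥ 1 is needed.
    have hD : 1 ≤ TwoOpt.boxSize c σ n ^ 2 := one_le_pow₀ (TwoOpt.one_le_boxSize hc hσ n)
    gcongr
    exact le_mul_of_one_le_right (Real.sqrt_nonneg _) hD
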